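/- **Setting.** Let $H$ be a Hermitian matrix of size at least $2$ with eigenvalues $\lambda_0\le\lambda_1\le\dots$ (listed with multiplicity) and an orthonormal basis of eigenvectors $|\psi_m\rangle$, let $\Delta=\lambda_1-\lambda_0>0$ be its spectral gap, and suppose that $H$ is normalized so that all $\lambda_m\in S:=[-\pi+\Delta/4,\ \pi-\Delta/4]$ (so $\Delta<2\pi$). Let $|\psi\rangle$ be a unit vector with overlap $p_0=|\langle\psi_0|\psi\rangle|^2>0$. *Circuit.* For $t\in\mathbb R$ and $W\in\{I,S_{\rm ph}^\dagger\}$, $S_{\rm ph}=\mathrm{diag}(1,i)$, prepare $|0\rangle|\psi\rangle$, apply a Hadamard gate to the ancilla, the controlled evolution $e^{-itH}$, then $W$ and a Hadamard gate to the ancilla, and measure the ancilla; the recorded value is $\pm1$ ($+1$ for outcome $0$). The evolution time of this circuit is $|t|$. A *sample* at time $t$ consists of one run with $W=I$ (value $X$) and one independent run with $W=S_{\rm ph}^\dagger$ (value $Y$). *Rough-estimation stage.* A rough-estimation procedure takes a fixed number of independent samples at random times drawn from a fixed finite distribution, and computes from them a number $\lambda_{\rm prior}$. Set $I=[-\pi,\lambda_{\rm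 prior}+\Delta/4]$ and $I'=[-\pi,\lambda_{\rm prior}+3\Delta/4]$, which are separated by $D=\Delta/2$. Its maximal evolution time $T_{\max,1}$ is the largest possible $|t|$; its total evolution time $T_{\mathrm{total},1}$ is the number of circuit runs times $T_{\max,1}$. *Algorithm 2.* Given $\lambda_{\rm prior}$, integers $d,N,N_s$ and coefficients $\hat F_l=|\hat F_l|e^{i\phi_l}$, $-d\le l\le d$ (depending on $\lambda_{\rm prior}$), put $\mathcal F=\sum_l|\hat F_l|$, $J=\lceil\log_2(1/\epsilon)\rceil+1$ and $\tau_j=2^{\,j-1-\lceil\log_2(1/\epsilon)\rceil}\,\delta/(N\epsilon)$ for $1\le j\le J$. For each level $j$ and each $0\le n<N$ take $N_s$ independent samples: draw $r\in\{-d,\dots,d\}$ with $\mathbb P(r=l)=|\hat F_l|/\mathcal F$, take a sample $(X,Y)$ at time $r+n\tau_j$, and form $(X+iY)e^{i\phi_r}\mathcal F$; let $Z_{j,n}$ be the average of these $N_s$ values. Starting with the search interval $[-\pi,\pi]$, for $j=1,\dots,J$ let $(r_j^*,\theta_j^*)$ minimize $\frac1N\sum_{n=0}^{N-1}|Z_{j,n}-r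 e^{-i\theta n\tau_j}|^2$ over $r\in\mathbb C$ and $\theta$ in the search interval, and replace the search interval by $[\theta_j^*-\frac{\pi}{2\tau_j},\theta_j^*+\frac{\pi}{2\tau_j}]$. The output is $\theta^*=\theta_J^*$. The maximal evolution time $T_{\max,2}$ of constructing the loss functions is the maximum of $|r+n\tau_j|$ over all $j,n$ and $r\in\{-d,\dots,d\}$; the total evolution time $T_{\mathrm{total},2}$ is the sum of the evolution times of all circuit runs, in the worst case over the shifts $r$, i.e. $T_{\mathrm{total},2}=\sum_{j}\sum_n 2N_s(d+n\tau_j)$. *Notation.* $g=\widetilde\Theta_L(f)$ means $c f\le g\le C f L^k$, with $c,C>0$ and $k\in\mathbb N$ depending only on $\zeta$. Put $L_0=1+\log(p_0^{-1}\delta^{-1})$, $L_1=1+\log(p_0^{-1}\eta^{-1})+\log(1+\Delta^{-1})$, $L_2=1+\log(p_0^{-1}\delta^{-1}\eta^{-1}\epsilon^{-1})+\log(1+\Delta^{-1})$. **Statement.** Fix $\zeta>0$. For all $0<\Delta<2\pi$, $0<p_0\le1$, $0<\delta<1$, $0<\eta<1$ and $0<\epsilon<1/2$ one can choose, depending only on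 these numbers and $\zeta$ (not on $H$ and $|\psi\rangle$), a rough-estimation procedure, integers $d$, $N\ge2$, $N_s$, a number $q$, and for every $\lambda_{\rm prior}$ coefficients $\hat F_l$, with $$d=\widetilde\Theta_{L_0}(\Delta^{-1}),\quad q=\Theta(p_0\delta^2),\quad NN_s=\widetilde\Theta_{L_2}\!\left(p_0^{-2}\delta^{-(2+\zeta)}\right),\quad N_s=\Omega(p_0^{-2}),$$ and moreover $\min\{N,N_s\}=\widetilde\Theta_{L_2}(p_0^{-2})$ if $p_0^{-2}\le\delta^{-(2+\zeta)}$, such that for every $\lambda_{\rm prior}\in[-\pi,\pi-\Delta]$ the filter $F_q(x)=\sum_{l=-d}^{d}\hat F_l e^{-ilx}$ satisfies $|F_q(x)-1|\le q$ on $S\cap I$ and $|F_q(x)|\le q$ on $S\setminus I'$, and such that the following holds. * *Correctness.* For every $H$ and $|\psi\rangle$ as above with spectral gap $\Delta$ and overlap $p_0$: with probability at least $1-\eta$ over both stages, $|\lambda_{\rm prior}-\lambda_0|\le\Delta/4$ and $|\theta^*-\lambda_0|<\epsilon$ (the minimizers exist, and this holds for every choice of them). Moreover, if Algorithm 2 is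 started from any fixed $\lambda_{\rm prior}$ with $|\lambda_{\rm prior}-\lambda_0|\le\Delta/4$, then $\mathbb P(|\theta^*-\lambda_0|<\epsilon)\ge1-\eta$. * *Cost of the rough estimation.* $T_{\max,1}=\widetilde\Theta_{L_1}(\Delta^{-1})$ and $T_{\mathrm{total},1}=\widetilde\Theta_{L_1}(\Delta^{-1}p_0^{-2})$. * *Cost of constructing the loss functions.* $T_{\max,2}=d+(N-1)\tau_J=d+(1-\tfrac1N)\,\delta/\epsilon$ (so $T_{\max,2}\le d+\delta/\epsilon$, with $d=\widetilde\Theta_{L_0}(\Delta^{-1})$), and $T_{\mathrm{total},2}=\widetilde\Theta_{L_2}\!\left(p_0^{-2}\delta^{-(2+\zeta)}(\Delta^{-1}+\delta/\epsilon)\right)$. -/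

import Mathlib

open scoped BigOperators

noncomputable section

namespace QCELS

/-! ## The one-ancilla circuit -/

/-- The state space `ℂ^M` of the system register. -/
abbrev Sys (M : ℕ) := EuclideanSpace ℂ (Fin M)

/-- The Hadamard gate. -/
def hadamardGate : Matrix (Fin 2) (Fin 2) ℂ :=
  ((1 / Real.sqrt 2 : ℝ) : ℂ) • !![1, 1; 1, -1]

/-- The adjoint of the phase gate `S = diag(1, i)`. -/
def sDagger : Matrix (Fin 2) (Fin 2) ℂ := !![1, 0; 0, -Complex.I]

/-- The time evolution `exp(-i t H)`. -/
def evolution {M : ℕ} (H : Matrix (Fin M) (Fin M) ℂ) (t : ℝ) : Matrix (Fin M) (Fin M) ℂ :=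
  NormedSpace.exp ((-(Complex.I * (t : ℂ))) • H)

/-- A joint state of the ancilla qubit and the system is a pair of system vectors
`s 0, s 1`, standing for `|0⟩ ⊗ s 0 + |1⟩ ⊗ s 1`; this is a gate acting on the ancilla. -/
def onAncilla {M : ℕ} (G : Matrix (Fin 2) (Fin 2) ℂ) (s : Fin 2 → Sys M) : Fin 2 → Sys M :=
  fun a => ∑ b, G a b • s b

/-- The gate `U` on the system, controlled by the ancilla. -/
def controlled {M : ℕ} (U : Matrix (Fin M) (Fin M) ℂ) (s : Fin 2 → Sys M) : Fin 2 → Sys M :=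
  ![s 0, Matrix.toEuclideanLin U (s 1)]

/-- The state before the measurement: Hadamard gate on the ancilla, controlled
`exp(-i t H)`, gate `W` on the ancilla, Hadamard gate on the ancilla,
applied to `|0⟩ ⊗ |ψ⟩`. -/
def circuitState {M : ℕ} (H : Matrix (Fin M) (Fin M) ℂ) (ψ : Sys M)
    (W : Matrix (Fin 2) (Fin 2) ℂ) (t : ℝ) : Fin 2 → Sys M :=
  onAncilla hadamardGate (onAncilla W (controlled (evolution H t)
    (onAncilla hadamardGate ![ψ, 0])))

/-- The probability that measuring the ancilla gives the outcome `a`. -/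
def outcomeProb {M : ℕ} (H : Matrix (Fin M) (Fin M) ℂ) (ψ : Sys M)
    (W : Matrix (Fin 2) (Fin 2) ℂ) (t : ℝ) (a : Fin 2) : ℝ :=
  ‖circuitState H ψ W t a‖ ^ 2

/-- The recorded value: `1` for the outcome `0` and `-1` for the outcome `1`. -/
def outcomeValue (a : Fin 2) : ℝ := if a = 0 then 1 else -1

/-- The record of one sample: the index of the randomly drawn evolution time, the outcome
of the circuit with `W = I`, and the outcome of the circuit with `W = S†`. -/
abbrev Sample (K : ℕ) := Fin K × Fin 2 × Fin 2

/-- The probability of a sample, if the index `l` is drawn with probability `p l`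
and both circuits are then run, independently, with evolution time `t l`. -/
def sampleProb {M K : ℕ} (H : Matrix (Fin M) (Fin M) ℂ) (ψ : Sys M)
    (p t : Fin K → ℝ) (s : Sample K) : ℝ :=
  p s.1 * outcomeProb H ψ 1 (t s.1) s.2.1 * outcomeProb H ψ sDagger (t s.1) s.2.2

/-- The probability of the event `E` under the weights `w` on a finite sample space. -/
def prob {Ω : Type} [Fintype Ω] (w : Ω → ℝ) (E : Ω → Prop) : ℝ :=
  ∑ ω, Set.indicator {ω | E ω} w ω

/-! ## Rough estimation -/

/-- A rough-estimation procedure: independent samples of the circuit at random evolution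
times drawn from a finite distribution, and a classical post-processing of the samples. -/
structure RoughEstimator where
  /-- number of possible evolution times -/
  numTimes : ℕ
  /-- the possible evolution times -/
  time : Fin numTimes → ℝ
  /-- the probabilities with which they are drawn -/
  weight : Fin numTimes → ℝ
  weight_pos : ∀ l, 0 < weight l
  weight_sum : ∑ l, weight l = 1
  /-- number of samples -/
  numSamples : ℕ
  /-- the estimate computed from the samples -/
  estimate : (Fin numSamples → Sample numTimes) → ℝ

namespace RoughEstimator

/-- The samples of the rough-estimation stage. -/
abbrev Data (A : RoughEstimator) := Fin A.numSamples → Sample A.numTimes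

/-- The law of the samples. -/
def dataProb (A : RoughEstimator) {M : ℕ} (H : Matrix (Fin M) (Fin M) ℂ) (ψ : Sys M)
    (ω : A.Data) : ℝ :=
  ∏ k, sampleProb H ψ A.weight A.time (ω k)

/-- The maximal evolution time. -/
def maxTime (A : RoughEstimator) : ℝ := ⨆ l, |A.time l|

/-- The total evolution time, in the worst case over the drawn times;
each sample runs two circuits. -/
def totalTime (A : RoughEstimator) : ℝ := 2 * A.numSamples * A.maxTime

end RoughEstimator

/-! ## The eigenvalue filter -/

/-- The integers `-d, ..., d`. -/
def shift (d : ℕ) (l : Fin (2 * d + 1)) : ℤ := (l : ℤ) - (d : ℤ)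

/-- The trigonometric polynomial `∑_{l=-d}^{d} F̂_l exp(-i l x)`; this sign makes the
expectation of the data generated below equal to `⟨ψ| F(H) exp(-i n τ H) |ψ⟩`. -/
def trigPoly {d : ℕ} (F : Fin (2 * d + 1) → ℂ) (x : ℝ) : ℂ :=
  ∑ l, F l * Complex.exp (-(Complex.I * (shift d l : ℂ) * (x : ℂ)))

/-- The interval `I`. -/
def innerInterval (lamPrior Δ : ℝ) : Set ℝ := Set.Icc (-Real.pi) (lamPrior + Δ / 4)

/-- The interval `I'`. -/
def outerInterval (lamPrior Δ : ℝ) : Set ℝ := Set.Icc (-Real.pi) (lamPrior + 3 * Δ / 4)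

/-- The range in which all the eigenvalues are assumed to lie. -/
def spectralRange (Δ : ℝ) : Set ℝ := Set.Icc (-Real.pi + Δ / 4) (Real.pi - Δ / 4)

/-- The filter is within `q` of `1` on `I` and within `q` of `0` off `I'`,
at all points of the spectral range. -/
def IsFilter {d : ℕ} (F : Fin (2 * d + 1) → ℂ) (q lamPrior Δ : ℝ) : Prop :=
  (∀ x ∈ spectralRange Δ ∩ innerInterval lamPrior Δ, ‖trigPoly F x - 1‖ ≤ q) ∧
  (∀ x ∈ spectralRange Δ \ outerInterval lamPrior Δ, ‖trigPoly F x‖ ≤ q)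

/-- `∑_l |F̂_l|`. -/
def filterMass {d : ℕ} (F : Fin (2 * d + 1) → ℂ) : ℝ := ∑ l, ‖F l‖

/-- The distribution `β_l = |F̂_l| / ∑_j |F̂_j|` of the random shift. -/
def shiftProb {d : ℕ} (F : Fin (2 * d + 1) → ℂ) (l : Fin (2 * d + 1)) : ℝ :=
  ‖F l‖ / filterMass F

/-! ## Multi-level QCELS with filtered data -/

/-- The number `J` of levels. -/
def numLevels (ε : ℝ) : ℕ := ⌈Real.logb 2 (1 / ε)⌉₊ + 1

/-- The time steps `τ_j`; levels are numbered from `0`, so that `timeStep δ ε N j` is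
the time step of the `(j+1)`-st level. -/
def timeStep (δ ε : ℝ) (N : ℕ) (j : ℕ) : ℝ :=
  (2 : ℝ) ^ ((j : ℤ) - (⌈Real.logb 2 (1 / ε)⌉₊ : ℤ)) * (δ / (N * ε))

/-- All the samples taken by the data generator: sample `k` for the data point `n`
at level `j`. -/
abbrev FilteredData (J N Ns d : ℕ) := Fin J → Fin N → Fin Ns → Sample (2 * d + 1)

/-- The law of the samples: they are independent, with evolution time `r + n τ_j`,
where `r` has the distribution `β`. -/
def filteredDataProb {M J N Ns d : ℕ} (H : Matrix (Fin M) (Fin M) ℂ) (ψ : Sys M)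
    (τ : ℕ → ℝ) (F : Fin (2 * d + 1) → ℂ) (ω : FilteredData J N Ns d) : ℝ :=
  ∏ j : Fin J, ∏ n : Fin N, ∏ k : Fin Ns,
    sampleProb H ψ (shiftProb F) (fun l => (shift d l : ℝ) + (n : ℕ) * τ j) (ω j n k)

/-- The value `Z_{k,n,q}` of one sample. -/
def sampleValue {d : ℕ} (F : Fin (2 * d + 1) → ℂ) (s : Sample (2 * d + 1)) : ℂ :=
  ((outcomeValue s.2.1 : ℂ) + Complex.I * (outcomeValue s.2.2 : ℂ)) *
    Complex.exp (Complex.I * (Complex.arg (F s.1) : ℂ)) * (filterMass F : ℂ)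

/-- The data point `Z_{n,q}` at level `j`. -/
def dataPoint {J N Ns d : ℕ} (F : Fin (2 * d + 1) → ℂ) (ω : FilteredData J N Ns d)
    (j : Fin J) (n : Fin N) : ℂ :=
  (1 / (Ns : ℂ)) * ∑ k, sampleValue F (ω j n k)

/-- The loss function. -/
def loss {N : ℕ} (Z : Fin N → ℂ) (τ : ℝ) (r : ℂ) (θ : ℝ) : ℝ :=
  (1 / (N : ℝ)) * ∑ n : Fin N,
    ‖Z n - r * Complex.exp (-(Complex.I * (θ : ℂ) * ((n : ℕ) : ℂ) * (τ : ℂ)))‖ ^ 2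

/-- The search interval for `θ` at each level: `[-π, π]` at the first level, and
`[θ_j - π/(2τ_j), θ_j + π/(2τ_j)]` after level `j`. -/
def searchInterval (τ θ : ℕ → ℝ) : ℕ → Set ℝ
  | 0 => Set.Icc (-Real.pi) Real.pi
  | j + 1 => Set.Icc (θ j - Real.pi / (2 * τ j)) (θ j + Real.pi / (2 * τ j))

/-- `(r, θ)` is a possible sequence of minimizers in the run of the algorithm
on the data `Z`. -/
def IsRun {J N : ℕ} (τ : ℕ → ℝ) (Z : Fin J → Fin N → ℂ) (r : ℕ → ℂ) (θ : ℕ → ℝ) : Prop :=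
  ∀ j : Fin J, θ j ∈ searchInterval τ θ j ∧
    ∀ r' : ℂ, ∀ θ' ∈ searchInterval τ θ j,
      loss (Z j) (τ j) (r j) (θ j) ≤ loss (Z j) (τ j) r' θ'

/-- The algorithm runs on the data `Z`, and its output, the last `θ`, is less than `ε` away
from `lam0` for every choice of the minimizers. -/
def Succeeds {J N : ℕ} (τ : ℕ → ℝ) (Z : Fin J → Fin N → ℂ) (ε lam0 : ℝ) : Prop :=
  (∃ r θ, IsRun τ Z r θ) ∧ ∀ r θ, IsRun τ Z r θ → |θ (J - 1) - lam0| < ε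

/-- The maximal evolution time for the construction of the loss functions: the largest of all
the durations `|r + n τ_j|`. -/
def lossMaxTime (J N d : ℕ) (τ : ℕ → ℝ) : ℝ :=
  ⨆ i : Fin J × Fin N × Fin (2 * d + 1), |(shift d i.2.2 : ℝ) + (i.2.1 : ℕ) * τ i.1|

/-- The total evolution time for the construction of the loss functions, in the worst case
over the random shifts `r`; each of the `Ns` samples runs two circuits. -/
def lossTotalTime (J N Ns d : ℕ) (τ : ℕ → ℝ) : ℝ :=
  ∑ j : Fin J, ∑ n : Fin N,
    2 * (Ns : ℝ) * ⨆ l : Fin (2 * d + 1), |(shift d l : ℝ) + (n : ℕ) * τ j|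

/-! ## Asymptotic notation -/

/-- `g = Θ̃(f)` with constants `c`, `C` and the polylogarithmic factor `L ^ k`, where `L ≥ 1`. -/
def ThetaTilde (c C : ℝ) (k : ℕ) (L f g : ℝ) : Prop := c * f ≤ g ∧ g ≤ C * f * L ^ k

end QCELS

end

/-! The circuits measure the real and imaginary parts of `∑ p_m exp(-i t λ_m)` (`outcomeProb_one`,
`outcomeProb_sDagger`). Averaging over random time shifts, weighted by the Fourier coefficients of a
function F, therefore estimates the same signal with mode m multiplied by F(λ_m) (`sum_mul_signal`).
Both stages use one family of filters: the indicator of [-π, b] convolved with a power of the Fejér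
kernel (`stepFilter`). A transition of width w with error q costs degree O(w⁻¹ log(1/q))
(`kernel_tail_ratio_le`). The coefficients decay like 1/(1+|l|) (`norm_stepFilter_le`), so their ℓ¹
norm, which sets the size of the statistical noise, is only logarithmic in the degree.

Rough stage (`abs_gridPoint_sub_le`). Letting b run over a grid of spacing Δ/8 estimates the
spectral distribution function, which vanishes below λ₀ and jumps by p₀ there. The first grid point
where the estimate reaches p₀/2 is within Δ/4 of λ₀. The same samples serve all grid points.

Second stage. With the cut placed in the gap, the data are p₀ exp(-i λ₀ n τ) plus a bias O(p₀δ²)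
plus noise. Eliminating r turns the minimization of the loss into the maximization of the modulus of
a correlation (`loss_eq`). At offset y = (θ-λ₀)τ with N|y| ≤ 2π, the correlation of the pure mode
drops by a fraction of order (N|y|)² (`sum_cos_phase_mem`), while by Abel summation the noise term
changes by at most a multiple of N|y| times the largest partial sum of the noise
(`norm_sum_mul_phase_sub_le`). Noise of size p₀/20 at single points is harmless; only the partial
sums must be small, of size N p₀ δ, and these profit from averaging over n. Up to logarithms N_s ~
p₀⁻² and N ≥ δ⁻² suffice. Comparing quadratic with linear gives N|y| < δ (`mul_abs_lt_of_norm_le`).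

This accuracy excludes aliases when τ is doubled, so it propagates through the levels, and Nτ = δ/ε
at the last one turns it into error ε (`GoodData.succeeds`). Hoeffding's inequality and union bounds
supply the good events; their logarithms, the ℓ¹ norm and the number of levels make up the
polylogarithmic factors. -/

namespace QCELS

/-! ## Outcome probabilities of the circuit -/

section Circuit

-- The exponential series is pushed through the continuous additive map `B ↦ B x`; its terms become
-- those of the scalar series, and sums are unique. The operator norm is there for the convergence
-- of the matrix series.
open scoped Matrix.Norms.Operator in
theorem exp_mulVec_of_eigenvector {M : ℕ} (A : Matrix (Fin M) (Fin M) ℂ) (x : Fin M → ℂ) (μ : ℂ)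
    (h : A.mulVec x = μ • x) : (NormedSpace.exp A).mulVec x = Complex.exp μ • x := by
  have hpow : ∀ n : ℕ, (A ^ n).mulVec x = μ ^ n • x := by
    intro n
    induction n with
    | zero => simp
    | succ n ih =>
      rw [pow_succ, ← Matrix.mulVec_mulVec, h, Matrix.mulVec_smul, ih, smul_smul, pow_succ, mul_comm]
  have h1 := NormedSpace.exp_series_hasSum_exp' (𝕂 := ℂ) A
  let φ : Matrix (Fin M) (Fin M) ℂ →+ (Fin M → ℂ) :=
    { toFun := fun B => B.mulVec x
      map_zero' := by simp
      map_add' := fun B C => Matrix.add_mulVec B C x }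
  have hφ : Continuous φ := by
    change Continuous fun B : Matrix (Fin M) (Fin M) ℂ => B.mulVec x
    fun_prop
  have h2 := h1.map φ hφ
  have h3 := (NormedSpace.exp_series_hasSum_exp' (𝕂 := ℂ) μ).smul_const x
  have h4 : (φ ∘ fun n : ℕ => ((n.factorial : ℂ)⁻¹) • A ^ n)
      = fun n : ℕ => (((n.factorial : ℂ)⁻¹) • μ ^ n) • x := by
    funext n
    change ((((n.factorial : ℂ)⁻¹) • A ^ n)).mulVec x = _
    rw [Matrix.smul_mulVec, hpow, smul_smul, smul_eq_mul]
  rw [h4] at h2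
  have := h2.unique h3
  rw [Complex.exp_eq_exp_ℂ]
  exact this

variable {M : ℕ} {H : Matrix (Fin M) (Fin M) ℂ} {lam : Fin M → ℝ}
  {v : OrthonormalBasis (Fin M) ℂ (Sys M)} {ψ : Sys M}

/-- The function `t ↦ ∑ m, p m * exp (-i t lam m)`. -/
noncomputable def signal (p lam : Fin M → ℝ) (t : ℝ) : ℂ :=
  ∑ m, (p m : ℂ) * Complex.exp (-(Complex.I * (t : ℂ) * (lam m : ℂ)))

theorem evolution_eigenvector (h : ∀ m, Matrix.toEuclideanLin H (v m) = (lam m : ℂ) • v m)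
    (t : ℝ) (m : Fin M) :
    Matrix.toEuclideanLin (evolution H t) (v m)
      = Complex.exp (-(Complex.I * (t : ℂ) * (lam m : ℂ))) • v m := by
  have h1 : H.mulVec (v m).ofLp = (lam m : ℂ) • (v m).ofLp := by
    have := congrArg WithLp.ofLp (h m)
    simpa [Matrix.toEuclideanLin] using this
  have h2 := exp_mulVec_of_eigenvector ((-(Complex.I * (t : ℂ))) • H) (v m).ofLp
    (-(Complex.I * (t : ℂ) * (lam m : ℂ))) (by
      rw [Matrix.smul_mulVec, h1, smul_smul]; congr 1; ring)
  apply (WithLp.equiv 2 (Fin M → ℂ)).injective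
  simpa [Matrix.toEuclideanLin, evolution] using h2

theorem inner_basis_evolution (h : ∀ m, Matrix.toEuclideanLin H (v m) = (lam m : ℂ) • v m)
    (t : ℝ) (m : Fin M) :
    inner ℂ (v m) (Matrix.toEuclideanLin (evolution H t) ψ)
      = Complex.exp (-(Complex.I * (t : ℂ) * (lam m : ℂ))) * inner ℂ (v m) ψ := by
  have h1 : Matrix.toEuclideanLin (evolution H t) ψ = ∑ k, inner ℂ (v k) ψ •
      (Complex.exp (-(Complex.I * (t : ℂ) * (lam k : ℂ))) • v k) := by
    conv_lhs => rw [← v.sum_repr' ψ]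
    rw [map_sum]
    refine Finset.sum_congr rfl fun k _ => ?_
    rw [map_smul, evolution_eigenvector h]
  rw [h1, inner_sum]
  simp only [inner_smul_right, v.inner_eq_ite]
  simp [mul_comm]

theorem norm_exp_neg_I_mul (t x : ℝ) :
    ‖Complex.exp (-(Complex.I * (t : ℂ) * (x : ℂ)))‖ = 1 := by
  have : -(Complex.I * (t : ℂ) * (x : ℂ)) = ((-(t * x) : ℝ) : ℂ) * Complex.I := by
    push_cast; ring
  rw [this, Complex.norm_exp_ofReal_mul_I]

theorem norm_evolution (h : ∀ m, Matrix.toEuclideanLin H (v m) = (lam m : ℂ) • v m) (t : ℝ) :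
    ‖Matrix.toEuclideanLin (evolution H t) ψ‖ = ‖ψ‖ := by
  have h1 := v.sum_sq_norm_inner_right (Matrix.toEuclideanLin (evolution H t) ψ)
  have h2 := v.sum_sq_norm_inner_right ψ
  simp only [inner_basis_evolution h, norm_mul, norm_exp_neg_I_mul, one_mul] at h1
  have : ‖Matrix.toEuclideanLin (evolution H t) ψ‖ ^ 2 = ‖ψ‖ ^ 2 := by rw [← h1, ← h2]
  exact (pow_left_inj₀ (norm_nonneg _) (norm_nonneg _) two_ne_zero).1 this

theorem inner_evolution (h : ∀ m, Matrix.toEuclideanLin H (v m) = (lam m : ℂ) • v m) (t : ℝ) :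
    inner ℂ ψ (Matrix.toEuclideanLin (evolution H t) ψ)
      = signal (fun m => ‖inner ℂ (v m) ψ‖ ^ 2) lam t := by
  rw [← v.sum_inner_mul_inner]
  unfold signal
  refine Finset.sum_congr rfl fun m _ => ?_
  rw [inner_basis_evolution h, ← inner_conj_symm ψ (v m)]
  have := Complex.conj_mul' (inner ℂ (v m) ψ)
  push_cast
  rw [← this]; ring

theorem norm_add_smul_sq {x y : Sys M} (hx : ‖x‖ = 1) (hy : ‖y‖ = 1) (w : ℂ) (hw : ‖w‖ = 1) :
    ‖(1 / 2 : ℂ) • (x + w • y)‖ ^ 2 = (1 + (w * inner ℂ x y).re) / 2 := by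
  rw [norm_smul, mul_pow, @norm_add_sq ℂ, inner_smul_right, norm_smul, hw, hx, hy]
  norm_num
  ring

/-- Both choices of the gate are of the form diag(1, w), so one computation serves the two circuits:
w = 1 will expose the real part of the overlap of ψ with its evolution, w = -i the imaginary part.
-/
theorem circuitState_eq (w : ℂ) (t : ℝ) (a : Fin 2) :
    circuitState H ψ !![1, 0; 0, w] t a
      = (1 / 2 : ℂ) • (ψ + (outcomeValue a * w : ℂ) •
          Matrix.toEuclideanLin (evolution H t) ψ) := by
  have h2 : (((1 / Real.sqrt 2 : ℝ) : ℂ)) * ((1 / Real.sqrt 2 : ℝ) : ℂ) = 1 / 2 := by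
    rw [← Complex.ofReal_mul]
    have : (1 / Real.sqrt 2) * (1 / Real.sqrt 2) = 1 / 2 := by
      rw [div_mul_div_comm, Real.mul_self_sqrt (by norm_num)]; norm_num
    rw [this]; push_cast; rfl
  set s : ℂ := ((1 / Real.sqrt 2 : ℝ) : ℂ) with hs
  fin_cases a <;>
    simp [circuitState, onAncilla, controlled, hadamardGate, Fin.sum_univ_two, outcomeValue,
      ← hs, smul_smul, -one_div, -Complex.ofReal_div] <;>
    rw [← smul_smul, ← h2] <;> module

theorem outcomeProb_one (h : ∀ m, Matrix.toEuclideanLin H (v m) = (lam m : ℂ) • v m)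
    (hψ : ‖ψ‖ = 1) (t : ℝ) (a : Fin 2) :
    outcomeProb H ψ 1 t a
      = (1 + outcomeValue a * (signal (fun m => ‖inner ℂ (v m) ψ‖ ^ 2) lam t).re) / 2 := by
  have h1 : (1 : Matrix (Fin 2) (Fin 2) ℂ) = !![1, 0; 0, 1] := Matrix.one_fin_two
  have hn : ‖((outcomeValue a : ℂ) * 1)‖ = 1 := by
    unfold outcomeValue; split_ifs <;> simp
  rw [outcomeProb, h1, circuitState_eq,
    norm_add_smul_sq hψ ((norm_evolution h t).trans hψ) _ hn, inner_evolution h]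
  simp

theorem outcomeProb_sDagger (h : ∀ m, Matrix.toEuclideanLin H (v m) = (lam m : ℂ) • v m)
    (hψ : ‖ψ‖ = 1) (t : ℝ) (a : Fin 2) :
    outcomeProb H ψ sDagger t a
      = (1 + outcomeValue a * (signal (fun m => ‖inner ℂ (v m) ψ‖ ^ 2) lam t).im) / 2 := by
  have hn : ‖((outcomeValue a : ℂ) * (-Complex.I))‖ = 1 := by
    unfold outcomeValue; split_ifs <;> simp
  rw [outcomeProb, sDagger, circuitState_eq,
    norm_add_smul_sq hψ ((norm_evolution h t).trans hψ) _ hn, inner_evolution h]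
  simp

end Circuit

/-! ## The mean of a sample -/

section Sample

variable {M K : ℕ} {H : Matrix (Fin M) (Fin M) ℂ} {ψ : Sys M}

/-- The circuits applied to `H` and `ψ` measure the real and imaginary parts of `g`. -/
def Measures (H : Matrix (Fin M) (Fin M) ℂ) (ψ : Sys M) (g : ℝ → ℂ) : Prop :=
  ∀ t a, outcomeProb H ψ 1 t a = (1 + outcomeValue a * (g t).re) / 2 ∧
    outcomeProb H ψ sDagger t a = (1 + outcomeValue a * (g t).im) / 2

theorem sampleProb_nonneg {p t : Fin K → ℝ} (hp : ∀ l, 0 ≤ p l) (s : Sample K) :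
    0 ≤ sampleProb H ψ p t s :=
  mul_nonneg (mul_nonneg (hp _) (sq_nonneg _)) (sq_nonneg _)

theorem sum_sampleProb {g : ℝ → ℂ} (hg : Measures H ψ g) {p t : Fin K → ℝ}
    (hp : ∑ l, p l = 1) : ∑ s, sampleProb H ψ p t s = 1 := by
  rw [Fintype.sum_prod_type, ← hp]
  refine Finset.sum_congr rfl fun l _ => ?_
  simp only [Fintype.sum_prod_type, Fin.sum_univ_two, sampleProb, (hg _ _).1, (hg _ _).2,
    outcomeValue]
  simp
  ring

/-- The value `a l * (X + i Y)` computed from a sample. -/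
noncomputable def weightedValue (a : Fin K → ℂ) (s : Sample K) : ℂ :=
  a s.1 * ((outcomeValue s.2.1 : ℂ) + Complex.I * (outcomeValue s.2.2 : ℂ))

/-- Given the drawn index, X and Y have means Re g and Im g, so X + iY is an unbiased estimate of g.
-/
theorem sum_sampleProb_mul_weightedValue {g : ℝ → ℂ} (hg : Measures H ψ g) (p t : Fin K → ℝ)
    (a : Fin K → ℂ) :
    ∑ s, (sampleProb H ψ p t s : ℂ) * weightedValue a s = ∑ l, (p l : ℂ) * a l * g (t l) := by
  rw [Fintype.sum_prod_type]
  refine Finset.sum_congr rfl fun l _ => ?_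
  simp only [Fintype.sum_prod_type, Fin.sum_univ_two, sampleProb, (hg _ _).1, (hg _ _).2,
    outcomeValue, weightedValue]
  have hre := Complex.re_add_im (g (t l))
  simp
  linear_combination (p l : ℂ) * a l * hre

theorem norm_weightedValue_le (a : Fin K → ℂ) {B : ℝ} (ha : ∀ l, ‖a l‖ ≤ B) (s : Sample K) :
    ‖weightedValue a s‖ ≤ 2 * B := by
  have h1 : ‖(outcomeValue s.2.1 : ℂ) + Complex.I * (outcomeValue s.2.2 : ℂ)‖ ≤ 2 := by
    refine (norm_add_le _ _).trans ?_
    have : ∀ a : Fin 2, ‖(outcomeValue a : ℂ)‖ = 1 := by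
      intro a; unfold outcomeValue; split_ifs <;> simp
    rw [norm_mul, this, this]; simp; norm_num
  rw [weightedValue, norm_mul, mul_comm]
  exact mul_le_mul h1 (ha _) (norm_nonneg _) (by norm_num)

end Sample

/-! ## Finite probability spaces and a Hoeffding bound -/

section Prob

variable {Ω : Type} [Fintype Ω] {w : Ω → ℝ}

theorem prob_mono (hw : ∀ ω, 0 ≤ w ω) {E E' : Ω → Prop} (h : ∀ ω, E ω → E' ω) :
    prob w E ≤ prob w E' :=
  Finset.sum_le_sum fun ω _ =>
    Set.indicator_le_indicator_of_subset (fun _ hω => h _ hω) (fun ω => hw ω) ω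

theorem prob_or_le (hw : ∀ ω, 0 ≤ w ω) (E E' : Ω → Prop) :
    prob w (fun ω => E ω ∨ E' ω) ≤ prob w E + prob w E' := by
  classical
  unfold prob
  rw [← Finset.sum_add_distrib]
  refine Finset.sum_le_sum fun ω _ => ?_
  have := hw ω
  by_cases h1 : E ω <;> by_cases h2 : E' ω <;> simp [h1, h2, this]

theorem prob_exists_le (hw : ∀ ω, 0 ≤ w ω) {κ : Type*} [Fintype κ] (E : κ → Ω → Prop) :
    prob w (fun ω => ∃ i, E i ω) ≤ ∑ i, prob w (E i) := by
  classical
  unfold prob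
  rw [Finset.sum_comm]
  refine Finset.sum_le_sum fun ω _ => ?_
  by_cases h : ∃ i, E i ω
  · obtain ⟨i, hi⟩ := h
    rw [Set.indicator_of_mem (show ω ∈ {ω | ∃ i, E i ω} from ⟨i, hi⟩)]
    calc w ω = Set.indicator {ω | E i ω} w ω := (Set.indicator_of_mem (by exact hi) w).symm
      _ ≤ _ := Finset.single_le_sum
        (f := fun i => Set.indicator {ω | E i ω} w ω)
        (fun i _ => Set.indicator_nonneg (fun ω _ => hw ω) ω) (Finset.mem_univ i)
  · rw [Set.indicator_of_notMem (by exact h)]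
    exact Finset.sum_nonneg fun i _ => Set.indicator_nonneg (fun ω _ => hw ω) ω

theorem prob_exists_le_card_mul (hw : ∀ ω, 0 ≤ w ω) {κ : Type*} [Fintype κ]
    (E : κ → Ω → Prop) {b : ℝ} (hb : ∀ i, prob w (E i) ≤ b) :
    prob w (fun ω => ∃ i, E i ω) ≤ Fintype.card κ * b := by
  refine (prob_exists_le hw E).trans ((Finset.sum_le_sum fun i _ => hb i).trans ?_)
  simp

theorem prob_not (h1 : ∑ ω, w ω = 1) (E : Ω → Prop) :
    prob w E = 1 - prob w (fun ω => ¬ E ω) := by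
  classical
  rw [eq_sub_iff_add_eq, ← h1]
  unfold prob
  rw [← Finset.sum_add_distrib]
  refine Finset.sum_congr rfl fun ω _ => ?_
  by_cases h : E ω <;> simp [h]

/-- If an event fails only when a member of a finite family of unlikely events happens,
then it is likely. -/
theorem one_sub_le_prob (hw : ∀ ω, 0 ≤ w ω) (h1 : ∑ ω, w ω = 1) {E B : Ω → Prop}
    (h : ∀ ω, ¬ B ω → E ω) : 1 - prob w B ≤ prob w E := by
  rw [prob_not h1 E]
  have := prob_mono hw (E := fun ω => ¬ E ω) (E' := B) fun ω hω => by
    by_contra hB; exact hω (h ω hB)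
  linarith

theorem prob_equiv {Ω' : Type} [Fintype Ω'] (e : Ω ≃ Ω') (w : Ω' → ℝ) (E : Ω' → Prop) :
    prob (fun ω => w (e ω)) (fun ω => E (e ω)) = prob w E := by
  unfold prob
  exact Fintype.sum_equiv e _ _ fun ω => rfl

/-- Hoeffding's lemma for a symmetric range: by convexity the exponential lies below its chord over
[-b, b], the mean-zero condition removes the linear term of the chord, and cosh x ≤ exp(x²/2). -/
theorem sum_mul_exp_le_of_mean_zero (hw : ∀ ω, 0 ≤ w ω) (h1 : ∑ ω, w ω = 1) {f : Ω → ℝ} {b : ℝ}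
    (hf : ∀ ω, |f ω| ≤ b) (h0 : ∑ ω, w ω * f ω = 0) (s : ℝ) :
    ∑ ω, w ω * Real.exp (s * f ω) ≤ Real.exp (s ^ 2 * b ^ 2 / 2) := by
  have hne : Nonempty Ω := by
    by_contra h
    rw [not_nonempty_iff] at h
    simp at h1
  have hb0 : 0 ≤ b := (abs_nonneg _).trans (hf hne.some)
  rcases hb0.eq_or_lt with hb | hb
  · have : ∀ ω, f ω = 0 := fun ω => by
      have := hf ω
      rw [← hb] at this
      exact abs_nonpos_iff.1 this
    simp [this, h1, ← hb]
  have key : ∀ ω, Real.exp (s * f ω) ≤ Real.cosh (s * b) + f ω / b * Real.sinh (s * b) := by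
    intro ω
    obtain ⟨hl, hu⟩ := abs_le.1 (hf ω)
    have h' : -1 ≤ f ω / b := by rw [le_div_iff₀ hb]; linarith
    have h'' : f ω / b ≤ 1 := by rw [div_le_iff₀ hb]; linarith
    have hx : 0 ≤ (1 + f ω / b) / 2 := by linarith
    have hy : 0 ≤ (1 - f ω / b) / 2 := by linarith
    have h := convexOn_exp.2 (Set.mem_univ (s * b)) (Set.mem_univ (-(s * b))) hx hy (by ring)
    have e : (1 + f ω / b) / 2 * (s * b) + (1 - f ω / b) / 2 * (-(s * b)) = s * f ω := by
      field_simp; ring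
    simp only [smul_eq_mul] at h
    rw [e] at h
    refine h.trans (le_of_eq ?_)
    rw [Real.cosh_eq, Real.sinh_eq]; ring
  calc ∑ ω, w ω * Real.exp (s * f ω)
      ≤ ∑ ω, w ω * (Real.cosh (s * b) + f ω / b * Real.sinh (s * b)) :=
        Finset.sum_le_sum fun ω _ => mul_le_mul_of_nonneg_left (key ω) (hw ω)
    _ = (∑ ω, w ω) * Real.cosh (s * b) + (∑ ω, w ω * f ω) * (Real.sinh (s * b) / b) := by
        rw [Finset.sum_mul, Finset.sum_mul, ← Finset.sum_add_distrib]
        refine Finset.sum_congr rfl fun ω _ => ?_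
        ring
    _ = Real.cosh (s * b) := by rw [h1, h0]; ring
    _ ≤ Real.exp ((s * b) ^ 2 / 2) := Real.cosh_le_exp_half_sq _
    _ = _ := by rw [mul_pow]

end Prob

/-! ### Chernoff and Hoeffding bounds for independent variables -/

section Product

variable {ι Ω : Type} [Fintype ι] [DecidableEq ι] [Fintype Ω] {w : ι → Ω → ℝ}

theorem sum_prod_eq_one (h1 : ∀ i, ∑ x, w i x = 1) : ∑ ω : ι → Ω, ∏ i, w i (ω i) = 1 := by
  have := Finset.prod_univ_sum (fun _ : ι => (Finset.univ : Finset Ω)) (fun i x => w i x)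
  rw [Fintype.piFinset_univ] at this
  rw [← this]; simp [h1]

theorem prob_sum_ge_le (hw : ∀ i x, 0 ≤ w i x) (h1 : ∀ i, ∑ x, w i x = 1)
    {f : ι → Ω → ℝ} {b : ι → ℝ} (hf : ∀ i x, |f i x| ≤ b i) (h0 : ∀ i, ∑ x, w i x * f i x = 0)
    {V t : ℝ} (hV : 0 < V) (hb : ∑ i, b i ^ 2 ≤ V) (ht : 0 ≤ t) :
    prob (fun ω : ι → Ω => ∏ i, w i (ω i)) (fun ω => t ≤ ∑ i, f i (ω i))
      ≤ Real.exp (-(t ^ 2 / (2 * V))) := by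
  -- This s minimizes the Chernoff exponent -st + s²V/2.
  set s := t / V with hs
  have hs0 : 0 ≤ s := div_nonneg ht hV.le
  have step : ∀ ω : ι → Ω, Set.indicator {ω : ι → Ω | t ≤ ∑ i, f i (ω i)}
      (fun ω => ∏ i, w i (ω i)) ω
      ≤ Real.exp (-(s * t)) * ∏ i, (w i (ω i) * Real.exp (s * f i (ω i))) := by
    intro ω
    have hp : 0 ≤ ∏ i, w i (ω i) := Finset.prod_nonneg fun i _ => hw _ _
    have e : Real.exp (-(s * t)) * ∏ i, (w i (ω i) * Real.exp (s * f i (ω i)))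
        = (∏ i, w i (ω i)) * Real.exp (s * (∑ i, f i (ω i) - t)) := by
      rw [Finset.prod_mul_distrib, ← Real.exp_sum, ← Finset.mul_sum, mul_sub, sub_eq_add_neg,
        Real.exp_add]
      ring
    rw [e]
    by_cases h : ω ∈ {ω : ι → Ω | t ≤ ∑ i, f i (ω i)}
    · rw [Set.indicator_of_mem h]
      refine le_mul_of_one_le_right hp (Real.one_le_exp (mul_nonneg hs0 ?_))
      exact sub_nonneg.2 h
    · rw [Set.indicator_of_notMem h]
      exact mul_nonneg hp (Real.exp_pos _).le
  calc prob (fun ω : ι → Ω => ∏ i, w i (ω i)) (fun ω => t ≤ ∑ i, f i (ω i))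
      ≤ ∑ ω : ι → Ω, Real.exp (-(s * t)) * ∏ i, (w i (ω i) * Real.exp (s * f i (ω i))) :=
        Finset.sum_le_sum fun ω _ => step ω
    _ = Real.exp (-(s * t)) * ∏ i, ∑ x, w i x * Real.exp (s * f i x) := by
        rw [← Finset.mul_sum, Finset.prod_univ_sum, Fintype.piFinset_univ]
    _ ≤ Real.exp (-(s * t)) * ∏ i, Real.exp (s ^ 2 * b i ^ 2 / 2) := by
        refine mul_le_mul_of_nonneg_left ?_ (Real.exp_pos _).le
        refine Finset.prod_le_prod (fun i _ => Finset.sum_nonneg fun x _ =>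
          mul_nonneg (hw _ _) (Real.exp_pos _).le) fun i _ => ?_
        exact sum_mul_exp_le_of_mean_zero (hw i) (h1 i) (hf i) (h0 i) s
    _ = Real.exp (-(s * t) + s ^ 2 * (∑ i, b i ^ 2) / 2) := by
        rw [← Real.exp_sum, ← Real.exp_add, Finset.mul_sum, Finset.sum_div]
    _ ≤ Real.exp (-(t ^ 2 / (2 * V))) := by
        rw [Real.exp_le_exp]
        have h2 : s ^ 2 * (∑ i, b i ^ 2) / 2 ≤ s ^ 2 * V / 2 := by gcongr
        have h3 : -(s * t) + s ^ 2 * V / 2 = -(t ^ 2 / (2 * V)) := by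
          rw [hs]; field_simp; ring
        linarith

theorem prob_abs_sum_ge_le (hw : ∀ i x, 0 ≤ w i x) (h1 : ∀ i, ∑ x, w i x = 1)
    {f : ι → Ω → ℝ} {b : ι → ℝ} (hf : ∀ i x, |f i x| ≤ b i) (h0 : ∀ i, ∑ x, w i x * f i x = 0)
    {V t : ℝ} (hV : 0 < V) (hb : ∑ i, b i ^ 2 ≤ V) (ht : 0 ≤ t) :
    prob (fun ω : ι → Ω => ∏ i, w i (ω i)) (fun ω => t ≤ |∑ i, f i (ω i)|)
      ≤ 2 * Real.exp (-(t ^ 2 / (2 * V))) := by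
  have hp : ∀ ω : ι → Ω, 0 ≤ ∏ i, w i (ω i) := fun ω => Finset.prod_nonneg fun i _ => hw _ _
  have hA := prob_sum_ge_le hw h1 hf h0 hV hb ht
  have hB := prob_sum_ge_le hw h1 (f := fun i x => -f i x) (b := b)
    (fun i x => by rw [abs_neg]; exact hf i x)
    (fun i => by simp [h0 i]) hV hb ht
  have hor := (prob_mono hp (E := fun ω => t ≤ |∑ i, f i (ω i)|)
    (E' := fun ω => t ≤ ∑ i, f i (ω i) ∨ t ≤ ∑ i, -f i (ω i)) fun ω h => by
      rw [Finset.sum_neg_distrib]; exact le_abs.1 h).trans (prob_or_le hp _ _)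
  linarith

/-- A complex number of modulus at least 2t has real or imaginary part of modulus at least t; two
signs for each of the two parts give the factor 4. -/
theorem prob_norm_sum_ge_le (hw : ∀ i x, 0 ≤ w i x) (h1 : ∀ i, ∑ x, w i x = 1)
    {f : ι → Ω → ℂ} {b : ι → ℝ} (hf : ∀ i x, ‖f i x‖ ≤ b i)
    (h0 : ∀ i, ∑ x, (w i x : ℂ) * f i x = 0)
    {V t : ℝ} (hV : 0 < V) (hb : ∑ i, b i ^ 2 ≤ V) (ht : 0 ≤ t) :
    prob (fun ω : ι → Ω => ∏ i, w i (ω i)) (fun ω => 2 * t ≤ ‖∑ i, f i (ω i)‖)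
      ≤ 4 * Real.exp (-(t ^ 2 / (2 * V))) := by
  have hp : ∀ ω : ι → Ω, 0 ≤ ∏ i, w i (ω i) := fun ω => Finset.prod_nonneg fun i _ => hw _ _
  have hA := prob_abs_sum_ge_le hw h1 (f := fun i x => (f i x).re) (b := b)
    (fun i x => (Complex.abs_re_le_norm _).trans (hf i x))
    (fun i => by simpa using congrArg Complex.re (h0 i)) hV hb ht
  have hB := prob_abs_sum_ge_le hw h1 (f := fun i x => (f i x).im) (b := b)
    (fun i x => (Complex.abs_im_le_norm _).trans (hf i x))
    (fun i => by simpa using congrArg Complex.im (h0 i)) hV hb ht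
  have hor := (prob_mono hp (E := fun ω => 2 * t ≤ ‖∑ i, f i (ω i)‖)
    (E' := fun ω => t ≤ |∑ i, (f i (ω i)).re| ∨ t ≤ |∑ i, (f i (ω i)).im|) fun ω h => by
      have := Complex.norm_le_abs_re_add_abs_im (∑ i, f i (ω i))
      rw [Complex.re_sum, Complex.im_sum] at this
      by_contra! hc
      linarith [hc.1, hc.2]).trans (prob_or_le hp _ _)
  linarith

end Product

/-! ## The filter -/

section Dirichlet

/-- The exponential sum `∑_{k < M} exp (i k x)`. -/
noncomputable def dirichletSum (M : ℕ) (x : ℝ) : ℂ :=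
  ∑ k ∈ Finset.range M, Complex.exp (Complex.I * (k : ℂ) * (x : ℂ))

theorem dirichletSum_eq_sum_pow (M : ℕ) (x : ℝ) :
    dirichletSum M x = ∑ k ∈ Finset.range M, Complex.exp (Complex.I * (x : ℂ)) ^ k := by
  unfold dirichletSum
  refine Finset.sum_congr rfl fun k _ => ?_
  rw [← Complex.exp_nat_mul]; congr 1; ring

theorem continuous_dirichletSum (M : ℕ) : Continuous (dirichletSum M) := by
  unfold dirichletSum; fun_prop

theorem dirichletSum_add_two_pi (M : ℕ) (x : ℝ) :
    dirichletSum M (x + 2 * Real.pi) = dirichletSum M x := by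
  rw [dirichletSum_eq_sum_pow, dirichletSum_eq_sum_pow]
  have : Complex.exp (Complex.I * ((x + 2 * Real.pi : ℝ) : ℂ))
      = Complex.exp (Complex.I * (x : ℂ)) := by
    have e : Complex.I * ((x + 2 * Real.pi : ℝ) : ℂ)
        = Complex.I * (x : ℂ) + 2 * Real.pi * Complex.I := by push_cast; ring
    rw [e, Complex.exp_periodic]
  rw [this]

theorem norm_dirichletSum_neg (M : ℕ) (x : ℝ) :
    ‖dirichletSum M (-x)‖ = ‖dirichletSum M x‖ := by
  have : dirichletSum M (-x) = (starRingEnd ℂ) (dirichletSum M x) := by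
    unfold dirichletSum
    rw [map_sum]
    refine Finset.sum_congr rfl fun k _ => ?_
    rw [← Complex.exp_conj]; simp
  rw [this, RCLike.norm_conj]

/-- The geometric sum has numerator of modulus at most 2 and denominator 2 sin(x/2), which is at
least 2w/π by Jordan's inequality, used on either side of π. -/
theorem norm_dirichletSum_le (M : ℕ) {w x : ℝ} (hw : 0 < w) (hx : w ≤ x)
    (hx' : x ≤ 2 * Real.pi - w) : ‖dirichletSum M x‖ ≤ Real.pi / w := by
  have hpi := Real.pi_pos
  have hsin : w / Real.pi ≤ Real.sin (x / 2) := by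
    rcases le_total x Real.pi with h | h
    · have := Real.mul_le_sin (x := x / 2) (by linarith) (by linarith)
      have e : 2 / Real.pi * (x / 2) = x / Real.pi := by ring
      rw [e] at this
      exact (div_le_div_of_nonneg_right hx hpi.le).trans this
    · have := Real.mul_le_sin (x := Real.pi - x / 2) (by linarith) (by linarith)
      rw [Real.sin_pi_sub] at this
      have e : 2 / Real.pi * (Real.pi - x / 2) = (2 * Real.pi - x) / Real.pi := by
        field_simp
      rw [e] at this
      exact (div_le_div_of_nonneg_right (by linarith) hpi.le).trans this
  have h1 : ‖Complex.exp (Complex.I * (x : ℂ)) - 1‖ = 2 * Real.sin (x / 2) := by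
    rw [Complex.norm_exp_I_mul_ofReal_sub_one, Real.norm_eq_abs, abs_of_nonneg]
    have : 0 < w / Real.pi := by positivity
    linarith
  have h2 : ‖dirichletSum M x‖ * ‖Complex.exp (Complex.I * (x : ℂ)) - 1‖ ≤ 2 := by
    rw [← norm_mul, dirichletSum_eq_sum_pow, geom_sum_mul]
    refine (norm_sub_le _ _).trans ?_
    rw [norm_pow, mul_comm, Complex.norm_exp_ofReal_mul_I]
    norm_num
  rw [h1] at h2
  rw [le_div_iff₀ hw]
  have h3 : ‖dirichletSum M x‖ * (w / Real.pi) ≤ ‖dirichletSum M x‖ * Real.sin (x / 2) :=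
    mul_le_mul_of_nonneg_left hsin (norm_nonneg _)
  have h4 : ‖dirichletSum M x‖ * (w / Real.pi) ≤ 1 := by linarith
  have h5 : ‖dirichletSum M x‖ * (w / Real.pi) * Real.pi = ‖dirichletSum M x‖ * w := by
    field_simp
  nlinarith

/-- The reflection k ↦ B - k shows that conjugation multiplies the sum by exp(-iBx). This exhibits
the Fejér kernel as a shifted polynomial in exp(ix), whence the coefficients in `kernel_eq_sum`. -/
theorem normSq_dirichletSum (B : ℕ) (x : ℝ) :
    ((‖dirichletSum (B + 1) x‖ ^ 2 : ℝ) : ℂ)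
      = Complex.exp (-(Complex.I * (B : ℂ) * (x : ℂ))) * dirichletSum (B + 1) x ^ 2 := by
  have hconj : (starRingEnd ℂ) (dirichletSum (B + 1) x)
      = Complex.exp (-(Complex.I * (B : ℂ) * (x : ℂ))) * dirichletSum (B + 1) x := by
    unfold dirichletSum
    rw [map_sum, Finset.mul_sum, ← Finset.sum_range_reflect]
    refine Finset.sum_congr rfl fun k hk => ?_
    rw [Finset.mem_range] at hk
    rw [← Complex.exp_conj, ← Complex.exp_add]
    congr 1
    have : ((B + 1 - 1 - k : ℕ) : ℂ) = (B : ℂ) - k := by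
      rw [Nat.add_sub_cancel, Nat.cast_sub (by omega)]
    rw [this]
    simp
    ring
  push_cast
  rw [← Complex.conj_mul', hconj]; ring

end Dirichlet

/-! ### Powers of the Fejér kernel: Fourier coefficients, mass and tails -/

section Kernel

open Polynomial in
/-- The coefficients of `(1 + X + ... + X ^ B) ^ (2 m)`. -/
noncomputable def kernelCoeff (m B j : ℕ) : ℝ :=
  ((∑ k ∈ Finset.range (B + 1), (X : ℝ[X]) ^ k) ^ (2 * m)).coeff j

open Polynomial in
theorem natDegree_kernel_le (m B : ℕ) :
    ((∑ k ∈ Finset.range (B + 1), (X : ℝ[X]) ^ k) ^ (2 * m)).natDegree < 2 * (m * B) + 1 := by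
  have h1 : (∑ k ∈ Finset.range (B + 1), (X : ℝ[X]) ^ k).natDegree ≤ B := by
    refine natDegree_sum_le_of_forall_le _ _ fun k hk => ?_
    rw [Finset.mem_range] at hk
    rw [natDegree_X_pow]; omega
  have := natDegree_pow_le_of_le (2 * m) h1
  rw [mul_assoc] at this
  omega

/-- A power of the Fejér kernel. -/
noncomputable def kernel (m B : ℕ) (x : ℝ) : ℝ := ‖dirichletSum (B + 1) x‖ ^ (2 * m)

theorem continuous_kernel (m B : ℕ) : Continuous (kernel m B) :=
  (continuous_dirichletSum _).norm.pow _

theorem kernel_nonneg (m B : ℕ) (x : ℝ) : 0 ≤ kernel m B x := pow_nonneg (norm_nonneg _) _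

theorem kernel_add_two_pi (m B : ℕ) (x : ℝ) : kernel m B (x + 2 * Real.pi) = kernel m B x := by
  rw [kernel, dirichletSum_add_two_pi]; rfl

open Polynomial in
theorem kernel_eq_sum (m B : ℕ) (x : ℝ) :
    (kernel m B x : ℂ) = ∑ l : Fin (2 * (m * B) + 1), (kernelCoeff m B l : ℂ) *
      Complex.exp (Complex.I * (shift (m * B) l : ℂ) * (x : ℂ)) := by
  set z := Complex.exp (Complex.I * (x : ℂ)) with hz
  have h1 : dirichletSum (B + 1) x ^ (2 * m)
      = ∑ l ∈ Finset.range (2 * (m * B) + 1), (kernelCoeff m B l : ℂ) * z ^ l := by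
    have := aeval_eq_sum_range' (natDegree_kernel_le m B) z
    rw [map_pow, map_sum] at this
    simp only [map_pow, aeval_X] at this
    rw [dirichletSum_eq_sum_pow, this]
    refine Finset.sum_congr rfl fun l _ => ?_
    rw [kernelCoeff, Complex.real_smul]
  have h2 : (kernel m B x : ℂ) = Complex.exp (-(Complex.I * ((m * B : ℕ) : ℂ) * (x : ℂ)))
      * dirichletSum (B + 1) x ^ (2 * m) := by
    rw [kernel, pow_mul, Complex.ofReal_pow, normSq_dirichletSum, mul_pow, ← pow_mul,
      ← Complex.exp_nat_mul]
    congr 2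
    push_cast; ring
  rw [h2, h1, Finset.sum_range, Finset.mul_sum]
  refine Finset.sum_congr rfl fun l _ => ?_
  rw [hz, ← Complex.exp_nat_mul, mul_left_comm, ← Complex.exp_add]
  congr 2
  rw [shift]; push_cast; ring

theorem integral_exp_I_int (n : ℤ) :
    ∫ x in (0 : ℝ)..(2 * Real.pi), Complex.exp (Complex.I * (n : ℂ) * (x : ℂ))
      = if n = 0 then 2 * (Real.pi : ℂ) else 0 := by
  split_ifs with h
  · simp [h]
  · have hc : Complex.I * (n : ℂ) ≠ 0 :=
      mul_ne_zero Complex.I_ne_zero (Int.cast_ne_zero.2 h)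
    rw [integral_exp_mul_complex hc]
    have : Complex.I * (n : ℂ) * ((2 * Real.pi : ℝ) : ℂ) = n * (2 * Real.pi * Complex.I) := by
      push_cast; ring
    rw [this, Complex.exp_int_mul_two_pi_mul_I]
    simp

theorem norm_integral_exp_I_int_le {n : ℤ} (h : n ≠ 0) (a b : ℝ) :
    ‖∫ x in a..b, Complex.exp (Complex.I * (n : ℂ) * (x : ℂ))‖ ≤ 2 / |(n : ℝ)| := by
  have hc : Complex.I * (n : ℂ) ≠ 0 :=
    mul_ne_zero Complex.I_ne_zero (Int.cast_ne_zero.2 h)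
  rw [integral_exp_mul_complex hc, norm_div]
  have h1 : ‖Complex.I * (n : ℂ)‖ = |(n : ℝ)| := by simp
  have h2 : ∀ x : ℝ, ‖Complex.exp (Complex.I * (n : ℂ) * (x : ℂ))‖ = 1 := by
    intro x
    have e : Complex.I * (n : ℂ) * (x : ℂ) = ((n * x : ℝ) : ℂ) * Complex.I := by
      push_cast; ring
    rw [e, Complex.norm_exp_ofReal_mul_I]
  rw [h1]
  gcongr
  refine (norm_sub_le _ _).trans ?_
  rw [h2, h2]; norm_num

theorem shift_sub_eq_zero_iff {d : ℕ} (l j : Fin (2 * d + 1)) :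
    shift d l - shift d j = 0 ↔ l = j := by
  rw [shift, shift, Fin.ext_iff]; omega

theorem integral_kernel_mul_exp (m B : ℕ) (j : Fin (2 * (m * B) + 1)) :
    ∫ x in (0 : ℝ)..(2 * Real.pi), (kernel m B x : ℂ) *
      Complex.exp (-(Complex.I * (shift (m * B) j : ℂ) * (x : ℂ)))
      = 2 * Real.pi * kernelCoeff m B j := by
  have h1 : ∀ x : ℝ, (kernel m B x : ℂ) *
      Complex.exp (-(Complex.I * (shift (m * B) j : ℂ) * (x : ℂ)))
      = ∑ l : Fin (2 * (m * B) + 1), (kernelCoeff m B l : ℂ) *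
      Complex.exp (Complex.I * ((shift (m * B) l - shift (m * B) j : ℤ) : ℂ) * (x : ℂ)) := by
    intro x
    rw [kernel_eq_sum, Finset.sum_mul]
    refine Finset.sum_congr rfl fun l _ => ?_
    rw [mul_assoc, ← Complex.exp_add]
    congr 2
    push_cast; ring
  simp only [h1]
  rw [intervalIntegral.integral_finsetSum
    (fun l _ => (Continuous.intervalIntegrable (by fun_prop) _ _))]
  simp only [intervalIntegral.integral_const_mul, integral_exp_I_int, shift_sub_eq_zero_iff]
  simp [mul_comm]

/-- The index of the shift `0`. -/
def midIndex (d : ℕ) : Fin (2 * d + 1) := ⟨d, by omega⟩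

@[simp] theorem shift_midIndex (d : ℕ) : shift d (midIndex d) = 0 := by simp [shift, midIndex]

theorem integral_kernel (m B : ℕ) :
    ∫ x in (0 : ℝ)..(2 * Real.pi), kernel m B x = 2 * Real.pi * kernelCoeff m B (m * B) := by
  have := integral_kernel_mul_exp m B (midIndex (m * B))
  simp only [shift_midIndex] at this
  simp only [Int.cast_zero, mul_zero, zero_mul, neg_zero, Complex.exp_zero, mul_one,
    intervalIntegral.integral_ofReal] at this
  exact_mod_cast this

/-- The kernel is nonnegative, so each of its Fourier coefficients is dominated by its mean. -/
theorem abs_kernelCoeff_le (m B : ℕ) (j : Fin (2 * (m * B) + 1)) :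
    |kernelCoeff m B j| ≤ kernelCoeff m B (m * B) := by
  have hpi := Real.pi_pos
  have h1 : ‖∫ x in (0 : ℝ)..(2 * Real.pi), (kernel m B x : ℂ) *
      Complex.exp (-(Complex.I * (shift (m * B) j : ℂ) * (x : ℂ)))‖
      ≤ ∫ x in (0 : ℝ)..(2 * Real.pi), kernel m B x := by
    refine (intervalIntegral.norm_integral_le_integral_norm (by positivity)).trans (le_of_eq ?_)
    refine intervalIntegral.integral_congr fun x _ => ?_
    have e : -(Complex.I * (shift (m * B) j : ℂ) * (x : ℂ))
        = ((-(shift (m * B) j * x) : ℝ) : ℂ) * Complex.I := by push_cast; ring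
    rw [norm_mul, e, Complex.norm_exp_ofReal_mul_I, mul_one, Complex.norm_real,
      Real.norm_of_nonneg (kernel_nonneg _ _ _)]
  rw [integral_kernel_mul_exp, integral_kernel, norm_mul, Complex.norm_real] at h1
  have h2 : ‖(2 * Real.pi : ℂ)‖ = 2 * Real.pi := by simp [abs_of_pos hpi]
  rw [h2] at h1
  exact le_of_mul_le_mul_left h1 (by positivity)

/-- At x = 0 the kernel is the sum of its 2mB + 1 coefficients, none of which exceeds the middle
one. This bounds from below the total mass by which the tails are divided. -/
theorem kernelCoeff_mid_ge (m B : ℕ) :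
    ((B : ℝ) + 1) ^ (2 * m) ≤ (2 * (m * B : ℕ) + 1) * kernelCoeff m B (m * B) := by
  have h0 := kernel_eq_sum m B 0
  have h1 : kernel m B 0 = ((B : ℝ) + 1) ^ (2 * m) := by
    have : ‖(B : ℂ) + 1‖ = (B : ℝ) + 1 := by exact_mod_cast Complex.norm_natCast (B + 1)
    simp [kernel, dirichletSum, this]
  simp only [Complex.ofReal_zero, mul_zero, Complex.exp_zero, mul_one] at h0
  have h2 : kernel m B 0 = ∑ l : Fin (2 * (m * B) + 1), kernelCoeff m B l := by
    exact_mod_cast h0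
  rw [← h1, h2]
  refine (Finset.sum_le_sum fun l _ => (le_abs_self _).trans (abs_kernelCoeff_le m B l)).trans ?_
  simp

theorem kernelCoeff_mid_pos (m B : ℕ) : 0 < kernelCoeff m B (m * B) := by
  have h := kernelCoeff_mid_ge m B
  have h1 : 0 < ((B : ℝ) + 1) ^ (2 * m) := by positivity
  exact pos_of_mul_pos_right (h1.trans_le h) (by positivity)

theorem integral_normSq_dirichletSum (B : ℕ) :
    ∫ x in (0 : ℝ)..(2 * Real.pi), ‖dirichletSum (B + 1) x‖ ^ 2 = 2 * Real.pi * (B + 1) := by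
  have h1 : ∀ x : ℝ, ((‖dirichletSum (B + 1) x‖ ^ 2 : ℝ) : ℂ)
      = ∑ k ∈ Finset.range (B + 1), ∑ l ∈ Finset.range (B + 1),
        Complex.exp (Complex.I * (((k : ℤ) - (l : ℤ) : ℤ) : ℂ) * (x : ℂ)) := by
    intro x
    push_cast
    rw [← Complex.mul_conj', dirichletSum, map_sum, Finset.sum_mul_sum]
    refine Finset.sum_congr rfl fun k _ => Finset.sum_congr rfl fun l _ => ?_
    rw [← Complex.exp_conj, ← Complex.exp_add]
    congr 1
    simp; ring
  have h2 : ((∫ x in (0 : ℝ)..(2 * Real.pi), ‖dirichletSum (B + 1) x‖ ^ 2 : ℝ) : ℂ)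
      = 2 * Real.pi * (B + 1) := by
    rw [← intervalIntegral.integral_ofReal]
    simp only [h1]
    rw [intervalIntegral.integral_finsetSum
      (fun l _ => (Continuous.intervalIntegrable (by fun_prop) _ _))]
    have h3 : ∀ k ∈ Finset.range (B + 1), ∫ x in (0 : ℝ)..(2 * Real.pi),
        ∑ l ∈ Finset.range (B + 1),
        Complex.exp (Complex.I * (((k : ℤ) - (l : ℤ) : ℤ) : ℂ) * (x : ℂ))
        = 2 * (Real.pi : ℂ) := by
      intro k hk
      rw [intervalIntegral.integral_finsetSum
        (fun l _ => (Continuous.intervalIntegrable (by fun_prop) _ _))]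
      simp only [integral_exp_I_int, sub_eq_zero, Nat.cast_inj]
      rw [Finset.sum_ite_eq, if_pos hk]
    rw [Finset.sum_congr rfl h3]
    simp; ring
  exact_mod_cast h2

/-- All but two of the 2m factors are bounded pointwise; the remaining square is integrated exactly
over a period. A pointwise bound of all factors would leave an extra B + 1 in the ratio of tail to
mass, hence a factor log(1/w) in the degree, which `L₀` does not allow. -/
theorem integral_kernel_tail_le {m B : ℕ} (hm : 1 ≤ m) {w s t : ℝ} (hw : 0 < w) (hs : w ≤ s)
    (hst : s ≤ t) (ht : t ≤ 2 * Real.pi - w) :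
    ∫ x in s..t, kernel m B x ≤ (Real.pi / w) ^ (2 * (m - 1)) * (2 * Real.pi * (B + 1)) := by
  have hc : Continuous fun x => ‖dirichletSum (B + 1) x‖ ^ 2 :=
    (continuous_dirichletSum _).norm.pow _
  calc ∫ x in s..t, kernel m B x
      ≤ ∫ x in s..t, (Real.pi / w) ^ (2 * (m - 1)) * ‖dirichletSum (B + 1) x‖ ^ 2 := by
        refine intervalIntegral.integral_mono_on hst ((continuous_kernel m B).intervalIntegrable _ _)
          ((continuous_const.mul hc).intervalIntegrable _ _) fun x hx => ?_
        have e : 2 * m = 2 * (m - 1) + 2 := by omega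
        rw [kernel, e, pow_add]
        refine mul_le_mul_of_nonneg_right ?_ (sq_nonneg _)
        exact pow_le_pow_left₀ (norm_nonneg _)
          (norm_dirichletSum_le _ hw (hs.trans hx.1) (hx.2.trans ht)) _
    _ = (Real.pi / w) ^ (2 * (m - 1)) * ∫ x in s..t, ‖dirichletSum (B + 1) x‖ ^ 2 :=
        intervalIntegral.integral_const_mul _ _
    _ ≤ _ := by
        have hpi := Real.pi_pos
        refine mul_le_mul_of_nonneg_left ?_ (by positivity)
        rw [← integral_normSq_dirichletSum]
        refine intervalIntegral.integral_mono_interval (by linarith) hst (by linarith) ?_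
          (hc.intervalIntegrable _ _)
        exact Filter.Eventually.of_forall fun x => sq_nonneg _

end Kernel

/-! ### The smoothed step: accuracy, coefficient decay and ℓ¹ norm -/

section StepFilter

/-- The coefficients of the convolution of the normalized kernel with the indicator function
of `[-π, b]`. -/
noncomputable def stepFilter (m B : ℕ) (b : ℝ) (l : Fin (2 * (m * B) + 1)) : ℂ :=
  (kernelCoeff m B l / (2 * Real.pi * kernelCoeff m B (m * B)) : ℝ) *
    ∫ y in (-Real.pi)..b, Complex.exp (Complex.I * (shift (m * B) l : ℂ) * (y : ℂ))

/-- Expanding the kernel in exponentials and integrating termwise gives the convolution with the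
indicator. The value at x is thus the fraction of the kernel's mass in a window, and the filter
errors become kernel tails. -/
theorem trigPoly_stepFilter (m B : ℕ) (b x : ℝ) :
    trigPoly (stepFilter m B b) x
      = (((∫ y in (-Real.pi - x)..(b - x), kernel m B y) /
          (2 * Real.pi * kernelCoeff m B (m * B)) : ℝ) : ℂ) := by
  rw [← intervalIntegral.integral_comp_sub_right (fun y => kernel m B y) x]
  have h1 : ((∫ y in (-Real.pi)..b, kernel m B (y - x) : ℝ) : ℂ)
      = ∑ l : Fin (2 * (m * B) + 1), (kernelCoeff m B l : ℂ) *
        (Complex.exp (-(Complex.I * (shift (m * B) l : ℂ) * (x : ℂ))) *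
        ∫ y in (-Real.pi)..b, Complex.exp (Complex.I * (shift (m * B) l : ℂ) * (y : ℂ))) := by
    rw [← intervalIntegral.integral_ofReal]
    simp only [kernel_eq_sum]
    rw [intervalIntegral.integral_finsetSum
      (fun l _ => (Continuous.intervalIntegrable (by fun_prop) _ _))]
    refine Finset.sum_congr rfl fun l _ => ?_
    rw [intervalIntegral.integral_const_mul, ← intervalIntegral.integral_const_mul (Complex.exp _)]
    congr 1
    refine intervalIntegral.integral_congr fun y _ => ?_
    rw [← Complex.exp_add]
    congr 1
    push_cast; ring
  rw [Complex.ofReal_div, h1, trigPoly, Finset.sum_div]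
  refine Finset.sum_congr rfl fun l _ => ?_
  rw [stepFilter]
  push_cast
  ring

theorem integral_kernel_period (m B : ℕ) (s : ℝ) :
    ∫ x in s..(s + 2 * Real.pi), kernel m B x = 2 * Real.pi * kernelCoeff m B (m * B) := by
  have hp : Function.Periodic (kernel m B) (2 * Real.pi) := kernel_add_two_pi m B
  rw [← integral_kernel, hp.intervalIntegral_add_eq s 0, zero_add]

variable {m B : ℕ} {b x : ℝ}

theorem integral_kernel_mem (m B : ℕ) {s t : ℝ} (hst : s ≤ t) (ht : t ≤ s + 2 * Real.pi) :
    (∫ y in s..t, kernel m B y) / (2 * Real.pi * kernelCoeff m B (m * B)) ∈ Set.Icc (0 : ℝ) 1 := by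
  have hpos : 0 < 2 * Real.pi * kernelCoeff m B (m * B) :=
    mul_pos Real.two_pi_pos (kernelCoeff_mid_pos m B)
  refine ⟨div_nonneg (intervalIntegral.integral_nonneg hst fun y _ => kernel_nonneg _ _ _) hpos.le,
    (div_le_one hpos).2 ?_⟩
  rw [← integral_kernel_period m B s]
  refine intervalIntegral.integral_mono_interval le_rfl hst ht ?_
    ((continuous_kernel m B).intervalIntegrable _ _)
  exact Filter.Eventually.of_forall fun x => kernel_nonneg _ _ _

/-- The values of the step filter are real and lie in `[0, 1]`. -/
theorem exists_trigPoly_stepFilter_eq (hb : b ∈ Set.Icc (-Real.pi) Real.pi) (x : ℝ) :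
    ∃ y ∈ Set.Icc (0 : ℝ) 1, trigPoly (stepFilter m B b) x = (y : ℂ) :=
  ⟨_, integral_kernel_mem m B (by linarith [hb.1]) (by linarith [hb.2]),
    trigPoly_stepFilter m B b x⟩

/-- The kernel contributes at most 1/(2π); the integral over [-π, b] is at most 2π for shift 0 and
at most 2/|l| otherwise, and π|l| ≥ 1 + |l| for |l| ≥ 1. -/
theorem norm_stepFilter_le (hb : b ∈ Set.Icc (-Real.pi) Real.pi) (l : Fin (2 * (m * B) + 1)) :
    ‖stepFilter m B b l‖ ≤ 1 / (1 + |(shift (m * B) l : ℝ)|) := by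
  have hpi := Real.pi_pos
  have hk := kernelCoeff_mid_pos m B
  have h1 : ‖((kernelCoeff m B l / (2 * Real.pi * kernelCoeff m B (m * B)) : ℝ) : ℂ)‖
      ≤ 1 / (2 * Real.pi) := by
    rw [Complex.norm_real, Real.norm_eq_abs, abs_div, abs_of_pos (by positivity :
      0 < 2 * Real.pi * kernelCoeff m B (m * B)), div_le_div_iff₀ (by positivity) (by positivity)]
    have := abs_kernelCoeff_le m B l
    nlinarith
  rw [stepFilter, norm_mul]
  by_cases hs : shift (m * B) l = 0
  · rw [hs]
    have h2 : ‖∫ y in (-Real.pi)..b, Complex.exp (Complex.I * ((0 : ℤ) : ℂ) * (y : ℂ))‖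
        ≤ 2 * Real.pi := by
      simp only [Int.cast_zero, mul_zero, zero_mul, Complex.exp_zero,
        intervalIntegral.integral_const, Complex.real_smul, mul_one, Complex.norm_real]
      rw [Real.norm_eq_abs, abs_of_nonneg (by linarith [hb.1])]
      linarith [hb.2]
    refine (mul_le_mul h1 h2 (norm_nonneg _) (by positivity)).trans (le_of_eq ?_)
    simp
    field_simp
  · have h2 := norm_integral_exp_I_int_le hs (-Real.pi) b
    have h3 : (1 : ℝ) ≤ |(shift (m * B) l : ℝ)| := by
      exact_mod_cast Int.one_le_abs hs
    refine (mul_le_mul h1 h2 (norm_nonneg _) (by positivity)).trans ?_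
    rw [div_mul_div_comm, div_le_div_iff₀ (by positivity) (by positivity)]
    nlinarith [Real.pi_gt_three]

theorem filterMass_stepFilter_pos (hb : -Real.pi < b) : 0 < filterMass (stepFilter m B b) := by
  have hpi := Real.pi_pos
  have hk := kernelCoeff_mid_pos m B
  refine Finset.sum_pos' (fun _ _ => norm_nonneg _) ⟨midIndex (m * B), Finset.mem_univ _, ?_⟩
  rw [norm_pos_iff, stepFilter, shift_midIndex]
  refine mul_ne_zero (Complex.ofReal_ne_zero.2 (div_pos ?_ (by positivity)).ne') ?_
  · exact hk
  · simp only [Int.cast_zero, mul_zero, zero_mul, Complex.exp_zero,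
        intervalIntegral.integral_const, Complex.real_smul, mul_one]
    exact Complex.ofReal_ne_zero.2 (by linarith : b - -Real.pi ≠ 0)

/-- The degree of the step filter with transition width `w` and error `q` is `m * B` for
this `m` and `B = ⌈4 π / w⌉`. -/
noncomputable def filterPower (q : ℝ) : ℕ := ⌈Real.log (2 / q)⌉₊ + 1

/-- See `filterPower`. -/
noncomputable def filterBase (w : ℝ) : ℕ := ⌈4 * Real.pi / w⌉₊

/-- Since B + 1 ≥ 4π/w, the square of the Dirichlet sum on the tail is at most 1/16 of its peak.
With m = k + 1 the tail and mass bounds leave the ratio 2m/16^k, with no factor of B. -/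
theorem kernel_tail_ratio_le {w q s t : ℝ} (hw : 0 < w) (hq : 0 < q) (hs : w ≤ s)
    (hst : s ≤ t) (ht : t ≤ 2 * Real.pi - w) :
    (∫ x in s..t, kernel (filterPower q) (filterBase w) x) /
      (2 * Real.pi * kernelCoeff (filterPower q) (filterBase w)
        (filterPower q * filterBase w)) ≤ q := by
  set m := filterPower q with hm
  set B := filterBase w with hB
  have hpi := Real.pi_pos
  set k : ℕ := ⌈Real.log (2 / q)⌉₊ with hk
  have hmk : m = k + 1 := rfl
  have hB1 : 4 * Real.pi / w ≤ (B : ℝ) + 1 := (Nat.le_ceil _).trans (by rw [hB, filterBase]; linarith)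
  have hB0 : (0 : ℝ) < (B : ℝ) + 1 := by positivity
  have hkc := kernelCoeff_mid_pos m B
  have h1 := integral_kernel_tail_le (B := B) (m := m) (by omega) hw hs hst ht
  have h2 := kernelCoeff_mid_ge m B
  rw [div_le_iff₀ (by positivity)]
  refine h1.trans ?_
  have h3 : (2 * ((m * B : ℕ) : ℝ) + 1) ≤ 2 * m * (B + 1) := by
    have : (1 : ℝ) ≤ m := by exact_mod_cast (by omega : 1 ≤ m)
    push_cast; nlinarith
  have h4 : ((B : ℝ) + 1) ^ (2 * k + 1) ≤ 2 * m * kernelCoeff m B (m * B) := by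
    have h5 : ((B : ℝ) + 1) ^ (2 * m) ≤ 2 * m * (B + 1) * kernelCoeff m B (m * B) :=
      h2.trans (mul_le_mul_of_nonneg_right h3 hkc.le)
    have e : ((B : ℝ) + 1) ^ (2 * m) = ((B : ℝ) + 1) ^ (2 * k + 1) * (B + 1) := by
      rw [← pow_succ]; congr 1
    rw [e] at h5
    refine le_of_mul_le_mul_right (h5.trans (le_of_eq ?_)) hB0
    ring
  have h6 : (Real.pi / w) ^ (2 * k) ≤ ((B : ℝ) + 1) ^ (2 * k) / 16 ^ k := by
    have : Real.pi / w ≤ ((B : ℝ) + 1) / 4 := by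
      rw [le_div_iff₀ (by norm_num)]; refine le_trans (le_of_eq ?_) hB1; ring
    refine (pow_le_pow_left₀ (by positivity) this _).trans (le_of_eq ?_)
    rw [div_pow, pow_mul 4]; norm_num
  -- Split 16^k = 2^k · 8^k: the first factor absorbs m = k + 1, the second exceeds e^k ≥ 2/q.
  have h7 : 2 * (m : ℝ) ≤ q * 16 ^ k := by
    have ha : (m : ℝ) ≤ 2 ^ k := by
      have : k + 1 ≤ 2 ^ k := Nat.lt_two_pow_self
      rw [hmk]; exact_mod_cast this
    have hb : 2 / q ≤ 8 ^ k := by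
      have h8 : 2 / q ≤ Real.exp k := by
        rw [← Real.log_le_iff_le_exp (by positivity)]
        exact Nat.le_ceil _
      have h9 : Real.exp k ≤ 8 ^ k := by
        rw [← Real.exp_one_pow]
        exact pow_le_pow_left₀ (Real.exp_pos _).le (by linarith [Real.exp_one_lt_d9]) _
      exact h8.trans h9
    rw [div_le_iff₀ hq] at hb
    have e : (16 : ℝ) ^ k = 2 ^ k * 8 ^ k := by rw [← mul_pow]; norm_num
    rw [e]
    have : (0 : ℝ) < 2 ^ k := by positivity
    nlinarith
  have e2 : 2 * (m - 1) = 2 * k := by rw [hmk]; rfl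
  rw [e2]
  have h16 : (0 : ℝ) < 16 ^ k := by positivity
  calc (Real.pi / w) ^ (2 * k) * (2 * Real.pi * (B + 1))
      ≤ ((B : ℝ) + 1) ^ (2 * k) / 16 ^ k * (2 * Real.pi * (B + 1)) := by gcongr
    _ = 2 * Real.pi * (((B : ℝ) + 1) ^ (2 * k + 1) / 16 ^ k) := by rw [pow_succ]; ring
    _ ≤ 2 * Real.pi * ((2 * m * kernelCoeff m B (m * B)) / 16 ^ k) := by gcongr
    _ ≤ 2 * Real.pi * (q * 16 ^ k * kernelCoeff m B (m * B) / 16 ^ k) := by gcongr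
    _ = q * (2 * Real.pi * kernelCoeff m B (m * B)) := by field_simp

/-- The defect from 1 is the mass of the rest of the period, the window from b - x to π - x. Its
left end stays w away from the peak by `hx'`, and its right end stays w away from the next peak by
`hx`; the second condition is why the spectrum must keep off the ends of [-π, π]. -/
theorem norm_trigPoly_stepFilter_sub_one_le {w q : ℝ} (hw : 0 < w) (hq : 0 < q)
    (hb : b ≤ Real.pi) (hx : -Real.pi + w ≤ x) (hx' : x ≤ b - w) :
    ‖trigPoly (stepFilter (filterPower q) (filterBase w) b) x - 1‖ ≤ q := by
  set m := filterPower q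
  set B := filterBase w
  have hkc := kernelCoeff_mid_pos m B
  have hpi := Real.pi_pos
  have hi : ∀ s t, IntervalIntegrable (kernel m B) MeasureTheory.volume s t :=
    fun s t => (continuous_kernel m B).intervalIntegrable s t
  have h1 := intervalIntegral.integral_add_adjacent_intervals (hi (-Real.pi - x) (b - x))
    (hi (b - x) (-Real.pi - x + 2 * Real.pi))
  rw [integral_kernel_period] at h1
  have h2 : trigPoly (stepFilter m B b) x - 1 = ((-((∫ y in (b - x)..(-Real.pi - x + 2 * Real.pi),
      kernel m B y) / (2 * Real.pi * kernelCoeff m B (m * B))) : ℝ) : ℂ) := by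
    rw [trigPoly_stepFilter, ← Complex.ofReal_one, ← Complex.ofReal_sub]
    congr 1
    rw [eq_sub_of_add_eq h1, sub_div, div_self (by positivity)]
    ring
  rw [h2, Complex.norm_real, norm_neg, Real.norm_of_nonneg
    (integral_kernel_mem m B (by linarith) (by linarith)).1]
  exact kernel_tail_ratio_le hw hq (by linarith) (by linarith) (by linarith)

theorem norm_trigPoly_stepFilter_le {w q : ℝ} (hw : 0 < w) (hq : 0 < q)
    (hb : b ∈ Set.Icc (-Real.pi) Real.pi) (hx : b + w ≤ x) (hx' : x ≤ Real.pi - w) :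
    ‖trigPoly (stepFilter (filterPower q) (filterBase w) b) x‖ ≤ q := by
  set m := filterPower q
  set B := filterBase w
  -- The window lies to the left of the peak at 0; one period further right it is inside [w, 2π -
  -- w].
  have h1 : ∫ y in (-Real.pi - x)..(b - x), kernel m B y
      = ∫ y in (-Real.pi - x + 2 * Real.pi)..(b - x + 2 * Real.pi), kernel m B y := by
    rw [← intervalIntegral.integral_comp_add_right (kernel m B) (2 * Real.pi)]
    simp only [kernel_add_two_pi]
  rw [trigPoly_stepFilter, h1, Complex.norm_real, Real.norm_of_nonneg
    (integral_kernel_mem m B (by linarith [hb.1]) (by linarith [hb.2])).1]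
  exact kernel_tail_ratio_le hw hq (by linarith) (by linarith [hb.1]) (by linarith)

/-- The sum of `1 / (1 + |l|)` over `-d ≤ l ≤ d`. -/
noncomputable def harmonicMass (d : ℕ) : ℝ := ∑ l : Fin (2 * d + 1), 1 / (1 + |(shift d l : ℝ)|)

theorem filterMass_stepFilter_le (hb : b ∈ Set.Icc (-Real.pi) Real.pi) :
    filterMass (stepFilter m B b) ≤ harmonicMass (m * B) :=
  Finset.sum_le_sum fun l _ => norm_stepFilter_le hb l

theorem harmonicMass_pos (d : ℕ) : 0 < harmonicMass d :=
  Finset.sum_pos (fun _ _ => by positivity) Finset.univ_nonempty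

theorem harmonicMass_le (d : ℕ) : harmonicMass d ≤ 2 * (1 + Real.log (d + 1)) := by
  have h1 : harmonicMass d ≤ 2 * ∑ i ∈ Finset.range (d + 1), 1 / (1 + (i : ℝ)) := by
    unfold harmonicMass
    have e : ∀ l : Fin (2 * d + 1), 1 / (1 + |(shift d l : ℝ)|)
        = (fun i : ℕ => 1 / (1 + |(i : ℝ) - d|)) l := by
      intro l; simp [shift]
    rw [Finset.sum_congr rfl fun l _ => e l,
      Fin.sum_univ_eq_sum_range (fun i : ℕ => 1 / (1 + |(i : ℝ) - d|)),
      (by ring : 2 * d + 1 = d + (d + 1)), Finset.sum_range_add, two_mul]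
    refine add_le_add ?_ (le_of_eq (Finset.sum_congr rfl fun i _ => ?_))
    · rw [← Finset.sum_range_reflect]
      refine le_trans (Finset.sum_le_sum fun i hi => ?_)
        (Finset.sum_le_sum_of_subset_of_nonneg
          (Finset.range_subset_range.2 (Nat.le_succ d)) fun i _ _ => by positivity)
      rw [Finset.mem_range] at hi
      have h : ((d - 1 - i : ℕ) : ℝ) = (d : ℝ) - 1 - i := by
        rw [Nat.cast_sub (by omega), Nat.cast_sub (by omega)]; simp
      rw [h, (by ring : (d : ℝ) - 1 - i - d = -(1 + i)), abs_neg,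
        abs_of_nonneg (by positivity)]
      gcongr
      linarith
    · push_cast
      rw [add_sub_cancel_left, abs_of_nonneg (by positivity)]
  have h2 := harmonic_le_one_add_log (d + 1)
  have h3 : ((harmonic (d + 1) : ℚ) : ℝ) = ∑ i ∈ Finset.range (d + 1), 1 / (1 + (i : ℝ)) := by
    rw [harmonic]; push_cast
    refine Finset.sum_congr rfl fun i _ => ?_
    rw [one_div, add_comm]
  rw [h3] at h2
  push_cast at h2
  linarith

end StepFilter

/-! ## The minimizers of the loss function -/

section Loss

variable {N : ℕ}

theorem norm_exp_I_mul_mul (x y z : ℝ) :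
    ‖Complex.exp (Complex.I * (x : ℂ) * (y : ℂ) * (z : ℂ))‖ = 1 := by
  have e : Complex.I * (x : ℂ) * (y : ℂ) * (z : ℂ) = ((x * y * z : ℝ) : ℂ) * Complex.I := by
    push_cast; ring
  rw [e, Complex.norm_exp_ofReal_mul_I]

/-- The correlation of the data with the frequency `θ`. -/
noncomputable def corr (Z : Fin N → ℂ) (τ θ : ℝ) : ℂ :=
  (1 / (N : ℂ)) * ∑ n : Fin N,
    Z n * Complex.exp (Complex.I * (θ : ℂ) * ((n : ℕ) : ℂ) * (τ : ℂ))

theorem sq_norm_sub (a r : ℂ) :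
    ‖a - r‖ ^ 2 = ‖a‖ ^ 2 - 2 * (a * (starRingEnd ℂ) r).re + ‖r‖ ^ 2 := by
  simp only [Complex.sq_norm, Complex.normSq_sub]; ring

/-- Demodulation by unimodular phases turns the loss into a least-squares fit of a constant;
complete the square in r. The optimal r is the correlation, and minimizing over θ maximizes its
modulus. -/
theorem loss_eq (hN : 0 < N) (Z : Fin N → ℂ) (τ : ℝ) (r : ℂ) (θ : ℝ) :
    loss Z τ r θ = (1 / (N : ℝ)) * ∑ n, ‖Z n‖ ^ 2 - ‖corr Z τ θ‖ ^ 2 + ‖r - corr Z τ θ‖ ^ 2 := by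
  have hN' : (N : ℝ) ≠ 0 := by positivity
  have hu : ∀ n : ℕ, ‖Complex.exp (Complex.I * (θ : ℂ) * (n : ℂ) * (τ : ℂ))‖ = 1 := fun n => by
    have := norm_exp_I_mul_mul θ n τ
    simpa using this
  have h1 : ∀ n : Fin N, ‖Z n - r * Complex.exp (-(Complex.I * (θ : ℂ) * ((n : ℕ) : ℂ) * (τ : ℂ)))‖ ^ 2
      = ‖Z n‖ ^ 2 - 2 * (Z n * Complex.exp (Complex.I * (θ : ℂ) * ((n : ℕ) : ℂ) * (τ : ℂ))
        * (starRingEnd ℂ) r).re + ‖r‖ ^ 2 := by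
    intro n
    have e : (Z n - r * Complex.exp (-(Complex.I * (θ : ℂ) * ((n : ℕ) : ℂ) * (τ : ℂ))))
        * Complex.exp (Complex.I * (θ : ℂ) * ((n : ℕ) : ℂ) * (τ : ℂ))
        = Z n * Complex.exp (Complex.I * (θ : ℂ) * ((n : ℕ) : ℂ) * (τ : ℂ)) - r := by
      rw [sub_mul, mul_assoc r, ← Complex.exp_add, neg_add_cancel, Complex.exp_zero, mul_one]
    have := congrArg norm e
    rw [norm_mul, hu, mul_one] at this
    rw [this, sq_norm_sub, norm_mul, hu, mul_one]
  have h2 : (∑ n : Fin N, (Z n * Complex.exp (Complex.I * (θ : ℂ) * ((n : ℕ) : ℂ) * (τ : ℂ))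
        * (starRingEnd ℂ) r).re) = N * (corr Z τ θ * (starRingEnd ℂ) r).re := by
    rw [← Complex.re_sum, ← Finset.sum_mul]
    have : (∑ n : Fin N, Z n * Complex.exp (Complex.I * (θ : ℂ) * ((n : ℕ) : ℂ) * (τ : ℂ)))
        = (N : ℝ) * corr Z τ θ := by
      rw [corr]; push_cast
      rw [← mul_assoc, mul_one_div_cancel (by exact_mod_cast hN'), one_mul]
    rw [this, mul_assoc, Complex.re_ofReal_mul]
  rw [loss, Finset.sum_congr rfl fun n _ => h1 n, Finset.sum_add_distrib, Finset.sum_sub_distrib,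
    ← Finset.mul_sum, h2, norm_sub_rev r, sq_norm_sub (corr Z τ θ) r]
  simp only [Finset.sum_const, Finset.card_univ, Fintype.card_fin, nsmul_eq_mul]
  field_simp
  ring

theorem exists_minimizer (hN : 0 < N) (Z : Fin N → ℂ) (τ : ℝ) {a b : ℝ} (hab : a ≤ b) :
    ∃ θ ∈ Set.Icc a b, ∀ r' : ℂ, ∀ θ' ∈ Set.Icc a b,
      loss Z τ (corr Z τ θ) θ ≤ loss Z τ r' θ' := by
  have hc : Continuous fun θ => ‖corr Z τ θ‖ := by
    unfold corr; fun_prop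
  obtain ⟨θ, hθ, hmax⟩ := isCompact_Icc.exists_isMaxOn (Set.nonempty_Icc.2 hab) hc.continuousOn
  refine ⟨θ, hθ, fun r' θ' hθ' => ?_⟩
  have h : ‖corr Z τ θ'‖ ≤ ‖corr Z τ θ‖ := hmax hθ'
  rw [loss_eq hN, loss_eq hN, sub_self, norm_zero]
  have := pow_le_pow_left₀ (norm_nonneg _) h 2
  have := sq_nonneg ‖r' - corr Z τ θ'‖
  linarith

theorem norm_corr_le_of_minimizer (hN : 0 < N) {Z : Fin N → ℂ} {τ θ : ℝ} {r : ℂ} {s : Set ℝ}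
    (h : ∀ r' : ℂ, ∀ θ' ∈ s, loss Z τ r θ ≤ loss Z τ r' θ') {θ' : ℝ} (hθ' : θ' ∈ s) :
    ‖corr Z τ θ'‖ ≤ ‖corr Z τ θ‖ := by
  have h1 := h (corr Z τ θ') θ' hθ'
  rw [loss_eq hN, loss_eq hN, sub_self, norm_zero] at h1
  have := sq_nonneg ‖r - corr Z τ θ‖
  exact (pow_le_pow_iff_left₀ (norm_nonneg _) (norm_nonneg _) two_ne_zero).1 (by linarith)

end Loss

/-! ### Existence of a sequence of minimizers -/

section Run

variable {J N : ℕ}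

theorem exists_isRun (hN : 0 < N) {τ : ℕ → ℝ} (hτ : ∀ j, 0 < τ j) (Z : Fin J → Fin N → ℂ) :
    ∃ r θ, IsRun τ Z r θ := by
  classical
  have hpi := Real.pi_pos
  -- The data are extended by zero to all levels, so that the minimizers, whose search interval
  -- depends on the previous choice, can be chosen by plain recursion on ℕ.
  let Z' : ℕ → Fin N → ℂ := fun j => if h : j < J then Z ⟨j, h⟩ else 0
  have h0 : ∃ θ ∈ Set.Icc (-Real.pi) Real.pi, ∀ r' : ℂ, ∀ θ' ∈ Set.Icc (-Real.pi) Real.pi,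
      loss (Z' 0) (τ 0) (corr (Z' 0) (τ 0) θ) θ ≤ loss (Z' 0) (τ 0) r' θ' :=
    exists_minimizer hN _ _ (by linarith)
  have hs : ∀ (j : ℕ) (t : ℝ), ∃ θ ∈ Set.Icc (t - Real.pi / (2 * τ j)) (t + Real.pi / (2 * τ j)),
      ∀ r' : ℂ, ∀ θ' ∈ Set.Icc (t - Real.pi / (2 * τ j)) (t + Real.pi / (2 * τ j)),
      loss (Z' (j + 1)) (τ (j + 1)) (corr (Z' (j + 1)) (τ (j + 1)) θ) θ
        ≤ loss (Z' (j + 1)) (τ (j + 1)) r' θ' := fun j t => by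
    have := hτ j
    have : 0 < Real.pi / (2 * τ j) := by positivity
    exact exists_minimizer hN _ _ (by linarith)
  choose θ0 hθ0 hmin0 using h0
  choose f hf hminf using hs
  let θ : ℕ → ℝ := fun j => Nat.rec θ0 (fun j t => f j t) j
  refine ⟨fun j => corr (Z' j) (τ j) (θ j), θ, fun ⟨j, hj⟩ => ?_⟩
  have e : Z ⟨j, hj⟩ = Z' j := by simp [Z', hj]
  rw [e]
  cases j with
  | zero => exact ⟨hθ0, hmin0⟩
  | succ j => exact ⟨hf j (θ j), hminf j (θ j)⟩

end Run

/-! ## Localization of the frequency -/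

section Localization

/-- The difference of squares is (A - B)(A + B + 2 Re e), with second factor at least 0.9 A, while
the two norms add up to at most 2.1 A. A perturbation common to both terms thus costs only a
constant factor of the gap, even if it is much larger than A - B. -/
theorem sub_div_three_le_norm_sub {A B : ℝ} {e : ℂ} (hA : 0 < A) (hB : 0 ≤ B) (hBA : B ≤ A)
    (he : ‖e‖ ≤ A / 20) : (A - B) / 3 ≤ ‖(A : ℂ) + e‖ - ‖(B : ℂ) + e‖ := by
  have h1 : ‖(A : ℂ) + e‖ ^ 2 - ‖(B : ℂ) + e‖ ^ 2 = (A - B) * (A + B + 2 * e.re) := by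
    simp only [Complex.sq_norm, Complex.normSq_apply, Complex.add_re, Complex.add_im,
      Complex.ofReal_re, Complex.ofReal_im]
    ring
  have hre := (abs_le.1 (Complex.abs_re_le_norm e)).1
  have hA' : ‖(A : ℂ) + e‖ ≤ A + A / 20 := by
    refine (norm_add_le _ _).trans ?_
    rw [Complex.norm_real, Real.norm_of_nonneg hA.le]; linarith
  have hB' : ‖(B : ℂ) + e‖ ≤ A + A / 20 := by
    refine (norm_add_le _ _).trans ?_
    rw [Complex.norm_real, Real.norm_of_nonneg hB]; linarith
  set x := ‖(A : ℂ) + e‖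
  set y := ‖(B : ℂ) + e‖
  have hx0 : 0 ≤ x := norm_nonneg _
  have hy0 : 0 ≤ y := norm_nonneg _
  by_contra! hc
  have h2 : (A - B) * (9 / 10 * A) ≤ (x - y) * (x + y) := by
    have : (x - y) * (x + y) = (A - B) * (A + B + 2 * e.re) := by rw [← h1]; ring
    rw [this]
    exact mul_le_mul_of_nonneg_left (by linarith) (by linarith)
  have h3 : (x - y) * (x + y) ≤ (A - B) / 3 * (21 / 10 * A) := by
    rcases le_total x y with h | h
    · have : (x - y) * (x + y) ≤ 0 := mul_nonpos_of_nonpos_of_nonneg (by linarith) (by linarith)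
      have : 0 ≤ (A - B) / 3 * (21 / 10 * A) := by
        have := sub_nonneg.2 hBA; positivity
      linarith
    · exact mul_le_mul hc.le (by linarith) (by linarith) (by linarith)
  rcases hBA.eq_or_lt with h | h
  · have : x = y := by simp only [x, y, h]
    linarith
  · nlinarith [mul_pos (sub_pos.2 h) hA]

/-- The symmetrized phases. -/
noncomputable def phase (N : ℕ) (y : ℝ) (n : ℕ) : ℂ :=
  Complex.exp (Complex.I * ((((n : ℝ) - ((N : ℝ) - 1) / 2) * y : ℝ) : ℂ))

theorem phase_eq (N : ℕ) (y : ℝ) (n : ℕ) :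
    phase N y n = Complex.exp (Complex.I * ((-(((N : ℝ) - 1) / 2) * y : ℝ) : ℂ)) *
      Complex.exp (Complex.I * (n : ℂ) * (y : ℂ)) := by
  rw [phase, ← Complex.exp_add]; congr 1; push_cast; ring

/-- Centering the exponents makes the reflection n ↦ N - 1 - n cancel the sines; a real main term is
what `sub_div_three_le_norm_sub` requires. -/
theorem sum_phase (N : ℕ) (y : ℝ) :
    ∑ n ∈ Finset.range N, phase N y n
      = ((∑ n ∈ Finset.range N, Real.cos (((n : ℝ) - ((N : ℝ) - 1) / 2) * y) : ℝ) : ℂ) := by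
  have hsin : ∑ n ∈ Finset.range N, Real.sin (((n : ℝ) - ((N : ℝ) - 1) / 2) * y) = 0 := by
    have h := Finset.sum_range_reflect
      (fun n : ℕ => Real.sin (((n : ℝ) - ((N : ℝ) - 1) / 2) * y)) N
    have h2 : ∀ n ∈ Finset.range N,
        Real.sin ((((N - 1 - n : ℕ) : ℝ) - ((N : ℝ) - 1) / 2) * y)
        = -Real.sin (((n : ℝ) - ((N : ℝ) - 1) / 2) * y) := by
      intro n hn
      rw [Finset.mem_range] at hn
      have e : ((N - 1 - n : ℕ) : ℝ) = (N : ℝ) - 1 - n := by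
        rw [Nat.cast_sub (by omega), Nat.cast_sub (by omega)]; simp
      rw [← Real.sin_neg, e]; congr 1; ring
    rw [Finset.sum_congr rfl h2, Finset.sum_neg_distrib] at h
    linarith
  apply Complex.ext
  · rw [Complex.ofReal_re]
    simp [phase, Complex.exp_re]
  · rw [Complex.ofReal_im, ← hsin]
    simp [phase, Complex.exp_im]

/-- Pairing n with h + n extracts the factor 2 cos(hy/2), which gives the quadratic drop through cos
x ≤ 1 - 2x²/π². The angles left in the half-length sum are at most π/2 in modulus, so its terms lie
in [0, 1]. The pairing is why N is taken even. -/
theorem sum_cos_phase_mem {h : ℕ} {y : ℝ} (hy : (2 * h : ℕ) * |y| ≤ 2 * Real.pi) :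
    ∑ n ∈ Finset.range (2 * h), Real.cos (((n : ℝ) - (((2 * h : ℕ) : ℝ) - 1) / 2) * y)
      ∈ Set.Icc 0 ((2 * h : ℕ) * (1 - ((2 * h : ℕ) * |y|) ^ 2 / (8 * Real.pi ^ 2))) := by
  have hpi := Real.pi_pos
  push_cast at hy ⊢
  have e : ∑ n ∈ Finset.range (2 * h), Real.cos (((n : ℝ) - ((2 * h : ℝ) - 1) / 2) * y)
      = 2 * Real.cos (h * y / 2) *
        ∑ n ∈ Finset.range h, Real.cos (((n : ℝ) - ((h : ℝ) - 1) / 2) * y) := by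
    rw [two_mul h, Finset.sum_range_add, ← Finset.sum_add_distrib, Finset.mul_sum]
    refine Finset.sum_congr rfl fun n _ => ?_
    have e1 : ((n : ℝ) - ((2 * h : ℝ) - 1) / 2) * y
        = ((n : ℝ) - ((h : ℝ) - 1) / 2) * y - h * y / 2 := by ring
    have e2 : (((h + n : ℕ) : ℝ) - ((2 * h : ℝ) - 1) / 2) * y
        = ((n : ℝ) - ((h : ℝ) - 1) / 2) * y + h * y / 2 := by push_cast; ring
    rw [e1, e2, Real.cos_add, Real.cos_sub]; ring
  have habs : |(h : ℝ) * y| ≤ Real.pi := by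
    rw [abs_mul, Nat.abs_cast]; linarith
  have hc0 : 0 ≤ Real.cos (h * y / 2) := by
    have := abs_le.1 habs
    exact Real.cos_nonneg_of_mem_Icc ⟨by linarith [this.1], by linarith [this.2]⟩
  have hc1 : Real.cos (h * y / 2) ≤ 1 - (2 * h * |y|) ^ 2 / (8 * Real.pi ^ 2) := by
    have := Real.cos_le_one_sub_mul_cos_sq (x := h * y / 2)
      (by rw [abs_div, abs_two]; linarith)
    refine this.trans (le_of_eq ?_)
    rw [mul_pow, sq_abs]; field_simp; ring
  have hS : ∀ n ∈ Finset.range h, Real.cos (((n : ℝ) - ((h : ℝ) - 1) / 2) * y) ∈ Set.Icc (0 : ℝ) 1 := by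
    intro n hn
    rw [Finset.mem_range] at hn
    have hn' : (n : ℝ) + 1 ≤ h := by exact_mod_cast hn
    have hn0 : (0 : ℝ) ≤ n := Nat.cast_nonneg n
    refine ⟨?_, Real.cos_le_one _⟩
    have h1 : |((n : ℝ) - ((h : ℝ) - 1) / 2) * y| ≤ Real.pi / 2 := by
      rw [abs_mul]
      have : |(n : ℝ) - ((h : ℝ) - 1) / 2| ≤ h / 2 := abs_le.2 ⟨by linarith, by linarith⟩
      have := mul_le_mul_of_nonneg_right this (abs_nonneg y)
      linarith
    have := abs_le.1 h1
    exact Real.cos_nonneg_of_mem_Icc ⟨by linarith [this.1], by linarith [this.2]⟩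
  have hS0 := Finset.sum_nonneg fun n hn => (hS n hn).1
  have hS1 := Finset.sum_le_sum fun n hn => (hS n hn).2
  simp only [Finset.sum_const, Finset.card_range, nsmul_eq_mul, mul_one] at hS1
  rw [e]
  refine ⟨by positivity, ?_⟩
  calc _ ≤ 2 * (1 - (2 * h * |y|) ^ 2 / (8 * Real.pi ^ 2)) * (h : ℝ) :=
        mul_le_mul (by linarith) hS1 hS0 (by linarith)
    _ = _ := by ring

theorem norm_exp_I_ofReal_sub_one_le (x : ℝ) : ‖Complex.exp (Complex.I * (x : ℂ)) - 1‖ ≤ |x| := by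
  have := Real.norm_exp_I_mul_ofReal_sub_one_le (x := x)
  simpa using this

/-- Abel summation: the centered phases move by at most |y| per step and end within N|y|/2 of 1.
Bounding the noise through its partial sums makes its effect proportional to |y|. -/
theorem norm_sum_mul_phase_sub_le {N : ℕ} (hN : 0 < N) {a : ℕ → ℂ} {S : ℝ}
    (hS : ∀ k ≤ N, ‖∑ n ∈ Finset.range k, a n‖ ≤ S) (y : ℝ) :
    ‖∑ n ∈ Finset.range N, a n * phase N y n - ∑ n ∈ Finset.range N, a n‖
      ≤ 3 / 2 * (N * |y|) * S := by
  have hS0 : 0 ≤ S := (norm_nonneg _).trans (hS 0 (Nat.zero_le _))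
  have hy := abs_nonneg y
  have hN1 : (1 : ℝ) ≤ N := by exact_mod_cast hN
  have e : ∑ n ∈ Finset.range N, a n * phase N y n - ∑ n ∈ Finset.range N, a n
      = ∑ n ∈ Finset.range N, (phase N y n - 1) • a n := by
    rw [← Finset.sum_sub_distrib]
    refine Finset.sum_congr rfl fun n _ => ?_
    rw [smul_eq_mul]; ring
  have hend : ‖phase N y (N - 1) - 1‖ ≤ N * |y| / 2 := by
    refine (norm_exp_I_ofReal_sub_one_le _).trans ?_
    rw [abs_mul]
    have : ((N - 1 : ℕ) : ℝ) = (N : ℝ) - 1 := by rw [Nat.cast_sub hN]; simp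
    rw [this, (by ring : (N : ℝ) - 1 - ((N : ℝ) - 1) / 2 = ((N : ℝ) - 1) / 2),
      abs_of_nonneg (by linarith)]
    nlinarith
  have hstep : ∀ n : ℕ, ‖(phase N y (n + 1) - 1) - (phase N y n - 1)‖ ≤ |y| := by
    intro n
    have : (phase N y (n + 1) - 1) - (phase N y n - 1)
        = phase N y n * (Complex.exp (Complex.I * (y : ℂ)) - 1) := by
      rw [mul_sub, mul_one, phase, phase, ← Complex.exp_add, sub_sub_sub_cancel_right]
      congr 2
      push_cast; ring
    rw [this, norm_mul, phase, mul_comm Complex.I, Complex.norm_exp_ofReal_mul_I, one_mul]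
    exact norm_exp_I_ofReal_sub_one_le y
  rw [e, Finset.sum_range_by_parts]
  calc _ ≤ N * |y| / 2 * S + (N * |y|) * S := by
        refine (norm_sub_le _ _).trans (add_le_add ?_ ?_)
        · rw [norm_smul]
          exact mul_le_mul hend (hS N le_rfl) (norm_nonneg _) (by positivity)
        · refine (norm_sum_le _ _).trans ?_
          refine (Finset.sum_le_sum (g := fun _ => |y| * S) fun n hn => ?_).trans ?_
          · rw [norm_smul]
            rw [Finset.mem_range] at hn
            exact mul_le_mul (hstep n) (hS _ (by omega)) (norm_nonneg _) hy
          · rw [Finset.sum_const, Finset.card_range, nsmul_eq_mul, mul_assoc]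
            refine mul_le_mul_of_nonneg_right ?_ (by positivity)
            exact_mod_cast Nat.sub_le N 1
    _ = _ := by ring

theorem norm_dirichletSum_le_half {N : ℕ} (hN : 4 ≤ N) {y : ℝ} (hy : 2 * Real.pi < N * |y|)
    (hy' : |y| ≤ Real.pi + 1) : ‖dirichletSum N y‖ ≤ N / 2 := by
  have hpi := Real.pi_gt_three
  have hpi4 := Real.pi_le_four
  have hN' : (4 : ℝ) ≤ N := by exact_mod_cast hN
  have e : ‖dirichletSum N y‖ = ‖dirichletSum N |y|‖ := by
    rcases abs_choice y with h | h
    · rw [h]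
    · rw [h, norm_dirichletSum_neg]
  have hy0 : 0 < |y| := by
    by_contra! h
    have : |y| = 0 := le_antisymm h (abs_nonneg y)
    rw [this] at hy; linarith
  rw [e]
  rcases le_total |y| Real.pi with h | h
  · refine (norm_dirichletSum_le N hy0 le_rfl (by linarith)).trans ?_
    rw [div_le_iff₀ hy0]; linarith
  -- Here π ≤ |y| ≤ π + 1 ≤ 2π - 2, so the distance to the multiples of 2π is at least 2.
  · refine (norm_dirichletSum_le N (w := 2) (by norm_num) (by linarith) (by linarith)).trans ?_
    linarith

/-- If the correlation of `p + a n` with the frequency `y` is at least that with the frequency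
`0`, then `y` is small. -/
theorem mul_abs_lt_of_norm_le {N : ℕ} (hN : 4 ≤ N) (hev : Even N) {p δ y : ℝ} (hp : 0 < p)
    (hδ : 0 < δ) (hy : |y| ≤ Real.pi + 1) {a : ℕ → ℂ} (ha : ∀ n < N, ‖a n‖ ≤ p / 20)
    (hS : ∀ k ≤ N, ‖∑ n ∈ Finset.range k, a n‖ ≤ N * (p * δ / 400))
    (hmax : ‖(N : ℂ) * p + ∑ n ∈ Finset.range N, a n‖
      ≤ ‖(p : ℂ) * dirichletSum N y + ∑ n ∈ Finset.range N, a n *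
          Complex.exp (Complex.I * (n : ℂ) * (y : ℂ))‖) :
    N * |y| < δ := by
  have hN' : (4 : ℝ) ≤ N := by exact_mod_cast hN
  have hNp : 0 < N * p := by positivity
  have hpi := Real.pi_pos
  have hsum : ‖∑ n ∈ Finset.range N, a n‖ ≤ N * p / 20 := by
    refine (norm_sum_le_of_le _ fun n hn => ha n (Finset.mem_range.1 hn)).trans (le_of_eq ?_)
    simp; ring
  -- Near the true frequency a quadratic drop competes with a linear noise term; far from it the
  -- Dirichlet sum is at most half its peak, and crude noise bounds suffice.
  rcases le_or_gt (N * |y|) (2 * Real.pi) with hu | hu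
  · obtain ⟨h, rfl⟩ := hev.two_dvd
    have hR := sum_cos_phase_mem hu
    set N := 2 * h with hNdef
    set R := ∑ n ∈ Finset.range N, Real.cos (((n : ℝ) - ((N : ℝ) - 1) / 2) * y) with hRdef
    set u := (N : ℝ) * |y| with hudef
    set E := ∑ n ∈ Finset.range N, a n with hE
    have hu0 : 0 ≤ u := by positivity
    have h1 : ‖(p : ℂ) * dirichletSum N y + ∑ n ∈ Finset.range N, a n *
          Complex.exp (Complex.I * (n : ℂ) * (y : ℂ))‖
        = ‖((p * R : ℝ) : ℂ) + ∑ n ∈ Finset.range N, a n * phase N y n‖ := by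
      -- Multiplying by this unimodular number centers the phases without changing the norm.
      set z := Complex.exp (Complex.I * ((-(((N : ℝ) - 1) / 2) * y : ℝ) : ℂ)) with hz
      have hzn : ‖z‖ = 1 := by rw [hz, mul_comm, Complex.norm_exp_ofReal_mul_I]
      rw [← one_mul ‖(p : ℂ) * dirichletSum N y + _‖, ← hzn, ← norm_mul]
      congr 1
      rw [Complex.ofReal_mul, hRdef, ← sum_phase, mul_add, dirichletSum, Finset.mul_sum,
        Finset.mul_sum, Finset.mul_sum, Finset.mul_sum]
      congr 1 <;> refine Finset.sum_congr rfl fun n _ => ?_ <;> rw [phase_eq] <;> ring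
    have h2 := norm_sum_mul_phase_sub_le (by omega : 0 < N) hS y
    have h3 : ‖((N * p : ℝ) : ℂ) + E‖ ≤ ‖((p * R : ℝ) : ℂ) + E‖
        + 3 / 2 * u * (N * (p * δ / 400)) := by
      have e0 : ((N * p : ℝ) : ℂ) = (N : ℂ) * p := by push_cast; rfl
      rw [e0]
      refine hmax.trans ?_
      rw [h1]
      have e : ((p * R : ℝ) : ℂ) + ∑ n ∈ Finset.range N, a n * phase N y n
          = (((p * R : ℝ) : ℂ) + E) + (∑ n ∈ Finset.range N, a n * phase N y n - E) := by ring
      rw [e]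
      exact (norm_add_le _ _).trans (add_le_add le_rfl h2)
    have hpR : p * R ≤ N * p * (1 - u ^ 2 / (8 * Real.pi ^ 2)) := by
      refine (mul_le_mul_of_nonneg_left hR.2 hp.le).trans (le_of_eq ?_); ring
    have hfrac : 0 ≤ u ^ 2 / (8 * Real.pi ^ 2) := by positivity
    have h4 := sub_div_three_le_norm_sub (A := N * p) (B := p * R) (e := E) hNp
      (mul_nonneg hp.le hR.1) (hpR.trans (by nlinarith)) hsum
    have h5 : N * p * (u ^ 2 / (8 * Real.pi ^ 2)) / 3 ≤ 3 / 2 * u * (N * (p * δ / 400)) := by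
      linarith
    -- This gives u ≤ 0.09 π² δ when u > 0, and π² < 10 makes that less than δ; the 400 in the bound
    -- on partial sums is chosen for this.
    have h6 : u ^ 2 / (8 * Real.pi ^ 2) ≤ 9 / 800 * u * δ := by
      have e : 3 / 2 * u * (N * (p * δ / 400)) = N * p * (9 / 800 * u * δ) / 3 := by ring
      rw [e] at h5
      have := (div_le_div_iff_of_pos_right (by norm_num : (0 : ℝ) < 3)).1 h5
      exact le_of_mul_le_mul_left this hNp
    rw [div_le_iff₀ (by positivity)] at h6
    have hpi2 : Real.pi ^ 2 < 10 := by nlinarith [Real.pi_lt_d2]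
    by_contra! hc
    have hu1 : 0 < u := hδ.trans_le hc
    have : u ^ 2 < u * δ := by
      have : 0 < u * δ := by positivity
      nlinarith
    nlinarith
  · exfalso
    have h1 := norm_dirichletSum_le_half hN hu hy
    have h2 : ‖∑ n ∈ Finset.range N, a n * Complex.exp (Complex.I * (n : ℂ) * (y : ℂ))‖
        ≤ N * p / 20 := by
      refine (norm_sum_le_of_le (f := fun n => a n * Complex.exp (Complex.I * (n : ℂ) * (y : ℂ)))
        (n := fun _ => p / 20) _ fun n hn => ?_).trans (le_of_eq ?_)
      · have e : Complex.I * (n : ℂ) * (y : ℂ) = ((n * y : ℝ) : ℂ) * Complex.I := by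
          push_cast; ring
        rw [norm_mul, e, Complex.norm_exp_ofReal_mul_I, mul_one]
        exact ha n (Finset.mem_range.1 hn)
      · simp; ring
    have h3 := (hmax.trans (norm_add_le _ _))
    rw [norm_mul, Complex.norm_real, Real.norm_of_nonneg hp.le] at h3
    have h4 : N * p - N * p / 20 ≤ ‖(N : ℂ) * p + ∑ n ∈ Finset.range N, a n‖ := by
      have := norm_sub_le_norm_add ((N : ℂ) * p) (∑ n ∈ Finset.range N, a n)
      rw [norm_mul, Complex.norm_natCast, Complex.norm_real, Real.norm_of_nonneg hp.le] at this
      linarith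
    have h5 := mul_le_mul_of_nonneg_left h1 hp.le
    nlinarith

end Localization

/-! ## Correctness of the multi-level search on good data -/

section Levels

variable {δ ε : ℝ} {N : ℕ}

theorem timeStep_pos (hδ : 0 < δ) (hε : 0 < ε) (hN : 0 < N) (j : ℕ) : 0 < timeStep δ ε N j := by
  have : (0 : ℝ) < N := by exact_mod_cast hN
  unfold timeStep; positivity

theorem timeStep_succ (j : ℕ) : timeStep δ ε N (j + 1) = 2 * timeStep δ ε N j := by
  unfold timeStep
  have e : ((j + 1 : ℕ) : ℤ) - (⌈Real.logb 2 (1 / ε)⌉₊ : ℤ)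
      = ((j : ℤ) - (⌈Real.logb 2 (1 / ε)⌉₊ : ℤ)) + 1 := by push_cast; ring
  rw [e, zpow_add_one₀ (by norm_num)]; ring

theorem mul_timeStep_last (hε : 0 < ε) (hN : 0 < N) :
    N * timeStep δ ε N (numLevels ε - 1) = δ / ε := by
  have : (0 : ℝ) < N := by exact_mod_cast hN
  unfold timeStep numLevels
  rw [Nat.add_sub_cancel, sub_self, zpow_zero]
  field_simp

/-- Rounding up the logarithm makes the first step small enough that the whole interval [-π, π] is
free of aliases. -/
theorem mul_timeStep_zero_le (hδ : 0 < δ) (hε : 0 < ε) (hN : 0 < N) :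
    N * timeStep δ ε N 0 ≤ δ := by
  have hN' : (0 : ℝ) < N := by exact_mod_cast hN
  set m := ⌈Real.logb 2 (1 / ε)⌉₊ with hm
  have h1 : 1 / ε ≤ 2 ^ m := by
    have : Real.logb 2 (1 / ε) ≤ m := Nat.le_ceil _
    rw [Real.logb_le_iff_le_rpow (by norm_num) (by positivity)] at this
    exact_mod_cast this
  have e : N * timeStep δ ε N 0 = δ * ((1 / ε) / 2 ^ m) := by
    unfold timeStep
    rw [← hm, Nat.cast_zero, zero_sub, zpow_neg, zpow_natCast]
    field_simp
  rw [e]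
  refine mul_le_of_le_one_right hδ.le ?_
  rw [div_le_one (by positivity)]; exact h1

/-- One level of the search. -/
theorem abs_sub_lt_of_minimizer (hN : 4 ≤ N) (hev : Even N) {p lam τ θ : ℝ} {Z : Fin N → ℂ} {r : ℂ}
    {s : Set ℝ} (hp : 0 < p) (hδ : 0 < δ)
    (hZ : ∀ n : Fin N, ‖Z n * Complex.exp (Complex.I * (lam : ℂ) * ((n : ℕ) : ℂ) * (τ : ℂ)) - p‖
      ≤ p / 20)
    (hS : ∀ k ≤ N, ‖∑ n : Fin N, if (n : ℕ) < k then
      Z n * Complex.exp (Complex.I * (lam : ℂ) * ((n : ℕ) : ℂ) * (τ : ℂ)) - p else 0‖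
      ≤ N * (p * δ / 400))
    (hmin : ∀ r' : ℂ, ∀ θ' ∈ s, loss Z τ r θ ≤ loss Z τ r' θ') (hlam : lam ∈ s)
    (hθ : |(θ - lam) * τ| ≤ Real.pi + 1) : N * |(θ - lam) * τ| < δ := by
  have hN0 : 0 < N := by omega
  have hNc : (N : ℂ) ≠ 0 := by exact_mod_cast hN0.ne'
  set b : Fin N → ℂ := fun n =>
    Z n * Complex.exp (Complex.I * (lam : ℂ) * ((n : ℕ) : ℂ) * (τ : ℂ)) - p with hb
  let a : ℕ → ℂ := fun n => if h : n < N then b ⟨n, h⟩ else 0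
  have hab : ∀ n : Fin N, a n = b n := fun n => by simp [a, n.2]
  -- Demodulation at the true frequency: the correlation is a Dirichlet sum in the offset plus the
  -- demodulated errors.
  have key : ∀ θ' : ℝ, (N : ℂ) * corr Z τ θ' = (p : ℂ) * dirichletSum N ((θ' - lam) * τ)
      + ∑ n ∈ Finset.range N, a n * Complex.exp (Complex.I * (n : ℂ) * (((θ' - lam) * τ : ℝ) : ℂ)) := by
    intro θ'
    rw [corr, ← mul_assoc, mul_one_div_cancel hNc, one_mul, dirichletSum, Finset.mul_sum,
      ← Finset.sum_add_distrib, Finset.sum_range]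
    refine Finset.sum_congr rfl fun n _ => ?_
    rw [hab, ← add_mul, hb]
    have e : Complex.exp (Complex.I * (θ' : ℂ) * ((n : ℕ) : ℂ) * (τ : ℂ))
        = Complex.exp (Complex.I * (lam : ℂ) * ((n : ℕ) : ℂ) * (τ : ℂ)) *
          Complex.exp (Complex.I * ((n : ℕ) : ℂ) * (((θ' - lam) * τ : ℝ) : ℂ)) := by
      rw [← Complex.exp_add]; congr 1; push_cast; ring
    rw [e]; ring
  have hc := norm_corr_le_of_minimizer hN0 hmin hlam
  have hc' : ‖(N : ℂ) * corr Z τ lam‖ ≤ ‖(N : ℂ) * corr Z τ θ‖ := by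
    rw [norm_mul, norm_mul]; exact mul_le_mul_of_nonneg_left hc (norm_nonneg _)
  rw [key, key] at hc'
  refine mul_abs_lt_of_norm_le hN hev hp hδ hθ (a := a) (fun n hn => ?_) (fun k hk => ?_) ?_
  · have := hab ⟨n, hn⟩
    simp only at this
    rw [this]; exact hZ ⟨n, hn⟩
  · have e : ∑ n ∈ Finset.range k, a n = ∑ n : Fin N, if (n : ℕ) < k then b n else 0 := by
      have h1 : ∀ n : Fin N, (if (n : ℕ) < k then b n else 0)
          = (fun i : ℕ => if i < k then a i else 0) n := fun n => by simp only [hab]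
      rw [Finset.sum_congr rfl fun n _ => h1 n,
        Fin.sum_univ_eq_sum_range (fun i : ℕ => if i < k then a i else 0),
        ← Finset.sum_filter]
      congr 1
      ext i; simp; omega
    rw [e]; exact hS k hk
  · refine le_trans (le_of_eq ?_) hc'
    congr 1
    simp [dirichletSum]
    ring

/-- The data are a noisy version of `p * exp (-i lam n τ)`. -/
def GoodData {J : ℕ} (τ : ℕ → ℝ) (Z : Fin J → Fin N → ℂ) (p δ lam : ℝ) : Prop :=
  (∀ (j : Fin J) (n : Fin N),
    ‖Z j n * Complex.exp (Complex.I * (lam : ℂ) * ((n : ℕ) : ℂ) * (τ j : ℂ)) - p‖ ≤ p / 20) ∧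
  (∀ (j : Fin J), ∀ k ≤ N, ‖∑ n : Fin N, if (n : ℕ) < k then
    Z j n * Complex.exp (Complex.I * (lam : ℂ) * ((n : ℕ) : ℂ) * (τ j : ℂ)) - p else 0‖
      ≤ N * (p * δ / 400))

/-- The invariant is N |θ_j - λ| τ_j < δ. Since N ≥ 4 and δ < 1, it gives |θ_j - λ| τ_j < 1/4: λ
stays in the next search interval, and after doubling τ every candidate has offset below π + 1/2,
within the range π + 1 of the one-level lemma. -/
theorem GoodData.succeeds (hN : 4 ≤ N) (hev : Even N) {p lam : ℝ} (hp : 0 < p) (hδ : 0 < δ)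
    (hδ1 : δ < 1) (hε : 0 < ε) (hlam : lam ∈ Set.Icc (-Real.pi) Real.pi)
    {Z : Fin (numLevels ε) → Fin N → ℂ} (hZ : GoodData (timeStep δ ε N) Z p δ lam) :
    Succeeds (timeStep δ ε N) Z ε lam := by
  have hN0 : 0 < N := by omega
  have hpi := Real.pi_gt_three
  have hN' : (4 : ℝ) ≤ N := by exact_mod_cast hN
  have hτ := timeStep_pos hδ hε hN0
  refine ⟨exists_isRun hN0 hτ Z, fun r θ hrun => ?_⟩
  set τ := timeStep δ ε N with hτdef
  have main : ∀ j : ℕ, j < numLevels ε → N * |(θ j - lam) * τ j| < δ := by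
    intro j
    induction j with
    | zero =>
      intro hj
      obtain ⟨hmem, hmin⟩ := hrun ⟨0, hj⟩
      refine abs_sub_lt_of_minimizer hN hev hp hδ (hZ.1 ⟨0, hj⟩) (hZ.2 ⟨0, hj⟩) hmin hlam ?_
      have h0 := mul_timeStep_zero_le hδ hε hN0
      have hmem' : θ 0 ∈ Set.Icc (-Real.pi) Real.pi := hmem
      rw [abs_mul, abs_of_pos (hτ 0)]
      have h1 : |θ 0 - lam| ≤ 2 * Real.pi := abs_le.2
        ⟨by linarith [hmem'.1, hlam.2], by linarith [hmem'.2, hlam.1]⟩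
      have h2 : τ 0 ≤ 1 / 4 := by nlinarith [hτ 0]
      have := mul_le_mul h1 h2 (hτ 0).le (by positivity)
      change |θ 0 - lam| * τ 0 ≤ _
      linarith
    | succ j ih =>
      intro hj
      have hprev := ih (by omega)
      obtain ⟨hmem, hmin⟩ := hrun ⟨j + 1, hj⟩
      have hmem' : θ (j + 1) ∈ Set.Icc (θ j - Real.pi / (2 * τ j)) (θ j + Real.pi / (2 * τ j)) := hmem
      have hτj := hτ j
      rw [abs_mul, abs_of_pos hτj] at hprev
      have hclose : |θ j - lam| * τ j < 1 / 4 := by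
        have : 0 ≤ |θ j - lam| * τ j := by positivity
        nlinarith
      have hpt : Real.pi / (2 * τ j) * τ j = Real.pi / 2 := by field_simp
      have hlam' : lam ∈ Set.Icc (θ j - Real.pi / (2 * τ j)) (θ j + Real.pi / (2 * τ j)) := by
        have : |θ j - lam| ≤ Real.pi / (2 * τ j) := by
          refine le_of_mul_le_mul_right ?_ hτj
          linarith
        have := abs_le.1 this
        exact ⟨by linarith [this.1, this.2], by linarith [this.1, this.2]⟩
      refine abs_sub_lt_of_minimizer hN hev hp hδ (hZ.1 ⟨j + 1, hj⟩) (hZ.2 ⟨j + 1, hj⟩) hmin hlam' ?_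
      rw [hτdef, timeStep_succ, ← hτdef, abs_mul, abs_of_pos (by positivity : 0 < 2 * τ j)]
      have h1 : |θ (j + 1) - lam| ≤ Real.pi / (2 * τ j) + |θ j - lam| := by
        have h2 : |θ (j + 1) - θ j| ≤ Real.pi / (2 * τ j) := abs_le.2
          ⟨by linarith [hmem'.1], by linarith [hmem'.2]⟩
        have := abs_add_le (θ (j + 1) - θ j) (θ j - lam)
        rw [sub_add_sub_cancel] at this
        linarith
      have h3 := mul_le_mul_of_nonneg_right h1 (by positivity : 0 ≤ 2 * τ j)
      nlinarith
  have hJ : numLevels ε - 1 < numLevels ε := by unfold numLevels; omega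
  have hlast := main _ hJ
  have hT := mul_timeStep_last (δ := δ) hε hN0
  rw [← hτdef] at hT
  rw [abs_mul, abs_of_pos (hτ _)] at hlast
  have e : N * (|θ (numLevels ε - 1) - lam| * τ (numLevels ε - 1))
      = |θ (numLevels ε - 1) - lam| * (δ / ε) := by rw [← hT]; ring
  rw [e, ← mul_div_assoc, div_lt_iff₀ hε, mul_comm δ] at hlast
  exact lt_of_mul_lt_mul_right hlast hδ.le

end Levels

/-! ## Concentration of the filtered data -/

section Flatten

variable {J N Ns : ℕ} {S : Type}

/-- Uncurrying of triply indexed families. -/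
def flatten (J N Ns : ℕ) (S : Type) :
    (Fin J × Fin N × Fin Ns → S) ≃ (Fin J → Fin N → Fin Ns → S) :=
  (Equiv.curry (Fin J) (Fin N × Fin Ns) S).trans
    (Equiv.piCongrRight fun _ => Equiv.curry (Fin N) (Fin Ns) S)

theorem flatten_apply (ω : Fin J × Fin N × Fin Ns → S) (j : Fin J) (n : Fin N) (k : Fin Ns) :
    flatten J N Ns S ω j n k = ω (j, n, k) := rfl

variable [Fintype S] {w : Fin J → Fin N → S → ℝ}

theorem sum_triple_prod_eq_one (h1 : ∀ j n, ∑ x, w j n x = 1) :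
    ∑ ω : Fin J → Fin N → Fin Ns → S, ∏ j, ∏ n, ∏ k, w j n (ω j n k) = 1 := by
  rw [← sum_prod_eq_one (ι := Fin J × Fin N × Fin Ns) (w := fun i x => w i.1 i.2.1 x)
    fun i => h1 _ _]
  refine (Fintype.sum_equiv (flatten J N Ns S) _ _ fun ω => ?_).symm
  simp only [Fintype.prod_prod_type, flatten_apply]

theorem prob_norm_triple_sum_ge_le (hw : ∀ j n x, 0 ≤ w j n x) (h1 : ∀ j n, ∑ x, w j n x = 1)
    {f : Fin J → Fin N → S → ℂ} {b : Fin J → Fin N → ℝ} (hf : ∀ j n x, ‖f j n x‖ ≤ b j n)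
    (h0 : ∀ j n, ∑ x, (w j n x : ℂ) * f j n x = 0) {V t : ℝ} (hV : 0 < V)
    (hb : Ns * ∑ j, ∑ n, b j n ^ 2 ≤ V) (ht : 0 ≤ t) :
    prob (fun ω : Fin J → Fin N → Fin Ns → S => ∏ j, ∏ n, ∏ k, w j n (ω j n k))
      (fun ω => 2 * t ≤ ‖∑ j, ∑ n, ∑ k, f j n (ω j n k)‖)
      ≤ 4 * Real.exp (-(t ^ 2 / (2 * V))) := by
  have h := prob_norm_sum_ge_le (ι := Fin J × Fin N × Fin Ns) (w := fun i x => w i.1 i.2.1 x)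
    (fun i x => hw _ _ x) (fun i => h1 _ _) (f := fun i x => f i.1 i.2.1 x)
    (b := fun i => b i.1 i.2.1) (fun i x => hf _ _ x) (fun i => h0 _ _) hV (by
      simp only [Fintype.sum_prod_type, Finset.sum_const, Finset.card_univ, Fintype.card_fin,
        nsmul_eq_mul, ← Finset.mul_sum]
      exact hb) ht
  rw [← prob_equiv (flatten J N Ns S)]
  simpa only [Fintype.prod_prod_type, Fintype.sum_prod_type, flatten_apply] using h

end Flatten

/-! ### Mean, bias and noise of the filtered data -/

section Filtered

variable {M d : ℕ} {H : Matrix (Fin M) (Fin M) ℂ} {ψ : Sys M} {p lam : Fin M → ℝ}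
  {F : Fin (2 * d + 1) → ℂ}

theorem sampleValue_eq_weightedValue (F : Fin (2 * d + 1) → ℂ) (s : Sample (2 * d + 1)) :
    sampleValue F s = weightedValue (fun l =>
      Complex.exp (Complex.I * (Complex.arg (F l) : ℂ)) * (filterMass F : ℂ)) s := by
  rw [sampleValue, weightedValue]; ring

/-- The mean of a sample value, for the evolution time `t`. -/
noncomputable def filteredSignal (p lam : Fin M → ℝ) (F : Fin (2 * d + 1) → ℂ) (t : ℝ) : ℂ :=
  ∑ m, (p m : ℂ) * Complex.exp (-(Complex.I * (t : ℂ) * (lam m : ℂ))) * trigPoly F (lam m)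

/-- Delaying the time by l multiplies mode m by exp(-i l λ_m), so combining delays applies the
trigonometric polynomial to the spectrum. -/
theorem sum_mul_signal (a : Fin (2 * d + 1) → ℂ) (t : ℝ) :
    ∑ l, a l * signal p lam ((shift d l : ℝ) + t) = filteredSignal p lam a t := by
  simp only [signal, filteredSignal, trigPoly, Finset.mul_sum]
  rw [Finset.sum_comm]
  refine Finset.sum_congr rfl fun m _ => Finset.sum_congr rfl fun l _ => ?_
  have e : Complex.exp (-(Complex.I * (((shift d l : ℝ) + t : ℝ) : ℂ) * (lam m : ℂ)))
      = Complex.exp (-(Complex.I * (t : ℂ) * (lam m : ℂ))) *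
        Complex.exp (-(Complex.I * (shift d l : ℂ) * (lam m : ℂ))) := by
    rw [← Complex.exp_add]; congr 1; push_cast; ring
  rw [e]; ring

theorem shiftProb_nonneg (F : Fin (2 * d + 1) → ℂ) (l : Fin (2 * d + 1)) : 0 ≤ shiftProb F l :=
  div_nonneg (norm_nonneg _) (Finset.sum_nonneg fun _ _ => norm_nonneg _)

theorem sum_shiftProb (hF : 0 < filterMass F) : ∑ l, shiftProb F l = 1 := by
  unfold shiftProb
  rw [← Finset.sum_div]
  exact div_self hF.ne'

/-- Importance sampling: the probability of a shift times its phase and the total mass restores the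
coefficient. -/
theorem sum_sampleProb_mul_sampleValue (hg : Measures H ψ (signal p lam)) (hF : 0 < filterMass F)
    (t : ℝ) :
    ∑ s, (sampleProb H ψ (shiftProb F) (fun l => (shift d l : ℝ) + t) s : ℂ) * sampleValue F s
      = filteredSignal p lam F t := by
  simp only [sampleValue_eq_weightedValue]
  rw [sum_sampleProb_mul_weightedValue hg, ← sum_mul_signal]
  refine Finset.sum_congr rfl fun l _ => ?_
  congr 1
  have h1 := Complex.norm_mul_exp_arg_mul_I (F l)
  have h2 : (filterMass F : ℂ) ≠ 0 := by exact_mod_cast hF.ne'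
  rw [shiftProb, mul_comm Complex.I]
  conv_rhs => rw [← h1]
  push_cast
  field_simp

theorem norm_sampleValue_le (hF : 0 < filterMass F) (s : Sample (2 * d + 1)) :
    ‖sampleValue F s‖ ≤ 2 * filterMass F := by
  rw [sampleValue_eq_weightedValue]
  refine norm_weightedValue_le _ (fun l => ?_) s
  rw [norm_mul, mul_comm Complex.I, Complex.norm_exp_ofReal_mul_I, one_mul, Complex.norm_real,
    Real.norm_of_nonneg hF.le]

/-- The mean of a function bounded by `b` is bounded by `b`. -/
theorem norm_sum_mul_le {Ω : Type} [Fintype Ω] {w : Ω → ℝ} (hw : ∀ ω, 0 ≤ w ω)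
    (h1 : ∑ ω, w ω = 1) {f : Ω → ℂ} {b : ℝ} (hf : ∀ ω, ‖f ω‖ ≤ b) :
    ‖∑ ω, (w ω : ℂ) * f ω‖ ≤ b := by
  refine (norm_sum_le_of_le (n := fun ω => w ω * b) _ fun ω _ => ?_).trans (le_of_eq ?_)
  · rw [norm_mul, Complex.norm_real, Real.norm_of_nonneg (hw ω)]
    exact mul_le_mul_of_nonneg_left (hf ω) (hw ω)
  · rw [← Finset.sum_mul, h1, one_mul]

/-- The error is an average, with weights p_m, of filter errors times unimodular phases, so the bias
is at most q whatever the number of modes. -/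
theorem norm_filteredSignal_sub_le {M : ℕ} {p lam : Fin (M + 1) → ℝ} (hp : ∀ m, 0 ≤ p m)
    (hp1 : ∑ m, p m = 1) {q : ℝ} (h0 : ‖trigPoly F (lam 0) - 1‖ ≤ q)
    (hF : ∀ m, m ≠ 0 → ‖trigPoly F (lam m)‖ ≤ q) (t : ℝ) :
    ‖filteredSignal p lam F t * Complex.exp (Complex.I * (t : ℂ) * (lam 0 : ℂ)) - p 0‖ ≤ q := by
  have e : filteredSignal p lam F t * Complex.exp (Complex.I * (t : ℂ) * (lam 0 : ℂ)) - p 0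
      = ∑ m, (p m : ℂ) * (Complex.exp (-(Complex.I * (t : ℂ) * ((lam m - lam 0 : ℝ) : ℂ))) *
        (trigPoly F (lam m) - if m = 0 then 1 else 0)) := by
    rw [filteredSignal, Finset.sum_mul]
    have : (p 0 : ℂ) = ∑ m, (p m : ℂ) *
        (Complex.exp (-(Complex.I * (t : ℂ) * ((lam m - lam 0 : ℝ) : ℂ))) *
          if m = 0 then 1 else 0) := by
      simp
    rw [this, ← Finset.sum_sub_distrib]
    refine Finset.sum_congr rfl fun m _ => ?_
    have e2 : Complex.exp (-(Complex.I * (t : ℂ) * ((lam m - lam 0 : ℝ) : ℂ)))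
        = Complex.exp (-(Complex.I * (t : ℂ) * (lam m : ℂ))) *
          Complex.exp (Complex.I * (t : ℂ) * (lam 0 : ℂ)) := by
      rw [← Complex.exp_add]; congr 1; push_cast; ring
    rw [e2]; ring
  rw [e]
  refine norm_sum_mul_le hp hp1 fun m => ?_
  rw [norm_mul, norm_exp_neg_I_mul, one_mul]
  by_cases hm : m = 0
  · rw [if_pos hm, hm]; exact h0
  · rw [if_neg hm, sub_zero]; exact hF m hm

variable {J N Ns : ℕ} {τ : ℕ → ℝ}

theorem filteredDataProb_nonneg (ω : FilteredData J N Ns d) :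
    0 ≤ filteredDataProb H ψ τ F ω :=
  Finset.prod_nonneg fun _ _ => Finset.prod_nonneg fun _ _ => Finset.prod_nonneg fun _ _ =>
    sampleProb_nonneg (shiftProb_nonneg F) _

theorem sum_filteredDataProb {g : ℝ → ℂ} (hg : Measures H ψ g) (hF : 0 < filterMass F) :
    ∑ ω : FilteredData J N Ns d, filteredDataProb H ψ τ F ω = 1 :=
  sum_triple_prod_eq_one (w := fun (j : Fin J) (n : Fin N) x =>
    sampleProb H ψ (shiftProb F) (fun l => (shift d l : ℝ) + (n : ℕ) * τ j) x)
    fun _ _ => sum_sampleProb hg (sum_shiftProb hF)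

/-- The centered and demodulated sample value. -/
noncomputable def noise (p lam : Fin M → ℝ) (F : Fin (2 * d + 1) → ℂ) (lam0 t : ℝ)
    (s : Sample (2 * d + 1)) : ℂ :=
  (sampleValue F s - filteredSignal p lam F t) * Complex.exp (Complex.I * (t : ℂ) * (lam0 : ℂ))

theorem norm_noise_le (hg : Measures H ψ (signal p lam)) (hF : 0 < filterMass F) (lam0 t : ℝ)
    (s : Sample (2 * d + 1)) : ‖noise p lam F lam0 t s‖ ≤ 4 * filterMass F := by
  have h1 : ‖Complex.exp (Complex.I * (t : ℂ) * (lam0 : ℂ))‖ = 1 := by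
    have := norm_exp_neg_I_mul (-t) lam0
    rwa [Complex.ofReal_neg, mul_neg, neg_mul, neg_neg] at this
  rw [noise, norm_mul, h1, mul_one]
  have h2 := norm_sum_mul_le
    (sampleProb_nonneg (H := H) (ψ := ψ) (t := fun l => (shift d l : ℝ) + t) (shiftProb_nonneg F))
    (sum_sampleProb hg (sum_shiftProb hF)) (norm_sampleValue_le hF)
  rw [sum_sampleProb_mul_sampleValue hg hF] at h2
  have := norm_sub_le (sampleValue F s) (filteredSignal p lam F t)
  linarith [norm_sampleValue_le hF s]

theorem sum_sampleProb_mul_noise (hg : Measures H ψ (signal p lam)) (hF : 0 < filterMass F)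
    (lam0 t : ℝ) :
    ∑ s, (sampleProb H ψ (shiftProb F) (fun l => (shift d l : ℝ) + t) s : ℂ) *
      noise p lam F lam0 t s = 0 := by
  have h1 : (∑ s, (sampleProb H ψ (shiftProb F) (fun l => (shift d l : ℝ) + t) s : ℂ)) = 1 := by
    exact_mod_cast sum_sampleProb hg (t := fun l => (shift d l : ℝ) + t) (sum_shiftProb hF)
  have h2 := sum_sampleProb_mul_sampleValue hg hF t
  simp only [noise, ← mul_assoc, ← Finset.sum_mul, mul_sub, Finset.sum_sub_distrib]
  rw [h1, h2, one_mul, sub_self, zero_mul]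

/-- Hoeffding's bound for the noise added up over the data points in a set. -/
theorem prob_norm_sum_noise_ge_le (hg : Measures H ψ (signal p lam)) (hF : 0 < filterMass F)
    (lam0 : ℝ) (j₀ : Fin J) (A : Finset (Fin N)) {V t b : ℝ} (hb : filterMass F ≤ b)
    (hV : 0 < V) (hA : Ns * (A.card * (4 * b) ^ 2) ≤ V) (ht : 0 ≤ t) :
    prob (fun ω : FilteredData J N Ns d => filteredDataProb H ψ τ F ω)
      (fun ω => 2 * t ≤ ‖∑ n ∈ A, ∑ k, noise p lam F lam0 ((n : ℕ) * τ j₀) (ω j₀ n k)‖)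
      ≤ 4 * Real.exp (-(t ^ 2 / (2 * V))) := by
  classical
  have h := prob_norm_triple_sum_ge_le (J := J) (N := N) (Ns := Ns)
    (w := fun j n x => sampleProb H ψ (shiftProb F) (fun l => (shift d l : ℝ) + (n : ℕ) * τ j) x)
    (fun _ _ _ => sampleProb_nonneg (shiftProb_nonneg F) _)
    (fun _ _ => sum_sampleProb hg (sum_shiftProb hF))
    -- Samples outside the chosen level and set get the zero function, so the bound for the full
    -- product space applies.
    (f := fun j n x => if j = j₀ ∧ n ∈ A then noise p lam F lam0 ((n : ℕ) * τ j) x else 0)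
    (b := fun j n => if j = j₀ ∧ n ∈ A then 4 * b else 0)
    (fun j n x => by
      split_ifs
      · exact (norm_noise_le hg hF _ _ _).trans (by linarith)
      · simp)
    (fun j n => by
      split_ifs
      · exact sum_sampleProb_mul_noise hg hF _ _
      · simp) (V := V) (t := t) hV (by
      refine le_trans (le_of_eq ?_) hA
      congr 1
      simp only [ite_and, ite_pow]
      rw [Finset.sum_eq_single j₀ (fun j _ hj => by simp [hj]) (by simp)]
      simp) ht
  have e : ∀ ω : FilteredData J N Ns d,
      (∑ j, ∑ n, ∑ k, if j = j₀ ∧ n ∈ A then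
        noise p lam F lam0 ((n : ℕ) * τ j) (ω j n k) else 0)
      = ∑ n ∈ A, ∑ k, noise p lam F lam0 ((n : ℕ) * τ j₀) (ω j₀ n k) := by
    intro ω
    rw [Finset.sum_eq_single j₀ (fun j _ hj => by simp [hj]) (by simp)]
    rw [← Finset.sum_filter_add_sum_filter_not Finset.univ (fun n => n ∈ A)]
    rw [Finset.sum_eq_zero (s := Finset.univ.filter fun n => n ∉ A) fun n hn => by
      rw [Finset.mem_filter] at hn; simp [hn.2]]
    rw [add_zero, Finset.filter_univ_mem]
    exact Finset.sum_congr rfl fun n hn => by simp [hn]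
  simp only [e] at h
  exact h

theorem dataPoint_mul_exp_sub (hNs : 0 < Ns) (lam0 p0 : ℝ) (ω : FilteredData J N Ns d)
    (j : Fin J) (n : Fin N) :
    dataPoint F ω j n * Complex.exp (Complex.I * (lam0 : ℂ) * ((n : ℕ) : ℂ) * (τ j : ℂ)) - p0
      = (1 / (Ns : ℂ)) * (∑ k, noise p lam F lam0 ((n : ℕ) * τ j) (ω j n k))
        + (filteredSignal p lam F ((n : ℕ) * τ j) *
          Complex.exp (Complex.I * (((n : ℕ) * τ j : ℝ) : ℂ) * (lam0 : ℂ)) - p0) := by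
  have hNs' : (Ns : ℂ) ≠ 0 := by exact_mod_cast hNs.ne'
  have e : Complex.I * (lam0 : ℂ) * ((n : ℕ) : ℂ) * (τ j : ℂ)
      = Complex.I * (((n : ℕ) * τ j : ℝ) : ℂ) * (lam0 : ℂ) := by push_cast; ring
  rw [e]
  simp only [noise]
  rw [← Finset.sum_mul, Finset.sum_sub_distrib, dataPoint, Finset.sum_const, Finset.card_univ,
    Fintype.card_fin, nsmul_eq_mul]
  field_simp
  ring

end Filtered

/-! ### Success probability of the second stage -/

section SecondStage

variable {M d N Ns : ℕ} {H : Matrix (Fin (M + 1)) (Fin (M + 1)) ℂ} {ψ : Sys (M + 1)}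
  {p lam : Fin (M + 1) → ℝ} {F : Fin (2 * d + 1) → ℂ} {δ ε q b L : ℝ}

/-- Error budgets: pointwise, p₀/40 of noise plus a bias of at most p₀/800 fits in p₀/20; per point
in the partial sums, noise and bias each use p₀δ/800 of the allowed p₀δ/400. -/
theorem goodData_of_noise_lt {J : ℕ} {τ : ℕ → ℝ} (hp : ∀ m, 0 ≤ p m) (hp1 : ∑ m, p m = 1)
    (hp0 : 0 < p 0) (hNs : 0 < Ns) (hδ : 0 < δ) (hδ1 : δ < 1) (hq : q ≤ p 0 * δ ^ 2 / 800)
    (h0 : ‖trigPoly F (lam 0) - 1‖ ≤ q) (hF : ∀ m, m ≠ 0 → ‖trigPoly F (lam m)‖ ≤ q)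
    {ω : FilteredData J N Ns d}
    (h1 : ∀ (j : Fin J) (n : Fin N),
      ‖∑ n ∈ {n}, ∑ k, noise p lam F (lam 0) ((n : ℕ) * τ j) (ω j n k)‖ ≤ 2 * (Ns * p 0 / 80))
    (h2 : ∀ (j : Fin J) (i : Fin (N + 1)),
      ‖∑ n ∈ Finset.univ.filter (fun n : Fin N => (n : ℕ) < i),
        ∑ k, noise p lam F (lam 0) ((n : ℕ) * τ j) (ω j n k)‖ ≤ 2 * (Ns * N * p 0 * δ / 1600)) :
    GoodData τ (dataPoint F ω) (p 0) δ (lam 0) := by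
  have hNs' : (0 : ℝ) < Ns := by exact_mod_cast hNs
  have hδ2 : δ ^ 2 ≤ δ := by nlinarith
  have hpδ : p 0 * δ ^ 2 ≤ p 0 * δ := mul_le_mul_of_nonneg_left hδ2 hp0.le
  have hpδ1 : p 0 * δ ≤ p 0 := by nlinarith
  have hdet := norm_filteredSignal_sub_le hp hp1 h0 hF
  have hNsn : ‖(1 / (Ns : ℂ))‖ = 1 / Ns := by rw [norm_div, norm_one, Complex.norm_natCast]
  refine ⟨fun j n => ?_, fun j i hi => ?_⟩
  · rw [dataPoint_mul_exp_sub (p := p) (lam := lam) hNs]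
    refine (norm_add_le _ _).trans ?_
    have h3 := h1 j n
    rw [Finset.sum_singleton] at h3
    have h4 : ‖(1 / (Ns : ℂ)) * ∑ k, noise p lam F (lam 0) ((n : ℕ) * τ j) (ω j n k)‖
        ≤ p 0 / 40 := by
      rw [norm_mul, hNsn]
      refine (mul_le_mul_of_nonneg_left h3 (by positivity)).trans (le_of_eq ?_)
      field_simp; ring
    have := hdet ((n : ℕ) * τ j)
    linarith
  · rw [← Finset.sum_filter]
    have e : ∀ n : Fin N, dataPoint F ω j n *
        Complex.exp (Complex.I * (lam 0 : ℂ) * ((n : ℕ) : ℂ) * (τ j : ℂ)) - p 0 = _ :=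
      fun n => dataPoint_mul_exp_sub (p := p) (lam := lam) hNs (lam 0) (p 0) ω j n
    rw [Finset.sum_congr rfl fun n _ => e n, Finset.sum_add_distrib, ← Finset.mul_sum]
    refine (norm_add_le _ _).trans ?_
    have h3 := h2 j ⟨i, by omega⟩
    have h4 : ‖(1 / (Ns : ℂ)) * ∑ n ∈ Finset.univ.filter (fun n : Fin N => (n : ℕ) < i),
        ∑ k, noise p lam F (lam 0) ((n : ℕ) * τ j) (ω j n k)‖ ≤ N * (p 0 * δ / 800) := by
      rw [norm_mul, hNsn]
      refine (mul_le_mul_of_nonneg_left h3 (by positivity)).trans (le_of_eq ?_)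
      field_simp; ring
    have h5 : ‖∑ n ∈ Finset.univ.filter (fun n : Fin N => (n : ℕ) < i),
        (filteredSignal p lam F ((n : ℕ) * τ j) *
          Complex.exp (Complex.I * (((n : ℕ) * τ j : ℝ) : ℂ) * (lam 0 : ℂ)) - p 0)‖
        ≤ N * (p 0 * δ / 800) := by
      refine (norm_sum_le_of_le (n := fun _ => p 0 * δ / 800) _ fun n _ =>
        (hdet _).trans (by linarith)).trans ?_
      rw [Finset.sum_const, nsmul_eq_mul]
      refine mul_le_mul_of_nonneg_right ?_ (by positivity)
      exact_mod_cast (Finset.card_filter_le _ _).trans (by simp)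
    linarith

/-- The second stage succeeds with high probability. -/
theorem one_sub_le_prob_succeeds (hg : Measures H ψ (signal p lam)) (hp : ∀ m, 0 ≤ p m)
    (hp1 : ∑ m, p m = 1) (hp0 : 0 < p 0) (hlam : lam 0 ∈ Set.Icc (-Real.pi) Real.pi)
    (hδ : 0 < δ) (hδ1 : δ < 1) (hε : 0 < ε) (hN : 4 ≤ N) (hev : Even N) (hNδ : 1 ≤ N * δ ^ 2)
    (hq : q ≤ p 0 * δ ^ 2 / 800) (h0 : ‖trigPoly F (lam 0) - 1‖ ≤ q)
    (hF : ∀ m, m ≠ 0 → ‖trigPoly F (lam m)‖ ≤ q) (hm : 0 < filterMass F) (hb : filterMass F ≤ b)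
    (hL : 0 ≤ L) (hNs : 0 < Ns) (hNsL : 81920000 * b ^ 2 * L ≤ Ns * p 0 ^ 2) :
    1 - 12 * numLevels ε * N * Real.exp (-L) ≤
      prob (fun ω : FilteredData (numLevels ε) N Ns d =>
          filteredDataProb H ψ (timeStep δ ε N) F ω)
        (fun ω => Succeeds (timeStep δ ε N) (dataPoint F ω) ε (lam 0)) := by
  set τ := timeStep δ ε N
  set J := numLevels ε
  have hNs' : (0 : ℝ) < Ns := by exact_mod_cast hNs
  have hN' : (4 : ℝ) ≤ N := by exact_mod_cast hN
  have hb0 : 0 < b := hm.trans_le hb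
  have hw : ∀ ω : FilteredData J N Ns d, 0 ≤ filteredDataProb H ψ τ F ω := filteredDataProb_nonneg
  let B1 : Fin J × Fin N → FilteredData J N Ns d → Prop := fun i ω =>
    2 * (Ns * p 0 / 80) ≤
      ‖∑ n ∈ {i.2}, ∑ k, noise p lam F (lam 0) ((n : ℕ) * τ i.1) (ω i.1 n k)‖
  let B2 : Fin J × Fin (N + 1) → FilteredData J N Ns d → Prop := fun i ω =>
    2 * (Ns * N * p 0 * δ / 1600) ≤
      ‖∑ n ∈ Finset.univ.filter (fun n : Fin N => (n : ℕ) < i.2),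
        ∑ k, noise p lam F (lam 0) ((n : ℕ) * τ i.1) (ω i.1 n k)‖
  have hB1 : ∀ i, prob (fun ω => filteredDataProb H ψ τ F ω) (B1 i) ≤ 4 * Real.exp (-L) := by
    intro i
    refine (prob_norm_sum_noise_ge_le hg hm (lam 0) i.1 {i.2} hb
      (V := Ns * (4 * b) ^ 2) (by positivity) (by simp) (by positivity)).trans ?_
    refine mul_le_mul_of_nonneg_left (Real.exp_le_exp.2 (neg_le_neg ?_)) (by norm_num)
    rw [le_div_iff₀ (by positivity)]
    have h1 := mul_le_mul_of_nonneg_left hNsL hNs'.le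
    have h2 : 0 ≤ Ns * (b ^ 2 * L) := by positivity
    nlinarith
  have hB2 : ∀ i, prob (fun ω => filteredDataProb H ψ τ F ω) (B2 i) ≤ 4 * Real.exp (-L) := by
    intro i
    refine (prob_norm_sum_noise_ge_le hg hm (lam 0) i.1 _ hb
      (V := Ns * (N * (4 * b) ^ 2)) (by positivity) ?_ (by positivity)).trans ?_
    · gcongr
      exact (Finset.card_filter_le _ _).trans (by simp)
    refine mul_le_mul_of_nonneg_left (Real.exp_le_exp.2 (neg_le_neg ?_)) (by norm_num)
    rw [le_div_iff₀ (by positivity)]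
    -- The exponent is Ns p₀² · Nδ² / (32 · 1600² b²), and 32 · 1600² = 81920000. Here Nδ² ≥ 1 pays
    -- for the smaller threshold with the averaging over n.
    have h1 : 81920000 * b ^ 2 * L * 1 ≤ Ns * p 0 ^ 2 * (N * δ ^ 2) :=
      mul_le_mul hNsL hNδ (by norm_num) (by positivity)
    have h2 := mul_le_mul_of_nonneg_left h1 (by positivity : (0 : ℝ) ≤ Ns * N)
    calc L * (2 * (Ns * (N * (4 * b) ^ 2))) = Ns * N * (81920000 * b ^ 2 * L * 1) / 2560000 := by ring
      _ ≤ Ns * N * (Ns * p 0 ^ 2 * (N * δ ^ 2)) / 2560000 := by gcongr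
      _ = _ := by ring
  have hbad := (prob_or_le hw (fun ω => ∃ i, B1 i ω) (fun ω => ∃ i, B2 i ω)).trans
    (add_le_add (prob_exists_le_card_mul hw B1 hB1) (prob_exists_le_card_mul hw B2 hB2))
  have hmain := one_sub_le_prob hw (sum_filteredDataProb hg hm)
    (E := fun ω => Succeeds τ (dataPoint F ω) ε (lam 0))
    (B := fun ω => (∃ i, B1 i ω) ∨ (∃ i, B2 i ω)) fun ω hω => by
      rw [not_or, not_exists, not_exists] at hω
      refine (goodData_of_noise_lt hp hp1 hp0 hNs hδ hδ1 hq h0 hF (fun j n => ?_)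
        (fun j i => ?_)).succeeds hN hev hp0 hδ hδ1 hε hlam
      · exact (not_le.1 (hω.1 (j, n))).le
      · exact (not_le.1 (hω.2 (j, i))).le
  refine le_trans ?_ hmain
  -- J·N single points and J·(N + 1) prefixes, each failing with probability at most 4 exp(-L);
  -- 4J(2N + 1) ≤ 12JN.
  simp only [Fintype.card_prod, Fintype.card_fin] at hbad
  push_cast at hbad
  have hJe : 0 ≤ (J : ℝ) * Real.exp (-L) := by positivity
  nlinarith

end SecondStage

/-! ## The rough estimate -/

section Rough

variable {d : ℕ}

/-- The weights proportional to `1 / (1 + |l|)`. -/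
noncomputable def harmonicWeight (d : ℕ) (l : Fin (2 * d + 1)) : ℝ :=
  1 / (1 + |(shift d l : ℝ)|) / harmonicMass d

theorem harmonicWeight_pos (l : Fin (2 * d + 1)) : 0 < harmonicWeight d l :=
  div_pos (by positivity) (harmonicMass_pos d)

theorem sum_harmonicWeight (d : ℕ) : ∑ l, harmonicWeight d l = 1 := by
  unfold harmonicWeight
  rw [← Finset.sum_div]
  exact div_self (harmonicMass_pos d).ne'

/-- The harmonic weights dominate the coefficients of all step filters up to one logarithmic factor.
Hence the sampling distribution need not depend on the grid point, and the samples are reused for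
the whole scan. -/
theorem norm_div_harmonicWeight_le {F : Fin (2 * d + 1) → ℂ} (l : Fin (2 * d + 1))
    (hF : ‖F l‖ ≤ 1 / (1 + |(shift d l : ℝ)|)) :
    ‖F l / (harmonicWeight d l : ℂ)‖ ≤ harmonicMass d := by
  rw [norm_div, Complex.norm_real, Real.norm_of_nonneg (harmonicWeight_pos l).le,
    div_le_iff₀ (harmonicWeight_pos l), harmonicWeight, mul_div_cancel₀ _ (harmonicMass_pos d).ne']
  exact hF

/-- The degree of the filters used for the rough estimate. -/
noncomputable def roughDegree (Δ p₀ : ℝ) : ℕ := filterPower (p₀ / 8) * filterBase (Δ / 8)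

/-- The grid on which the spectral distribution is scanned. -/
noncomputable def gridPoint (Δ : ℝ) (i : ℕ) : ℝ := -Real.pi + i * (Δ / 8)

/-- The filter for the grid point `i`. -/
noncomputable def gridFilter (Δ p₀ : ℝ) (i : ℕ) : Fin (2 * roughDegree Δ p₀ + 1) → ℂ :=
  stepFilter (filterPower (p₀ / 8)) (filterBase (Δ / 8)) (gridPoint Δ i)

/-- The estimate of the weight of the spectrum below the grid point `i`. -/
noncomputable def gridScore (Δ p₀ : ℝ) (n i : ℕ)
    (ω : Fin n → Sample (2 * roughDegree Δ p₀ + 1)) : ℝ :=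
  (1 / (n : ℝ)) * (∑ k, weightedValue
    (fun l => gridFilter Δ p₀ i l / (harmonicWeight (roughDegree Δ p₀) l : ℂ)) (ω k)).re

/-- The rough estimate from `n` samples: the first grid point below which there is spectral weight
at least `p₀ / 2`. -/
noncomputable def roughEstimator (Δ p₀ : ℝ) (n : ℕ) : RoughEstimator where
  numTimes := 2 * roughDegree Δ p₀ + 1
  time l := shift (roughDegree Δ p₀) l
  weight := harmonicWeight (roughDegree Δ p₀)
  weight_pos := harmonicWeight_pos
  weight_sum := sum_harmonicWeight _
  numSamples := n
  estimate ω := gridPoint Δ (sInf {i | p₀ / 2 ≤ gridScore Δ p₀ n i ω})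

theorem abs_shift_le (l : Fin (2 * d + 1)) : |(shift d l : ℝ)| ≤ d := by
  have h : |shift d l| ≤ d := by
    rw [abs_le, shift]; have := l.2; constructor <;> omega
  exact_mod_cast h

theorem shift_last (d : ℕ) : shift d (Fin.last (2 * d)) = d := by
  simp [shift]; ring

theorem iSup_abs_shift_add (d : ℕ) {t : ℝ} (ht : 0 ≤ t) :
    ⨆ l : Fin (2 * d + 1), |(shift d l : ℝ) + t| = d + t := by
  refine le_antisymm (ciSup_le fun l => ?_) ?_
  · refine (abs_add_le _ _).trans ?_
    rw [abs_of_nonneg ht]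
    linarith [abs_shift_le l]
  · refine le_trans (le_of_eq ?_) (le_ciSup (f := fun l : Fin (2 * d + 1) =>
      |(shift d l : ℝ) + t|) (Set.finite_range _).bddAbove (Fin.last (2 * d)))
    rw [shift_last, abs_of_nonneg (by positivity)]
    simp

theorem maxTime_roughEstimator (Δ p₀ : ℝ) (n : ℕ) :
    (roughEstimator Δ p₀ n).maxTime = roughDegree Δ p₀ := by
  have := iSup_abs_shift_add (roughDegree Δ p₀) le_rfl
  simp only [add_zero] at this
  exact this

theorem totalTime_roughEstimator (Δ p₀ : ℝ) (n : ℕ) :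
    (roughEstimator Δ p₀ n).totalTime = 2 * n * roughDegree Δ p₀ := by
  rw [RoughEstimator.totalTime, maxTime_roughEstimator]; rfl

variable {M : ℕ} {H : Matrix (Fin (M + 1)) (Fin (M + 1)) ℂ} {ψ : Sys (M + 1)}
  {p lam : Fin (M + 1) → ℝ} {Δ p₀ : ℝ} {n : ℕ}

theorem gridPoint_mem {i : ℕ} (hΔ : 0 < Δ) (hi : i ≤ ⌊16 * Real.pi / Δ⌋₊) :
    gridPoint Δ i ∈ Set.Icc (-Real.pi) Real.pi := by
  have hpi := Real.pi_pos
  have h1 : (i : ℝ) ≤ 16 * Real.pi / Δ := (Nat.le_floor_iff (by positivity)).1 hi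
  rw [le_div_iff₀ hΔ] at h1
  unfold gridPoint
  constructor
  · have : 0 ≤ (i : ℝ) * (Δ / 8) := by positivity
    linarith
  · linarith

theorem filteredSignal_zero (p lam : Fin (M + 1) → ℝ) (F : Fin (2 * d + 1) → ℂ) :
    filteredSignal p lam F 0 = ∑ m, (p m : ℂ) * trigPoly F (lam m) := by
  simp [filteredSignal]

/-- If all the scores are close to their means, then the rough estimate is correct. -/
theorem abs_gridPoint_sub_le (hp : ∀ m, 0 ≤ p m) (hp1 : ∑ m, p m = 1) (hp0 : p 0 = p₀)
    (hp0pos : 0 < p₀) (hΔ : 0 < Δ) (hmono : Monotone lam)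
    (hlam : ∀ m, lam m ∈ spectralRange Δ) {s : ℕ → ℝ}
    (hs : ∀ i ≤ ⌊16 * Real.pi / Δ⌋₊,
      |s i - (filteredSignal p lam (gridFilter Δ p₀ i) 0).re| ≤ p₀ / 8) :
    |gridPoint Δ (sInf {i | p₀ / 2 ≤ s i}) - lam 0| ≤ Δ / 4 := by
  have hpi := Real.pi_pos
  have hp01 : p₀ ≤ 1 := by
    rw [← hp0, ← hp1]
    exact Finset.single_le_sum (fun m _ => hp m) (Finset.mem_univ 0)
  obtain ⟨hl0, hl1⟩ := hlam 0
  have hre : ∀ i, (filteredSignal p lam (gridFilter Δ p₀ i) 0).re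
      = ∑ m, p m * (trigPoly (gridFilter Δ p₀ i) (lam m)).re := by
    intro i
    rw [filteredSignal_zero, Complex.re_sum]
    exact Finset.sum_congr rfl fun m _ => Complex.re_ofReal_mul _ _
  -- The ground state alone contributes p₀(1 - p₀/8) ≥ 7p₀/8 and the other modes contribute
  -- nonnegatively, as the filter takes values in [0, 1].
  have hhigh : ∀ i ≤ ⌊16 * Real.pi / Δ⌋₊, lam 0 + Δ / 8 ≤ gridPoint Δ i → p₀ / 2 ≤ s i := by
    intro i hi hb
    have hmem := gridPoint_mem hΔ hi
    have h1 : ‖trigPoly (gridFilter Δ p₀ i) (lam 0) - 1‖ ≤ p₀ / 8 :=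
      norm_trigPoly_stepFilter_sub_one_le (w := Δ / 8) (q := p₀ / 8) (x := lam 0)
      (by positivity) (by positivity) hmem.2 (by linarith) (by linarith)
    have h2 : 1 - p₀ / 8 ≤ (trigPoly (gridFilter Δ p₀ i) (lam 0)).re := by
      have := (abs_le.1 ((Complex.abs_re_le_norm _).trans h1)).1
      rw [Complex.sub_re, Complex.one_re] at this
      linarith
    have h3 : p 0 * (trigPoly (gridFilter Δ p₀ i) (lam 0)).re
        ≤ ∑ m, p m * (trigPoly (gridFilter Δ p₀ i) (lam m)).re := by
      refine Finset.single_le_sum (f := fun m => p m *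
        (trigPoly (gridFilter Δ p₀ i) (lam m)).re) (fun m _ => ?_) (Finset.mem_univ 0)
      obtain ⟨y, hy, e⟩ := exists_trigPoly_stepFilter_eq (m := filterPower (p₀ / 8))
        (B := filterBase (Δ / 8)) hmem (lam m)
      have e' : trigPoly (gridFilter Δ p₀ i) (lam m) = y := e
      rw [e', Complex.ofReal_re]
      exact mul_nonneg (hp m) hy.1
    have h4 := (abs_le.1 (hs i hi)).1
    rw [hre] at h4
    rw [hp0] at h3
    nlinarith
  -- Otherwise the whole spectrum is in the stop band: the mean is at most p₀/8 and the score at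
  -- most p₀/4.
  have hlow : ∀ i ≤ ⌊16 * Real.pi / Δ⌋₊, p₀ / 2 ≤ s i → lam 0 - Δ / 8 ≤ gridPoint Δ i := by
    intro i hi hsi
    by_contra! hb
    have hmem := gridPoint_mem hΔ hi
    have h1 : ∀ m, (trigPoly (gridFilter Δ p₀ i) (lam m)).re ≤ p₀ / 8 := by
      intro m
      refine (Complex.re_le_norm _).trans ?_
      exact norm_trigPoly_stepFilter_le (w := Δ / 8) (q := p₀ / 8)
        (by positivity) (by positivity) hmem (by linarith [hmono (Fin.zero_le m)])
        (by linarith [(hlam m).2])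
    have h2 : ∑ m, p m * (trigPoly (gridFilter Δ p₀ i) (lam m)).re ≤ p₀ / 8 := by
      refine (Finset.sum_le_sum fun m _ => mul_le_mul_of_nonneg_left (h1 m) (hp m)).trans ?_
      rw [← Finset.sum_mul, hp1, one_mul]
    have h4 := (abs_le.1 (hs i hi)).2
    rw [hre] at h4
    linarith
  -- The first grid point above λ₀ + Δ/8 is below λ₀ + Δ/4 ≤ π. It certifies that the infimum, taken
  -- over all of ℕ, is attained within the controlled part of the grid.
  set i₁ := ⌈(lam 0 + Δ / 8 + Real.pi) / (Δ / 8)⌉₊ with hi₁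
  have hb₁ : lam 0 + Δ / 8 ≤ gridPoint Δ i₁ := by
    have := Nat.le_ceil ((lam 0 + Δ / 8 + Real.pi) / (Δ / 8))
    rw [div_le_iff₀ (by positivity), ← hi₁] at this
    unfold gridPoint; linarith
  have hb₁' : gridPoint Δ i₁ ≤ lam 0 + Δ / 4 := by
    have h0 : 0 ≤ (lam 0 + Δ / 8 + Real.pi) / (Δ / 8) :=
      div_nonneg (by linarith) (by positivity)
    have := Nat.ceil_lt_add_one h0
    rw [← hi₁, ← sub_lt_iff_lt_add, lt_div_iff₀ (by positivity)] at this
    unfold gridPoint; linarith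
  have hi₁G : i₁ ≤ ⌊16 * Real.pi / Δ⌋₊ := by
    rw [Nat.le_floor_iff (by positivity), le_div_iff₀ hΔ]
    unfold gridPoint at hb₁'; linarith
  have hmem₁ : i₁ ∈ {i | p₀ / 2 ≤ s i} := hhigh i₁ hi₁G hb₁
  have hle := Nat.sInf_le hmem₁
  have hmem₀ := Nat.sInf_mem ⟨i₁, hmem₁⟩
  set i₀ := sInf {i | p₀ / 2 ≤ s i}
  have h1 := hlow i₀ (hle.trans hi₁G) hmem₀
  have h2 : gridPoint Δ i₀ ≤ gridPoint Δ i₁ := by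
    unfold gridPoint
    have : (i₀ : ℝ) ≤ i₁ := by exact_mod_cast hle
    have := mul_le_mul_of_nonneg_right this (by positivity : 0 ≤ Δ / 8)
    linarith
  exact abs_le.2 ⟨by linarith, by linarith⟩

theorem dataProb_nonneg (ω : (roughEstimator Δ p₀ n).Data) :
    0 ≤ (roughEstimator Δ p₀ n).dataProb H ψ ω :=
  Finset.prod_nonneg fun _ _ => sampleProb_nonneg (fun l => ((roughEstimator Δ p₀ n).weight_pos l).le) _

/-- The rough estimate is correct with high probability. -/
theorem one_sub_le_prob_rough (hg : Measures H ψ (signal p lam)) (hp : ∀ m, 0 ≤ p m)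
    (hp1 : ∑ m, p m = 1) (hp0 : p 0 = p₀) (hp0pos : 0 < p₀) (hΔ : 0 < Δ) (hmono : Monotone lam)
    (hlam : ∀ m, lam m ∈ spectralRange Δ) {L : ℝ} (hn : 0 < n)
    (hnL : 8192 * harmonicMass (roughDegree Δ p₀) ^ 2 * L ≤ n * p₀ ^ 2) :
    1 - 4 * (16 * Real.pi / Δ + 1) * Real.exp (-L) ≤
      prob ((roughEstimator Δ p₀ n).dataProb H ψ)
        (fun ω => |(roughEstimator Δ p₀ n).estimate ω - lam 0| ≤ Δ / 4) := by
  set D := roughDegree Δ p₀ with hD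
  set W := harmonicMass D with hW
  have hWpos : 0 < W := harmonicMass_pos D
  have hpi := Real.pi_pos
  have hn' : (0 : ℝ) < n := by exact_mod_cast hn
  set G := ⌊16 * Real.pi / Δ⌋₊ with hG
  have hw : ∀ ω : (roughEstimator Δ p₀ n).Data, 0 ≤ (roughEstimator Δ p₀ n).dataProb H ψ ω :=
    dataProb_nonneg
  let a : ℕ → Fin (2 * D + 1) → ℂ := fun i l => gridFilter Δ p₀ i l / (harmonicWeight D l : ℂ)
  let P : Sample (2 * D + 1) → ℝ := sampleProb H ψ (harmonicWeight D) (fun l => shift D l)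
  have hP0 : ∀ s, 0 ≤ P s := sampleProb_nonneg fun l => (harmonicWeight_pos l).le
  have hP1 : ∑ s, P s = 1 := sum_sampleProb hg (sum_harmonicWeight D)
  have hmean : ∀ i, ∑ s, (P s : ℂ) * weightedValue (a i) s
      = filteredSignal p lam (gridFilter Δ p₀ i) 0 := by
    intro i
    rw [sum_sampleProb_mul_weightedValue hg, ← sum_mul_signal]
    refine Finset.sum_congr rfl fun l _ => ?_
    have h : (harmonicWeight D l : ℂ) ≠ 0 := by exact_mod_cast (harmonicWeight_pos l).ne'
    simp only [a, add_zero]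
    rw [mul_div_cancel₀ _ h]
  let f : ℕ → Sample (2 * D + 1) → ℂ := fun i s =>
    weightedValue (a i) s - filteredSignal p lam (gridFilter Δ p₀ i) 0
  have hfb : ∀ i ≤ G, ∀ s, ‖f i s‖ ≤ 4 * W := by
    intro i hi s
    have ha : ∀ l, ‖a i l‖ ≤ W := fun l =>
      norm_div_harmonicWeight_le l (norm_stepFilter_le (gridPoint_mem hΔ hi) l)
    have h1 := norm_weightedValue_le (a i) ha
    have h2 := norm_sum_mul_le hP0 hP1 h1
    rw [hmean] at h2
    have := norm_sub_le (weightedValue (a i) s) (filteredSignal p lam (gridFilter Δ p₀ i) 0)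
    have := h1 s
    simp only [f]
    linarith
  have hf0 : ∀ i, ∑ s, (P s : ℂ) * f i s = 0 := by
    intro i
    have h1 : (∑ s, (P s : ℂ)) = 1 := by exact_mod_cast hP1
    simp only [f, mul_sub, Finset.sum_sub_distrib, ← Finset.sum_mul, hmean, h1, one_mul, sub_self]
  let B : Fin (G + 1) → (roughEstimator Δ p₀ n).Data → Prop := fun i ω =>
    2 * (n * p₀ / 16) ≤ ‖∑ k : Fin n, f i (ω k)‖
  have hB : ∀ i, prob ((roughEstimator Δ p₀ n).dataProb H ψ) (B i) ≤ 4 * Real.exp (-L) := by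
    intro i
    have h := prob_norm_sum_ge_le (ι := Fin n) (w := fun _ => P) (fun _ => hP0) (fun _ => hP1)
      (f := fun _ => f i) (b := fun _ => 4 * W) (fun _ => hfb i (by omega)) (fun _ => hf0 i)
      (V := n * (4 * W) ^ 2) (t := n * p₀ / 16) (by positivity) (by simp) (by positivity)
    refine le_trans h (mul_le_mul_of_nonneg_left (Real.exp_le_exp.2 (neg_le_neg ?_)) (by norm_num))
    -- The exponent is n p₀² / (16² · 32 W²), and 16² · 32 = 8192.
    rw [le_div_iff₀ (by positivity)]
    have := mul_le_mul_of_nonneg_left hnL hn'.le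
    nlinarith
  have hsum : ∑ ω : (roughEstimator Δ p₀ n).Data, (roughEstimator Δ p₀ n).dataProb H ψ ω = 1 :=
    sum_prod_eq_one (ι := Fin n) (w := fun _ => P) fun _ => hP1
  have hmain := one_sub_le_prob hw hsum
    (E := fun ω => |(roughEstimator Δ p₀ n).estimate ω - lam 0| ≤ Δ / 4)
    (B := fun ω => ∃ i, B i ω) fun ω hω => by
      rw [not_exists] at hω
      refine abs_gridPoint_sub_le hp hp1 hp0 hp0pos hΔ hmono hlam fun i hi => ?_
      have h1 := (not_le.1 (hω ⟨i, by omega⟩)).le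
      have e : gridScore Δ p₀ n i ω - (filteredSignal p lam (gridFilter Δ p₀ i) 0).re
          = (1 / (n : ℝ)) * (∑ k : Fin n, f i (ω k)).re := by
        simp only [f, gridScore, Finset.sum_sub_distrib, Complex.sub_re, Finset.sum_const,
          Finset.card_univ, Fintype.card_fin, nsmul_eq_mul]
        rw [← Complex.ofReal_natCast, Complex.re_ofReal_mul]
        field_simp
        rfl
      rw [e, abs_mul, abs_of_pos (by positivity)]
      refine (mul_le_mul_of_nonneg_left ((Complex.abs_re_le_norm _).trans h1)
        (by positivity)).trans (le_of_eq ?_)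
      field_simp; ring
  have hbad := prob_exists_le_card_mul hw B hB
  rw [Fintype.card_fin] at hbad
  refine le_trans ?_ hmain
  have hGle : (G : ℝ) ≤ 16 * Real.pi / Δ := Nat.floor_le (by positivity)
  have hexp := Real.exp_pos (-L)
  push_cast at hbad
  have h9 : ((G : ℝ) + 1) * (4 * Real.exp (-L)) ≤ (16 * Real.pi / Δ + 1) * (4 * Real.exp (-L)) := by
    gcongr
  linarith

end Rough

/-! ## The parameters -/

section Parameters

/-- Lets each estimate be proved with its own constants and exponent before all are relaxed to a
common triple. -/
theorem ThetaTilde.of_le {a b c C L f g : ℝ} {j k : ℕ} (hf : 0 ≤ f) (hL : 1 ≤ L) (hc : c ≤ a)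
    (hC : b ≤ C) (hb : 0 ≤ b) (hjk : j ≤ k) (h1 : a * f ≤ g) (h2 : g ≤ b * f * L ^ j) :
    ThetaTilde c C k L f g := by
  refine ⟨(mul_le_mul_of_nonneg_right hc hf).trans h1, h2.trans ?_⟩
  have : L ^ j ≤ L ^ k := pow_le_pow_right₀ hL hjk
  have : 0 ≤ L ^ j := by positivity
  have : 0 ≤ C * f := mul_nonneg (hb.trans hC) hf
  gcongr

theorem filterPower_le {q : ℝ} (hq : 0 < q) (hq2 : q ≤ 2) :
    (filterPower q : ℝ) ≤ Real.log (2 / q) + 2 := by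
  have h : 0 ≤ Real.log (2 / q) := Real.log_nonneg (by rw [le_div_iff₀ hq]; linarith)
  have := Nat.ceil_lt_add_one h
  unfold filterPower
  push_cast
  linarith

theorem one_le_filterPower (q : ℝ) : (1 : ℝ) ≤ filterPower q := by
  unfold filterPower; push_cast; linarith [Nat.cast_nonneg (α := ℝ) ⌈Real.log (2 / q)⌉₊]

variable {Δ p₀ δ η ε : ℝ}

theorem inv_le_filterBase {r : ℝ} (hΔ : 0 < Δ) (hr : 1 ≤ r) : Δ⁻¹ ≤ filterBase (Δ / r) := by
  refine le_trans ?_ (Nat.le_ceil _)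
  rw [div_div_eq_mul_div, le_div_iff₀ hΔ, inv_mul_cancel₀ hΔ.ne']
  nlinarith [Real.pi_gt_three]

theorem filterBase_le {r : ℝ} (hΔ : 0 < Δ) (hΔ2 : Δ < 2 * Real.pi) (hr : 0 < r) :
    (filterBase (Δ / r) : ℝ) ≤ (4 * r + 2) * 3.15 * Δ⁻¹ := by
  have hpi := Real.pi_pos
  have h := (Nat.ceil_lt_add_one (by positivity : 0 ≤ 4 * Real.pi / (Δ / r))).le
  refine h.trans ?_
  -- The 1 lost in rounding up is absorbed because Δ < 2π; this is the + 2 in 4r + 2.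
  have h1 : 1 ≤ 2 * Real.pi * Δ⁻¹ := by
    rw [← div_eq_mul_inv, le_div_iff₀ hΔ]; linarith
  have e : 4 * Real.pi / (Δ / r) = 4 * r * Real.pi * Δ⁻¹ := by field_simp
  rw [e]
  have h2 : (4 * r + 2) * Real.pi * Δ⁻¹ ≤ (4 * r + 2) * 3.15 * Δ⁻¹ := by
    gcongr; exact Real.pi_lt_d2.le
  linarith

theorem inv_le_degree (hΔ : 0 < Δ) {r q : ℝ} (hr : 1 ≤ r) :
    Δ⁻¹ ≤ ((filterPower q * filterBase (Δ / r) : ℕ) : ℝ) := by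
  push_cast
  have h1 := inv_le_filterBase hΔ hr
  have h2 := one_le_filterPower q
  have : 0 < Δ⁻¹ := by positivity
  nlinarith

theorem log_le_of_le_pow {x : ℝ} {n : ℕ} (hx : 0 < x) (h : x ≤ 2.7 ^ n) : Real.log x ≤ n := by
  rw [Real.log_le_iff_le_exp hx, ← Real.exp_one_pow]
  exact h.trans (pow_le_pow_left₀ (by norm_num) (by linarith [Real.exp_one_gt_d9]) _)

theorem degree_le (hΔ : 0 < Δ) (hΔ2 : Δ < 2 * Real.pi) (hp : 0 < p₀) (hp1 : p₀ ≤ 1) (hδ : 0 < δ)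
    (hδ1 : δ < 1) :
    ((filterPower (p₀ * δ ^ 2 / 800) * filterBase (Δ / 4) : ℕ) : ℝ)
      ≤ 600 * (1 + Real.log (p₀⁻¹ * δ⁻¹)) * Δ⁻¹ := by
  have hlp : Real.log p₀ ≤ 0 := Real.log_nonpos hp.le hp1
  have hld : Real.log δ ≤ 0 := Real.log_nonpos hδ.le hδ1.le
  have hd2 : δ ^ 2 ≤ 1 := by nlinarith
  have hq : p₀ * δ ^ 2 / 800 ≤ 2 := by
    have : p₀ * δ ^ 2 ≤ 1 := mul_le_one₀ hp1 (by positivity) hd2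
    linarith
  have h1 := filterPower_le (by positivity) hq
  have e : 2 / (p₀ * δ ^ 2 / 800) = 1600 * (p₀⁻¹ * (δ⁻¹) ^ 2) := by field_simp; norm_num
  have hlog : Real.log (1600 : ℝ) ≤ (8 : ℕ) := log_le_of_le_pow (by norm_num) (by norm_num)
  rw [e, Real.log_mul (by norm_num) (by positivity), Real.log_mul (by positivity) (by positivity),
    Real.log_pow, Real.log_inv, Real.log_inv] at h1
  rw [Real.log_mul (by positivity) (by positivity), Real.log_inv, Real.log_inv]
  have h2 := filterBase_le hΔ hΔ2 (r := 4) (by norm_num)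
  push_cast at h1 hlog ⊢
  have h3 : (filterPower (p₀ * δ ^ 2 / 800) : ℝ) ≤ 10 * (1 + (-Real.log p₀ + -Real.log δ)) := by
    linarith
  calc _ ≤ 10 * (1 + (-Real.log p₀ + -Real.log δ)) * ((4 * 4 + 2) * 3.15 * Δ⁻¹) :=
        mul_le_mul h3 h2 (by positivity) (by linarith)
    _ ≤ _ := by
        have : 0 ≤ (1 + (-Real.log p₀ + -Real.log δ)) * Δ⁻¹ :=
          mul_nonneg (by linarith) (by positivity)
        nlinarith

theorem roughDegree_le (hΔ : 0 < Δ) (hΔ2 : Δ < 2 * Real.pi) (hp : 0 < p₀) (hp1 : p₀ ≤ 1) :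
    (roughDegree Δ p₀ : ℝ) ≤ 600 * (1 + Real.log p₀⁻¹) * Δ⁻¹ := by
  have hlp : Real.log p₀ ≤ 0 := Real.log_nonpos hp.le hp1
  have h1 := filterPower_le (q := p₀ / 8) (by positivity) (by linarith)
  have e : 2 / (p₀ / 8) = 16 * p₀⁻¹ := by field_simp; norm_num
  have hlog : Real.log (16 : ℝ) ≤ (3 : ℕ) := log_le_of_le_pow (by norm_num) (by norm_num)
  rw [e, Real.log_mul (by norm_num) (by positivity), Real.log_inv] at h1
  rw [Real.log_inv]
  have h2 := filterBase_le hΔ hΔ2 (r := 8) (by norm_num)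
  unfold roughDegree
  push_cast at h1 hlog ⊢
  have h3 : (filterPower (p₀ / 8) : ℝ) ≤ 5 * (1 + -Real.log p₀) := by linarith
  calc _ ≤ 5 * (1 + -Real.log p₀) * ((4 * 8 + 2) * 3.15 * Δ⁻¹) :=
        mul_le_mul h3 h2 (by positivity) (by linarith)
    _ ≤ _ := by
        have : 0 ≤ (1 + -Real.log p₀) * Δ⁻¹ := mul_nonneg (by linarith) (by positivity)
        nlinarith

theorem harmonicMass_le_of_le {d : ℕ} {l : ℝ} (hΔ : 0 < Δ) (hl : 1 ≤ l)
    (hd : (d : ℝ) ≤ 600 * l * Δ⁻¹) : harmonicMass d ≤ 2 * (7 + l + Real.log (1 + Δ⁻¹)) := by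
  refine (harmonicMass_le d).trans ?_
  have hΔi : 0 < Δ⁻¹ := by positivity
  have h1 : Real.log (d + 1) ≤ Real.log (600 * l * (1 + Δ⁻¹)) :=
    Real.log_le_log (by positivity) (by nlinarith)
  rw [Real.log_mul (by positivity) (by positivity), Real.log_mul (by norm_num) (by positivity)] at h1
  have hlog : Real.log (600 : ℝ) ≤ (7 : ℕ) := log_le_of_le_pow (by norm_num) (by norm_num)
  have h2 := Real.log_le_sub_one_of_pos (by linarith : 0 < l)
  push_cast at hlog
  linarith

theorem numLevels_le (hε : 0 < ε) (hε1 : ε < 1) :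
    (numLevels ε : ℝ) ≤ 2 + 3 / 2 * Real.log ε⁻¹ := by
  have h0 : 0 ≤ Real.logb 2 (1 / ε) :=
    Real.logb_nonneg (by norm_num) (by rw [le_div_iff₀ hε]; linarith)
  have h1 := (Nat.ceil_lt_add_one h0).le
  have hlog : 0 ≤ Real.log ε⁻¹ := Real.log_nonneg (by rw [one_le_inv₀ hε]; exact hε1.le)
  have h2 : Real.logb 2 (1 / ε) ≤ 3 / 2 * Real.log ε⁻¹ := by
    rw [Real.logb, one_div, div_le_iff₀ (Real.log_pos (by norm_num))]
    nlinarith [Real.log_two_gt_d9]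
  unfold numLevels
  push_cast
  linarith

theorem nat_ceil_mul_le {x y : ℝ} (hx : 0 ≤ x) (hy : 1 ≤ y) :
    (⌈x * y⌉₊ : ℝ) ≤ (x + 1) * y := by
  have := (Nat.ceil_lt_add_one (by positivity : 0 ≤ x * y)).le
  linarith

/-- The number of data points per level. -/
noncomputable def numPoints (ζ δ : ℝ) : ℕ := 2 * ⌈2 * δ ^ (-(2 + ζ))⌉₊

variable {ζ : ℝ}

theorem one_le_rpow_neg (hζ : 0 < ζ) (hδ : 0 < δ) (hδ1 : δ < 1) : 1 ≤ δ ^ (-(2 + ζ)) :=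
  Real.one_le_rpow_of_pos_of_le_one_of_nonpos hδ hδ1.le (by linarith)

theorem le_numPoints (ζ δ : ℝ) : 4 * δ ^ (-(2 + ζ)) ≤ numPoints ζ δ := by
  have := Nat.le_ceil (2 * δ ^ (-(2 + ζ)))
  unfold numPoints; push_cast; linarith

theorem numPoints_le (hζ : 0 < ζ) (hδ : 0 < δ) (hδ1 : δ < 1) :
    (numPoints ζ δ : ℝ) ≤ 6 * δ ^ (-(2 + ζ)) := by
  have := nat_ceil_mul_le (x := 2) (by norm_num) (one_le_rpow_neg hζ hδ hδ1)
  unfold numPoints; push_cast; linarith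

theorem four_le_numPoints (hζ : 0 < ζ) (hδ : 0 < δ) (hδ1 : δ < 1) : 4 ≤ numPoints ζ δ := by
  have h1 := le_numPoints ζ δ
  have h2 := one_le_rpow_neg hζ hδ hδ1
  have : (4 : ℝ) ≤ numPoints ζ δ := by linarith
  exact_mod_cast this

/-- This, rather than the exact power of δ, is what concentration of the partial sums needs from the
number of points. -/
theorem one_le_numPoints_mul_sq (hζ : 0 < ζ) (hδ : 0 < δ) (hδ1 : δ < 1) :
    1 ≤ numPoints ζ δ * δ ^ 2 := by
  have h1 := le_numPoints ζ δ
  have h2 : 1 ≤ δ ^ (-(2 + ζ)) * δ ^ 2 := by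
    rw [← Real.rpow_natCast δ 2, ← Real.rpow_add hδ]
    exact Real.one_le_rpow_of_pos_of_le_one_of_nonpos hδ hδ1.le (by push_cast; linarith)
  have h3 : 0 ≤ δ ^ 2 := by positivity
  nlinarith

/-- The failure probability of the second stage. -/
theorem failure_le (hζ : 0 < ζ) (hδ : 0 < δ) (hδ1 : δ < 1) (hη : 0 < η) (hη1 : η < 1) (hε : 0 < ε)
    (hε1 : ε < 1) {L : ℝ}
    (hL : 1 + Real.log δ⁻¹ + Real.log η⁻¹ + Real.log ε⁻¹ ≤ L) :
    12 * numLevels ε * numPoints ζ δ * Real.exp (-((7 + ζ) * L)) ≤ η / 2 := by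
  have hlδ : 0 ≤ Real.log δ⁻¹ := Real.log_nonneg (by rw [one_le_inv₀ hδ]; exact hδ1.le)
  have hlη : 0 ≤ Real.log η⁻¹ := Real.log_nonneg (by rw [one_le_inv₀ hη]; exact hη1.le)
  have hlε : 0 ≤ Real.log ε⁻¹ := Real.log_nonneg (by rw [one_le_inv₀ hε]; exact hε1.le)
  have hJ := numLevels_le hε hε1
  have hJ' : (numLevels ε : ℝ) ≤ Real.exp (1 + 3 / 2 * Real.log ε⁻¹) :=
    hJ.trans ((by linarith : 2 + 3 / 2 * Real.log ε⁻¹ ≤ (1 + 3 / 2 * Real.log ε⁻¹) + 1).trans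
      (Real.add_one_le_exp _))
  have hN := numPoints_le hζ hδ hδ1
  have hδe : δ ^ (-(2 + ζ)) = Real.exp ((2 + ζ) * Real.log δ⁻¹) := by
    rw [Real.rpow_def_of_pos hδ, Real.log_inv]; congr 1; ring
  have hηe : η = Real.exp (-Real.log η⁻¹) := by rw [Real.log_inv, neg_neg, Real.exp_log hη]
  -- 144 = 12 · 6 · 2. The exponent (7 + ζ)L then covers 5 + 1 from constants, 3/2 log(1/ε) from the
  -- levels, (2 + ζ) log(1/δ) from the points, and leaves log(1/η).
  have h144 : (144 : ℝ) ≤ Real.exp 5 := by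
    have : Real.exp 5 = Real.exp 1 ^ 5 := by rw [Real.exp_one_pow]; norm_num
    rw [this]
    exact le_trans (by norm_num : (144 : ℝ) ≤ 2.71 ^ 5)
      (pow_le_pow_left₀ (by norm_num) (by linarith [Real.exp_one_gt_d9]) _)
  rw [le_div_iff₀ (by norm_num : (0 : ℝ) < 2)]
  calc 12 * (numLevels ε : ℝ) * numPoints ζ δ * Real.exp (-((7 + ζ) * L)) * 2
      ≤ 12 * Real.exp (1 + 3 / 2 * Real.log ε⁻¹) * (6 * Real.exp ((2 + ζ) * Real.log δ⁻¹)) *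
          Real.exp (-((7 + ζ) * L)) * 2 := by rw [← hδe]; gcongr
    _ = 144 * (Real.exp (1 + 3 / 2 * Real.log ε⁻¹) * Real.exp ((2 + ζ) * Real.log δ⁻¹) *
          Real.exp (-((7 + ζ) * L))) := by ring
    _ ≤ Real.exp 5 * (Real.exp (1 + 3 / 2 * Real.log ε⁻¹) * Real.exp ((2 + ζ) * Real.log δ⁻¹) *
          Real.exp (-((7 + ζ) * L))) := by gcongr
    _ = Real.exp (5 + (1 + 3 / 2 * Real.log ε⁻¹ + (2 + ζ) * Real.log δ⁻¹ + -((7 + ζ) * L))) := by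
        rw [← Real.exp_add, ← Real.exp_add, ← Real.exp_add]
    _ ≤ Real.exp (-Real.log η⁻¹) := by
        rw [Real.exp_le_exp]
        nlinarith
    _ = η := hηe.symm

/-- The failure probability of the first stage. -/
theorem rough_failure_le (hΔ : 0 < Δ) (hη : 0 < η) (hη1 : η < 1) {L : ℝ}
    (hL : 1 + Real.log η⁻¹ + Real.log (1 + Δ⁻¹) ≤ L) :
    4 * (16 * Real.pi / Δ + 1) * Real.exp (-(7 * L)) ≤ η / 2 := by
  have hlη : 0 ≤ Real.log η⁻¹ := Real.log_nonneg (by rw [one_le_inv₀ hη]; exact hη1.le)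
  have hΔi : 0 < Δ⁻¹ := by positivity
  have hηe : η = Real.exp (-Real.log η⁻¹) := by rw [Real.log_inv, neg_neg, Real.exp_log hη]
  have hΔe : 1 + Δ⁻¹ = Real.exp (Real.log (1 + Δ⁻¹)) := (Real.exp_log (by positivity)).symm
  have h408 : (408 : ℝ) ≤ Real.exp 7 := by
    have : Real.exp 7 = Real.exp 1 ^ 7 := by rw [Real.exp_one_pow]; norm_num
    rw [this]
    exact le_trans (by norm_num : (408 : ℝ) ≤ 2.7 ^ 7)
      (pow_le_pow_left₀ (by norm_num) (by linarith [Real.exp_one_gt_d9]) _)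
  have h1 : 16 * Real.pi / Δ + 1 ≤ 51 * (1 + Δ⁻¹) := by
    rw [div_eq_mul_inv]; nlinarith [Real.pi_lt_d2]
  have hlΔ : 0 ≤ Real.log (1 + Δ⁻¹) := Real.log_nonneg (by linarith)
  rw [le_div_iff₀ (by norm_num : (0 : ℝ) < 2)]
  calc 4 * (16 * Real.pi / Δ + 1) * Real.exp (-(7 * L)) * 2
      ≤ 4 * (51 * (1 + Δ⁻¹)) * Real.exp (-(7 * L)) * 2 := by gcongr
    _ = 408 * ((1 + Δ⁻¹) * Real.exp (-(7 * L))) := by ring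
    _ ≤ Real.exp 7 * (Real.exp (Real.log (1 + Δ⁻¹)) * Real.exp (-(7 * L))) := by
        rw [← hΔe]; gcongr
    _ = Real.exp (7 + (Real.log (1 + Δ⁻¹) + -(7 * L))) := by
        rw [← Real.exp_add, ← Real.exp_add]
    _ ≤ Real.exp (-Real.log η⁻¹) := by
        rw [Real.exp_le_exp]; linarith
    _ = η := hηe.symm

end Parameters

/-! ## The cost of the second stage -/

section Cost

variable {δ ε : ℝ} {N : ℕ}

theorem timeStep_le_last (hδ : 0 < δ) (hε : 0 < ε) (hN : 0 < N) (j : Fin (numLevels ε)) :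
    timeStep δ ε N j ≤ timeStep δ ε N (numLevels ε - 1) := by
  have hmono : Monotone (timeStep δ ε N) := monotone_nat_of_le_succ fun j => by
    rw [timeStep_succ]; linarith [timeStep_pos hδ hε hN j]
  exact hmono (by omega)

theorem sub_one_mul_timeStep_last (hε : 0 < ε) (hN : 0 < N) :
    ((N : ℝ) - 1) * timeStep δ ε N (numLevels ε - 1) = (1 - 1 / (N : ℝ)) * (δ / ε) := by
  have hN' : (0 : ℝ) < N := by exact_mod_cast hN
  rw [← mul_timeStep_last hε hN]
  field_simp

theorem natCast_mul_timeStep_le (hδ : 0 < δ) (hε : 0 < ε) (j : Fin (numLevels ε)) (n : Fin N) :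
    (n : ℕ) * timeStep δ ε N j ≤ (1 - 1 / (N : ℝ)) * (δ / ε) := by
  have hN : 0 < N := n.pos
  rw [← sub_one_mul_timeStep_last hε hN]
  have h1 : ((n : ℕ) : ℝ) ≤ (N : ℝ) - 1 := by
    have : ((n : ℕ) : ℝ) + 1 ≤ N := by exact_mod_cast n.2
    linarith
  have h0 : (0 : ℝ) ≤ (n : ℕ) := Nat.cast_nonneg _
  exact mul_le_mul h1 (timeStep_le_last hδ hε hN j) (timeStep_pos hδ hε hN j).le (by linarith)

theorem lossMaxTime_eq (d : ℕ) (hδ : 0 < δ) (hε : 0 < ε) (hN : 0 < N) :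
    lossMaxTime (numLevels ε) N d (timeStep δ ε N) = d + (1 - 1 / (N : ℝ)) * (δ / ε) := by
  have hJ : 0 < numLevels ε := by unfold numLevels; omega
  have : Nonempty (Fin (numLevels ε) × Fin N × Fin (2 * d + 1)) :=
    ⟨(⟨0, hJ⟩, ⟨0, hN⟩, 0)⟩
  refine le_antisymm (ciSup_le fun i => ?_) ?_
  · refine (abs_add_le _ _).trans (add_le_add (abs_shift_le _) ?_)
    rw [abs_of_nonneg (mul_nonneg (Nat.cast_nonneg _) (timeStep_pos hδ hε hN _).le)]
    exact natCast_mul_timeStep_le hδ hε _ _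
  · refine le_trans (le_of_eq ?_) (le_ciSup
      (f := fun i : Fin (numLevels ε) × Fin N × Fin (2 * d + 1) =>
        |(shift d i.2.2 : ℝ) + (i.2.1 : ℕ) * timeStep δ ε N i.1|)
      (Set.finite_range _).bddAbove
      (⟨numLevels ε - 1, by omega⟩, ⟨N - 1, by omega⟩, Fin.last (2 * d)))
    have e : ((N - 1 : ℕ) : ℝ) = (N : ℝ) - 1 := by rw [Nat.cast_sub hN]; simp
    simp only [shift_last, e]
    have h1 : (1 : ℝ) ≤ N := by exact_mod_cast hN
    have h2 := timeStep_pos hδ hε hN (numLevels ε - 1)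
    rw [sub_one_mul_timeStep_last hε hN, abs_of_nonneg]
    · simp
    · rw [← sub_one_mul_timeStep_last hε hN]
      have := mul_nonneg (sub_nonneg.2 h1) h2.le
      positivity

theorem lossTotalTime_eq (Ns d : ℕ) (hδ : 0 < δ) (hε : 0 < ε) (hN : 0 < N) :
    lossTotalTime (numLevels ε) N Ns d (timeStep δ ε N)
      = ∑ j : Fin (numLevels ε), ∑ n : Fin N, 2 * (Ns : ℝ) * (d + (n : ℕ) * timeStep δ ε N j) := by
  unfold lossTotalTime
  refine Finset.sum_congr rfl fun j _ => Finset.sum_congr rfl fun n _ => ?_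
  rw [iSup_abs_shift_add d (mul_nonneg (Nat.cast_nonneg _) (timeStep_pos hδ hε hN _).le)]

theorem lossTotalTime_le (Ns d : ℕ) (hδ : 0 < δ) (hε : 0 < ε) (hN : 0 < N) :
    lossTotalTime (numLevels ε) N Ns d (timeStep δ ε N)
      ≤ numLevels ε * (N * (2 * Ns * (d + δ / ε))) := by
  rw [lossTotalTime_eq Ns d hδ hε hN]
  have h : ∀ (j : Fin (numLevels ε)) (n : Fin N),
      2 * (Ns : ℝ) * (d + (n : ℕ) * timeStep δ ε N j) ≤ 2 * Ns * (d + δ / ε) := by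
    intro j n
    have h1 := natCast_mul_timeStep_le hδ hε j n
    have h2 : (1 - 1 / (N : ℝ)) * (δ / ε) ≤ δ / ε :=
      mul_le_of_le_one_left (by positivity) (by
        have : (0 : ℝ) ≤ 1 / N := by positivity
        linarith)
    have h3 := h1.trans h2
    gcongr
  refine (Finset.sum_le_sum fun j _ => Finset.sum_le_sum fun n _ => h j n).trans (le_of_eq ?_)
  simp

/-- The last level alone suffices: n averages to (N - 1)/2, and 1 - 1/N ≥ 1/2. -/
theorem le_lossTotalTime (Ns d : ℕ) (hδ : 0 < δ) (hε : 0 < ε) (hN : 2 ≤ N) :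
    N * Ns * (d + δ / ε) / 2 ≤ lossTotalTime (numLevels ε) N Ns d (timeStep δ ε N) := by
  have hN0 : 0 < N := by omega
  have hN' : (2 : ℝ) ≤ N := by exact_mod_cast hN
  have hJ : numLevels ε - 1 < numLevels ε := by unfold numLevels; omega
  rw [lossTotalTime_eq Ns d hδ hε hN0]
  refine le_trans ?_ (Finset.single_le_sum (f := fun j : Fin (numLevels ε) =>
    ∑ n : Fin N, 2 * (Ns : ℝ) * (d + (n : ℕ) * timeStep δ ε N j)) (fun j _ =>
      Finset.sum_nonneg fun n _ => by have := timeStep_pos hδ hε hN0 j; positivity)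
      (Finset.mem_univ ⟨numLevels ε - 1, hJ⟩))
  simp only []
  set t := timeStep δ ε N (numLevels ε - 1) with ht
  have e1 : (∑ n : Fin N, ((n : ℕ) : ℝ)) * 2 = N * (N - 1) := by
    rw [Fin.sum_univ_eq_sum_range (fun n => (n : ℝ)) N]
    have h := Finset.sum_range_id_mul_two N
    have h' : ((∑ n ∈ Finset.range N, n : ℕ) : ℝ) * 2 = (N : ℝ) * ((N - 1 : ℕ) : ℝ) := by
      exact_mod_cast h
    rw [Nat.cast_sub hN0] at h'
    push_cast at h'
    exact h'
  have e2 : ∑ n : Fin N, 2 * (Ns : ℝ) * (d + (n : ℕ) * t)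
      = N * Ns * (2 * d + ((N : ℝ) - 1) * t) := by
    rw [← Finset.mul_sum, Finset.sum_add_distrib, ← Finset.sum_mul]
    simp only [Finset.sum_const, Finset.card_univ, Fintype.card_fin, nsmul_eq_mul]
    linear_combination (Ns : ℝ) * t * e1
  rw [e2, ht, sub_one_mul_timeStep_last hε hN0]
  have h3 : 1 / 2 * (δ / ε) ≤ (1 - 1 / (N : ℝ)) * (δ / ε) := by
    refine mul_le_mul_of_nonneg_right ?_ (by positivity)
    have : 1 / (N : ℝ) ≤ 1 / 2 := by gcongr
    linarith
  have h4 : (d + δ / ε) / 2 ≤ 2 * d + (1 - 1 / (N : ℝ)) * (δ / ε) := by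
    have : (0 : ℝ) ≤ d := Nat.cast_nonneg d
    linarith
  calc _ = N * Ns * ((d + δ / ε) / 2) := by ring
    _ ≤ _ := by gcongr

end Cost

/-! ## The two stages together -/

section Combination

/-- The cut is the midpoint of the separation, leaving a transition width Δ/4 on each side. The
margin of the spectral range at ±π has the same width. -/
theorem isFilter_stepFilter {Δ q lamPrior : ℝ} (hΔ : 0 < Δ) (hq : 0 < q)
    (hl : lamPrior ∈ Set.Icc (-Real.pi) (Real.pi - Δ)) :
    IsFilter (stepFilter (filterPower q) (filterBase (Δ / 4)) (lamPrior + Δ / 2)) q lamPrior Δ := by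
  obtain ⟨h1, h2⟩ := hl
  refine ⟨fun x hx => ?_, fun x hx => ?_⟩
  · exact norm_trigPoly_stepFilter_sub_one_le (by positivity) hq (by linarith)
      (by linarith [hx.1.1]) (by linarith [hx.2.2])
  · have h3 : lamPrior + 3 * Δ / 4 ≤ x := by
      by_contra! h
      exact hx.2 ⟨by linarith [hx.1.1], h.le⟩
    exact norm_trigPoly_stepFilter_le (by positivity) hq ⟨by linarith, by linarith⟩
      (by linarith) (by linarith [hx.1.2])

/-- The law of the second stage depends on the outcome of the first, so the bound is obtained by
conditioning: (1 - a)(1 - b) ≥ 1 - (a + b). -/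
theorem one_sub_le_prob_prod {Ω Ω' : Type} [Fintype Ω] [Fintype Ω'] {w : Ω → ℝ} {w' : Ω → Ω' → ℝ}
    (hw : ∀ ω, 0 ≤ w ω) {E : Ω → Prop} {E' : Ω → Ω' → Prop} {a b : ℝ} (ha : 0 ≤ a) (hb : 0 ≤ b)
    (hb1 : b ≤ 1) (hE : 1 - a ≤ prob w E) (hE' : ∀ ω, E ω → 1 - b ≤ prob (w' ω) (E' ω)) :
    1 - (a + b) ≤ prob (fun ω : Ω × Ω' => w ω.1 * w' ω.1 ω.2)
      (fun ω => E ω.1 ∧ E' ω.1 ω.2) := by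
  classical
  have h1 : prob (fun ω : Ω × Ω' => w ω.1 * w' ω.1 ω.2) (fun ω => E ω.1 ∧ E' ω.1 ω.2)
      = ∑ ω, if E ω then w ω * prob (w' ω) (E' ω) else 0 := by
    unfold prob
    rw [Fintype.sum_prod_type]
    refine Finset.sum_congr rfl fun ω _ => ?_
    split_ifs with h
    · rw [Finset.mul_sum]
      refine Finset.sum_congr rfl fun ω' _ => ?_
      simp [Set.indicator_apply, h]
    · refine Finset.sum_eq_zero fun ω' _ => ?_
      simp [h]
  have h2 : prob w E * (1 - b) ≤ ∑ ω, if E ω then w ω * prob (w' ω) (E' ω) else 0 := by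
    unfold prob
    rw [Finset.sum_mul]
    refine Finset.sum_le_sum fun ω _ => ?_
    by_cases h : E ω
    · simp only [Set.indicator_apply, Set.mem_ofPred_eq, h, if_true]
      exact mul_le_mul_of_nonneg_left (hE' ω h) (hw ω)
    · simp [h]
  rw [h1]
  have h3 := mul_le_mul_of_nonneg_right hE (sub_nonneg.2 hb1)
  nlinarith [mul_nonneg ha hb]

variable {M : ℕ} {H : Matrix (Fin (M + 2)) (Fin (M + 2)) ℂ} {lam : Fin (M + 2) → ℝ}
  {v : OrthonormalBasis (Fin (M + 2)) ℂ (Sys (M + 2))} {ψ : Sys (M + 2)}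
  {ζ Δ p₀ δ η ε : ℝ}

theorem measures_signal (h : ∀ m, Matrix.toEuclideanLin H (v m) = (lam m : ℂ) • v m)
    (hψ : ‖ψ‖ = 1) : Measures H ψ (signal (fun m => ‖inner ℂ (v m) ψ‖ ^ 2) lam) :=
  fun t a => ⟨outcomeProb_one h hψ t a, outcomeProb_sDagger h hψ t a⟩

/-- The second stage with the step filter. -/
theorem one_sub_le_prob_second {p : Fin (M + 2) → ℝ} (hg : Measures H ψ (signal p lam))
    (hp : ∀ m, 0 ≤ p m) (hp1 : ∑ m, p m = 1) (hp0 : p 0 = p₀) (hmono : Monotone lam)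
    (hlam : ∀ m, lam m ∈ spectralRange Δ) (hgap : lam 1 - lam 0 = Δ)
    (hζ : 0 < ζ) (hΔ : 0 < Δ) (hΔ2 : Δ < 2 * Real.pi) (hp₀ : 0 < p₀) (hp₀1 : p₀ ≤ 1)
    (hδ : 0 < δ) (hδ1 : δ < 1) (hη : 0 < η) (hη1 : η < 1) (hε : 0 < ε) (hε1 : ε < 1) {L : ℝ}
    (hL : 1 + Real.log p₀⁻¹ + Real.log δ⁻¹ + Real.log η⁻¹ + Real.log ε⁻¹ + Real.log (1 + Δ⁻¹) ≤ L)
    {Ns : ℕ} (hNs : 26542080000 * (7 + ζ) * L ^ 3 ≤ Ns * p₀ ^ 2) {lamPrior : ℝ}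
    (hprior : |lamPrior - lam 0| ≤ Δ / 4) :
    1 - η / 2 ≤ prob (fun ω : FilteredData (numLevels ε) (numPoints ζ δ) Ns
          (filterPower (p₀ * δ ^ 2 / 800) * filterBase (Δ / 4)) =>
        filteredDataProb H ψ (timeStep δ ε (numPoints ζ δ))
          (stepFilter (filterPower (p₀ * δ ^ 2 / 800)) (filterBase (Δ / 4)) (lamPrior + Δ / 2)) ω)
      (fun ω => Succeeds (timeStep δ ε (numPoints ζ δ)) (dataPoint
        (stepFilter (filterPower (p₀ * δ ^ 2 / 800)) (filterBase (Δ / 4)) (lamPrior + Δ / 2)) ω)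
        ε (lam 0)) := by
  have hlp : 0 ≤ Real.log p₀⁻¹ := Real.log_nonneg (by rw [one_le_inv₀ hp₀]; exact hp₀1)
  have hlδ : 0 ≤ Real.log δ⁻¹ := Real.log_nonneg (by rw [one_le_inv₀ hδ]; exact hδ1.le)
  have hlη : 0 ≤ Real.log η⁻¹ := Real.log_nonneg (by rw [one_le_inv₀ hη]; exact hη1.le)
  have hlε : 0 ≤ Real.log ε⁻¹ := Real.log_nonneg (by rw [one_le_inv₀ hε]; exact hε1.le)
  have hlΔ : 0 ≤ Real.log (1 + Δ⁻¹) := Real.log_nonneg (by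
    have : 0 < Δ⁻¹ := by positivity
    linarith)
  have hL1 : 1 ≤ L := by linarith
  obtain ⟨hpr1, hpr2⟩ := abs_le.1 hprior
  obtain ⟨hl0, hl0'⟩ := hlam 0
  have hl1 := (hlam 1).2
  -- From the gap and the rough accuracy: the cut lies between λ₀ + Δ/4 and λ₀ + 3Δ/4 = λ₁ - Δ/4.
  have hb : lamPrior + Δ / 2 ∈ Set.Icc (-Real.pi) Real.pi := ⟨by linarith, by linarith⟩
  have hdeg := degree_le hΔ hΔ2 hp₀ hp₀1 hδ hδ1
  rw [Real.log_mul (by positivity) (by positivity)] at hdeg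
  have hW := harmonicMass_le_of_le hΔ (by linarith) hdeg
  have hNs0 : 0 < Ns := by
    rcases Nat.eq_zero_or_pos Ns with h | h
    · rw [h] at hNs
      have : 0 < 26542080000 * (7 + ζ) * L ^ 3 := by positivity
      simp at hNs; linarith
    · exact h
  have hq : 0 < p₀ * δ ^ 2 / 800 := by positivity
  -- The filter mass is at most 18L, and 26542080000 = 81920000 · 18². Two powers of L come from the
  -- mass, the third from the failure exponent.
  have key := one_sub_le_prob_succeeds (b := 18 * L) (L := (7 + ζ) * L) (Ns := Ns)
    (q := p₀ * δ ^ 2 / 800) (N := numPoints ζ δ)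
    (F := stepFilter (filterPower (p₀ * δ ^ 2 / 800)) (filterBase (Δ / 4)) (lamPrior + Δ / 2))
    hg hp hp1 (by rw [hp0]; exact hp₀) ⟨by linarith, by linarith⟩ hδ hδ1 hε
    (four_le_numPoints hζ hδ hδ1) (even_two_mul _) (one_le_numPoints_mul_sq hζ hδ hδ1)
    (by rw [hp0])
    (norm_trigPoly_stepFilter_sub_one_le (by positivity) hq hb.2 (by linarith) (by linarith))
    (fun m hm => norm_trigPoly_stepFilter_le (by positivity) hq hb (by
      have : lam 1 ≤ lam m := hmono (Fin.one_le_of_ne_zero hm)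
      linarith) (hlam m).2)
    (filterMass_stepFilter_pos (by linarith))
    ((filterMass_stepFilter_le hb).trans (hW.trans (by linarith)))
    (by positivity) hNs0 (by
      rw [hp0]; refine le_trans (le_of_eq ?_) hNs; ring)
  refine le_trans ?_ key
  have := failure_le (L := L) hζ hδ hδ1 hη hη1 hε hε1 (by linarith)
  linarith

/-- The first stage. -/
theorem one_sub_le_prob_first {p : Fin (M + 2) → ℝ} (hg : Measures H ψ (signal p lam))
    (hp : ∀ m, 0 ≤ p m) (hp1 : ∑ m, p m = 1) (hp0 : p 0 = p₀) (hmono : Monotone lam)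
    (hlam : ∀ m, lam m ∈ spectralRange Δ)
    (hΔ : 0 < Δ) (hΔ2 : Δ < 2 * Real.pi) (hp₀ : 0 < p₀) (hp₀1 : p₀ ≤ 1)
    (hη : 0 < η) (hη1 : η < 1) {L : ℝ}
    (hL : 1 + Real.log p₀⁻¹ + Real.log η⁻¹ + Real.log (1 + Δ⁻¹) ≤ L)
    {n : ℕ} (hn : 18579456 * L ^ 3 ≤ n * p₀ ^ 2) :
    1 - η / 2 ≤ prob ((roughEstimator Δ p₀ n).dataProb H ψ)
        (fun ω => |(roughEstimator Δ p₀ n).estimate ω - lam 0| ≤ Δ / 4) := by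
  have hlp : 0 ≤ Real.log p₀⁻¹ := Real.log_nonneg (by rw [one_le_inv₀ hp₀]; exact hp₀1)
  have hlη : 0 ≤ Real.log η⁻¹ := Real.log_nonneg (by rw [one_le_inv₀ hη]; exact hη1.le)
  have hlΔ : 0 ≤ Real.log (1 + Δ⁻¹) := Real.log_nonneg (by
    have : 0 < Δ⁻¹ := by positivity
    linarith)
  have hL1 : 1 ≤ L := by linarith
  have hW := harmonicMass_le_of_le hΔ (by linarith) (roughDegree_le hΔ hΔ2 hp₀ hp₀1)
  have hW' : harmonicMass (roughDegree Δ p₀) ≤ 18 * L := hW.trans (by linarith)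
  have hW0 := harmonicMass_pos (roughDegree Δ p₀)
  have hn0 : 0 < n := by
    rcases Nat.eq_zero_or_pos n with h | h
    · rw [h] at hn
      have : 0 < 18579456 * L ^ 3 := by positivity
      simp at hn; linarith
    · exact h
  -- Here 18579456 = 8192 · 18² · 7.
  have key := one_sub_le_prob_rough (L := 7 * L) hg hp hp1 hp0 hp₀ hΔ hmono hlam hn0 (by
    refine le_trans ?_ hn
    calc _ ≤ 8192 * (18 * L) ^ 2 * (7 * L) := by gcongr
      _ = _ := by ring)
  refine le_trans ?_ key
  have := rough_failure_le (L := L) hΔ hη hη1 (by linarith)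
  linarith

end Combination

end QCELS

/-! ### Choice of the parameters and assembly of the theorem -/

set_option maxHeartbeats 1000000 in
theorem mainTheorem4 (ζ : ℝ) (hζ : 0 < ζ) :
    ∃ c C : ℝ, ∃ k : ℕ, 0 < c ∧ 0 < C ∧
    ∀ Δ p₀ δ η ε : ℝ, 0 < Δ → Δ < 2 * Real.pi → 0 < p₀ → p₀ ≤ 1 → 0 < δ → δ < 1 →
      0 < η → η < 1 → 0 < ε → ε < 1 / 2 →
    ∃ (A : QCELS.RoughEstimator) (d N Ns : ℕ) (q : ℝ) (F : ℝ → Fin (2 * d + 1) → ℂ),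
      -- the parameters
      QCELS.ThetaTilde c C k (1 + Real.log (p₀⁻¹ * δ⁻¹)) Δ⁻¹ d ∧
      c * (p₀ * δ ^ 2) ≤ q ∧ q ≤ C * (p₀ * δ ^ 2) ∧
      2 ≤ N ∧ c * (p₀ ^ 2)⁻¹ ≤ Ns ∧
      QCELS.ThetaTilde c C k (1 + Real.log (p₀⁻¹ * δ⁻¹ * η⁻¹ * ε⁻¹) + Real.log (1 + Δ⁻¹))
        ((p₀ ^ 2)⁻¹ * δ ^ (-(2 + ζ))) (N * Ns) ∧
      ((p₀ ^ 2)⁻¹ ≤ δ ^ (-(2 + ζ)) →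
        QCELS.ThetaTilde c C k (1 + Real.log (p₀⁻¹ * δ⁻¹ * η⁻¹ * ε⁻¹) + Real.log (1 + Δ⁻¹))
          (p₀ ^ 2)⁻¹ (min N Ns : ℕ)) ∧
      (∀ lamPrior ∈ Set.Icc (-Real.pi) (Real.pi - Δ),
        QCELS.IsFilter (F lamPrior) q lamPrior Δ) ∧
      -- the cost of the rough estimation
      QCELS.ThetaTilde c C k (1 + Real.log (p₀⁻¹ * η⁻¹) + Real.log (1 + Δ⁻¹))
        Δ⁻¹ A.maxTime ∧
      QCELS.ThetaTilde c C k (1 + Real.log (p₀⁻¹ * η⁻¹) + Real.log (1 + Δ⁻¹))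
        (Δ⁻¹ * (p₀ ^ 2)⁻¹) A.totalTime ∧
      -- the cost of the construction of the loss functions
      QCELS.lossMaxTime (QCELS.numLevels ε) N d (QCELS.timeStep δ ε N)
        = d + (1 - 1 / (N : ℝ)) * (δ / ε) ∧
      QCELS.ThetaTilde c C k (1 + Real.log (p₀⁻¹ * δ⁻¹ * η⁻¹ * ε⁻¹) + Real.log (1 + Δ⁻¹))
        ((p₀ ^ 2)⁻¹ * δ ^ (-(2 + ζ)) * (Δ⁻¹ + δ / ε))
        (QCELS.lossTotalTime (QCELS.numLevels ε) N Ns d (QCELS.timeStep δ ε N)) ∧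
      -- correctness for all Hamiltonians and initial states with these parameters
      ∀ (M : ℕ) (H : Matrix (Fin (M + 2)) (Fin (M + 2)) ℂ) (lam : Fin (M + 2) → ℝ)
        (v : OrthonormalBasis (Fin (M + 2)) ℂ (QCELS.Sys (M + 2))) (ψ : QCELS.Sys (M + 2)),
        H.IsHermitian → Monotone lam →
        (∀ m, Matrix.toEuclideanLin H (v m) = (lam m : ℂ) • v m) →
        (∀ m, lam m ∈ QCELS.spectralRange Δ) → lam 1 - lam 0 = Δ →
        ‖ψ‖ = 1 → ‖inner ℂ (v 0) ψ‖ ^ 2 = p₀ →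
        -- the whole algorithm
        1 - η ≤ QCELS.prob
          (fun ω : A.Data × QCELS.FilteredData (QCELS.numLevels ε) N Ns d =>
            A.dataProb H ψ ω.1 *
              QCELS.filteredDataProb H ψ (QCELS.timeStep δ ε N) (F (A.estimate ω.1)) ω.2)
          (fun ω => |A.estimate ω.1 - lam 0| ≤ Δ / 4 ∧
            QCELS.Succeeds (QCELS.timeStep δ ε N)
              (QCELS.dataPoint (F (A.estimate ω.1)) ω.2) ε (lam 0)) ∧
        -- the second stage alone, from any admissible rough estimate
        ∀ lamPrior : ℝ, |lamPrior - lam 0| ≤ Δ / 4 →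
          1 - η ≤ QCELS.prob
            (fun ω : QCELS.FilteredData (QCELS.numLevels ε) N Ns d =>
              QCELS.filteredDataProb H ψ (QCELS.timeStep δ ε N) (F lamPrior) ω)
            (fun ω => QCELS.Succeeds (QCELS.timeStep δ ε N)
              (QCELS.dataPoint (F lamPrior) ω) ε (lam 0)) := by
  set K : ℝ := 26542080000 * (7 + ζ) with hK
  have hK0 : 185794560000 ≤ K := by rw [hK]; linarith
  -- The lower constant comes from q. The upper one, 14400 = 2 · 6 · 2 · 600, and the exponent 5 = 1
  -- + 3 + 1 come from the total time: levels, samples and degree carry 1, 3 and 1 powers of `L₂`.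
  refine ⟨1 / 800, 14400 * (K + 1), 5, by norm_num, by positivity, ?_⟩
  intro Δ p₀ δ η ε hΔ hΔ2 hp₀ hp₀1 hδ hδ1 hη hη1 hε hε2
  have hε1 : ε < 1 := by linarith
  have hΔi : 0 < Δ⁻¹ := by positivity
  have hlp : 0 ≤ Real.log p₀⁻¹ := Real.log_nonneg (by rw [one_le_inv₀ hp₀]; exact hp₀1)
  have hlδ : 0 ≤ Real.log δ⁻¹ := Real.log_nonneg (by rw [one_le_inv₀ hδ]; exact hδ1.le)
  have hlη : 0 ≤ Real.log η⁻¹ := Real.log_nonneg (by rw [one_le_inv₀ hη]; exact hη1.le)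
  have hlε : 0 ≤ Real.log ε⁻¹ := Real.log_nonneg (by rw [one_le_inv₀ hε]; exact hε1.le)
  have hlΔ : 0 ≤ Real.log (1 + Δ⁻¹) := Real.log_nonneg (by linarith)
  have e₀ : Real.log (p₀⁻¹ * δ⁻¹) = Real.log p₀⁻¹ + Real.log δ⁻¹ :=
    Real.log_mul (by positivity) (by positivity)
  have e₁ : Real.log (p₀⁻¹ * η⁻¹) = Real.log p₀⁻¹ + Real.log η⁻¹ :=
    Real.log_mul (by positivity) (by positivity)
  have e₂ : Real.log (p₀⁻¹ * δ⁻¹ * η⁻¹ * ε⁻¹)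
      = Real.log p₀⁻¹ + Real.log δ⁻¹ + Real.log η⁻¹ + Real.log ε⁻¹ := by
    rw [Real.log_mul (by positivity) (by positivity), Real.log_mul (by positivity) (by positivity),
      e₀]
  set L₀ := 1 + Real.log (p₀⁻¹ * δ⁻¹) with hL₀
  set L₁ := 1 + Real.log (p₀⁻¹ * η⁻¹) + Real.log (1 + Δ⁻¹) with hL₁
  set L₂ := 1 + Real.log (p₀⁻¹ * δ⁻¹ * η⁻¹ * ε⁻¹) + Real.log (1 + Δ⁻¹) with hL₂
  have hL₀1 : 1 ≤ L₀ := by linarith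
  have hL₁1 : 1 ≤ L₁ := by linarith
  have hL₂1 : 1 ≤ L₂ := by linarith
  have hL₀₂ : L₀ ≤ L₂ := by linarith
  have hpi : 1 ≤ (p₀ ^ 2)⁻¹ := by
    rw [one_le_inv₀ (by positivity)]; nlinarith
  set P := (p₀ ^ 2)⁻¹ with hP
  have hPp : P * p₀ ^ 2 = 1 := inv_mul_cancel₀ (by positivity)
  set x := δ ^ (-(2 + ζ)) with hx
  have hx1 : 1 ≤ x := QCELS.one_le_rpow_neg hζ hδ hδ1
  set q := p₀ * δ ^ 2 / 800 with hq
  have hq0 : 0 < q := by positivity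
  set N := QCELS.numPoints ζ δ with hN
  -- All logarithms go into the number of samples per point, so N stays comparable to δ^(-(2+ζ))
  -- without logarithms.
  set Ns := ⌈K * L₂ ^ 3 * P⌉₊ with hNs
  set n := ⌈18579456 * L₁ ^ 3 * P⌉₊ with hn
  have hN4 : 4 ≤ N := QCELS.four_le_numPoints hζ hδ hδ1
  have hNle : (N : ℝ) ≤ 6 * x := QCELS.numPoints_le hζ hδ hδ1
  have hNge : 4 * x ≤ N := QCELS.le_numPoints ζ δ
  have hL₂3 : 1 ≤ L₂ ^ 3 := one_le_pow₀ hL₂1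
  have hL₁3 : 1 ≤ L₁ ^ 3 := one_le_pow₀ hL₁1
  have hNsge : K * L₂ ^ 3 * P ≤ Ns := Nat.le_ceil _
  have hnge : 18579456 * L₁ ^ 3 * P ≤ n := Nat.le_ceil _
  have hNsle : (Ns : ℝ) ≤ (K + 1) * P * L₂ ^ 3 := by
    refine (QCELS.nat_ceil_mul_le (by positivity) hpi).trans ?_
    have : (K * L₂ ^ 3 + 1) * P ≤ (K * L₂ ^ 3 + L₂ ^ 3) * P := by gcongr
    linarith
  have hnle : (n : ℝ) ≤ 18579457 * P * L₁ ^ 3 := by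
    refine (QCELS.nat_ceil_mul_le (by positivity) hpi).trans ?_
    have : (18579456 * L₁ ^ 3 + 1) * P ≤ (18579456 * L₁ ^ 3 + L₁ ^ 3) * P := by gcongr
    linarith
  have hNsP : P ≤ Ns := by
    refine le_trans ?_ hNsge
    have : 1 ≤ K * L₂ ^ 3 := one_le_mul_of_one_le_of_one_le (by linarith) hL₂3
    exact le_mul_of_one_le_left (by positivity) this
  have hnP : P ≤ n := by
    refine le_trans ?_ hnge
    exact le_mul_of_one_le_left (by positivity) (by linarith)
  set d := QCELS.filterPower q * QCELS.filterBase (Δ / 4) with hd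
  have hdge : Δ⁻¹ ≤ (d : ℝ) := QCELS.inv_le_degree hΔ (by norm_num)
  have hdle : (d : ℝ) ≤ 600 * L₀ * Δ⁻¹ := QCELS.degree_le hΔ hΔ2 hp₀ hp₀1 hδ hδ1
  have hrge : Δ⁻¹ ≤ (QCELS.roughDegree Δ p₀ : ℝ) := QCELS.inv_le_degree hΔ (by norm_num)
  have hrle : (QCELS.roughDegree Δ p₀ : ℝ) ≤ 600 * Δ⁻¹ * L₁ := by
    refine (QCELS.roughDegree_le hΔ hΔ2 hp₀ hp₀1).trans ?_
    have : (1 + Real.log p₀⁻¹) * Δ⁻¹ ≤ L₁ * Δ⁻¹ := by gcongr; linarith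
    linarith
  have hJ := QCELS.numLevels_le hε hε1
  refine ⟨QCELS.roughEstimator Δ p₀ n, d, N, Ns, q,
    fun lamPrior => QCELS.stepFilter (QCELS.filterPower q) (QCELS.filterBase (Δ / 4))
      (lamPrior + Δ / 2), ?_, ?_, ?_, by omega, ?_, ?_, ?_, ?_, ?_, ?_, ?_, ?_, ?_⟩
  · refine QCELS.ThetaTilde.of_le (a := 1) (b := 600) (j := 1) hΔi.le hL₀1 (by norm_num)
      (by linarith) (by norm_num) (by norm_num) (by linarith) ?_
    linarith
  · rw [hq]; linarith
  · rw [hq]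
    have : 1 / 800 * (p₀ * δ ^ 2) ≤ 14400 * (K + 1) * (p₀ * δ ^ 2) := by
      gcongr; linarith
    linarith
  · linarith
  · refine QCELS.ThetaTilde.of_le (a := 1) (b := 6 * (K + 1)) (j := 3) (by positivity) hL₂1
      (by norm_num) (by linarith) (by positivity) (by norm_num) ?_ ?_
    · rw [one_mul, mul_comm]
      exact mul_le_mul (by linarith) hNsP (by positivity) (by positivity)
    · calc (N : ℝ) * Ns ≤ (6 * x) * ((K + 1) * P * L₂ ^ 3) :=
            mul_le_mul hNle hNsle (by positivity) (by positivity)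
        _ = _ := by ring
  · intro hPx
    refine QCELS.ThetaTilde.of_le (a := 1) (b := K + 1) (j := 3) (by positivity) hL₂1
      (by norm_num) (by linarith) (by positivity) (by norm_num) ?_ ?_
    · rw [one_mul, Nat.cast_min]
      exact le_min (by linarith) hNsP
    · rw [Nat.cast_min]
      exact (min_le_right _ _).trans hNsle
  · intro lamPrior hl
    exact QCELS.isFilter_stepFilter hΔ hq0 hl
  · rw [QCELS.maxTime_roughEstimator]
    refine QCELS.ThetaTilde.of_le (a := 1) (b := 600) (j := 1) hΔi.le hL₁1 (by norm_num)
      (by linarith) (by norm_num) (by norm_num) (by linarith) ?_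
    linarith
  · rw [QCELS.totalTime_roughEstimator]
    refine QCELS.ThetaTilde.of_le (a := 1) (b := 1200 * 18579457) (j := 4) (by positivity) hL₁1
      (by norm_num) (by linarith) (by norm_num) (by norm_num) ?_ ?_
    · have := mul_le_mul hnP hrge hΔi.le (by positivity)
      have h0 : 0 ≤ P * Δ⁻¹ := by positivity
      linarith
    · calc 2 * (n : ℝ) * (QCELS.roughDegree Δ p₀ : ℝ)
          ≤ 2 * (18579457 * P * L₁ ^ 3) * (600 * Δ⁻¹ * L₁) := by gcongr
        _ = _ := by ring
  · exact QCELS.lossMaxTime_eq d hδ hε (by omega)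
  · refine QCELS.ThetaTilde.of_le (a := 1 / 2) (b := 14400 * (K + 1)) (j := 5) (by positivity) hL₂1
      (by norm_num) le_rfl (by positivity) le_rfl ?_ ?_
    · refine le_trans ?_ (QCELS.le_lossTotalTime Ns d hδ hε (by omega))
      have h1 : P * x ≤ N * Ns := by
        rw [mul_comm]
        exact mul_le_mul (by linarith) hNsP (by positivity) (by positivity)
      have h2 : P * x * (Δ⁻¹ + δ / ε) ≤ N * Ns * (d + δ / ε) := by gcongr
      linarith
    · refine (QCELS.lossTotalTime_le Ns d hδ hε (by omega)).trans ?_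
      have h1 : (d : ℝ) + δ / ε ≤ 600 * L₂ * (Δ⁻¹ + δ / ε) := by
        have h2 : 600 * L₀ * Δ⁻¹ ≤ 600 * L₂ * Δ⁻¹ := by gcongr
        have h3 : δ / ε ≤ 600 * L₂ * (δ / ε) :=
          le_mul_of_one_le_left (by positivity) (by linarith)
        linarith
      have hJ' : (QCELS.numLevels ε : ℝ) ≤ 2 * L₂ := by linarith
      calc (QCELS.numLevels ε : ℝ) * (N * (2 * Ns * (d + δ / ε)))
          ≤ 2 * L₂ * ((6 * x) * (2 * ((K + 1) * P * L₂ ^ 3) *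
              (600 * L₂ * (Δ⁻¹ + δ / ε)))) := by gcongr
        _ = _ := by ring
  · intro M H lam v ψ _ hmono heig hlam hgap hψ hov
    have hg := QCELS.measures_signal heig hψ
    have hp : ∀ m, 0 ≤ ‖inner ℂ (v m) ψ‖ ^ 2 := fun m => sq_nonneg _
    have hp1 : ∑ m, ‖inner ℂ (v m) ψ‖ ^ 2 = 1 := by
      rw [v.sum_sq_norm_inner_right, hψ, one_pow]
    have hNsK : K * L₂ ^ 3 ≤ Ns * p₀ ^ 2 := by
      have := mul_le_mul_of_nonneg_right hNsge (sq_nonneg p₀)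
      rwa [mul_assoc, hPp, mul_one] at this
    have hnK : 18579456 * L₁ ^ 3 ≤ n * p₀ ^ 2 := by
      have := mul_le_mul_of_nonneg_right hnge (sq_nonneg p₀)
      rwa [mul_assoc, hPp, mul_one] at this
    have hsecond := fun lamPrior => QCELS.one_sub_le_prob_second hg hp hp1 hov hmono hlam hgap hζ hΔ
      hΔ2 hp₀ hp₀1 hδ hδ1 hη hη1 hε hε1 (L := L₂) (by linarith) hNsK (lamPrior := lamPrior)
    refine ⟨?_, fun lamPrior hl => ?_⟩
    -- Each stage is allowed failure probability η/2.
    · have hfirst := QCELS.one_sub_le_prob_first hg hp hp1 hov hmono hlam hΔ hΔ2 hp₀ hp₀1 hη hη1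
        (L := L₁) (by linarith) hnK
      have h := QCELS.one_sub_le_prob_prod (a := η / 2) (b := η / 2) QCELS.dataProb_nonneg
        (by positivity) (by positivity) (by linarith) hfirst fun ω hω => hsecond _ hω
      rwa [add_halves] at h
    · exact le_trans (by linarith) (hsecond lamPrior hl)
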